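/- Let $s\in(0,1)$, let $n\ge 1$ be an integer with $n>2s$, put $2^*:=\frac{2n}{n-2s}$, and let $\Omega\subset\mathbb R^n$ be non-empty, open and bounded, with Lipschitz boundary. Let $K:\mathbb R^n\setminus\{0\}\to(0,+\infty)$ be such that $x\mapsto\min\{|x|^2,1\}K(x)$ belongs to $L^1(\mathbb R^n)$ and, for some $k_0>0$, $K(x)\ge k_0|x|^{-(n+2s)}$ for all $x\ne 0$. Put $$\mathcal L_Ku(x):=\int_{\mathbb R^n}\bigl(u(x+y)+u(x-y)-2u(x)\bigr)K(y)\,dy .$$ Let $\Omega^c:=\mathbb R^n\setminus\Omega$ and $Q:=\mathbb R^{2n}\setminus(\Omega^c\times\Omega^c)$. Let $X_0$ be the space of Lebesgue measurable $u:\mathbb R^n\to\mathbb R$ such that $u|_\Omega\in L^2(\Omega)$, $(x,y)\mapsto(u(x)-u(y))\sqrt{K(x-y)}$ is in $L^2(Q)$, and $u=0$ a.e. in $\Omega^c$ (functions equal a.e. being identified), with $$\langle u,v\rangle:=\int_Q(u(x)-u(y))(v(x)-v(y))K(x-y)\,dx\,dy,\qquad \|u\|:=\langle u,u\rangle^{1/2},\qquad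 c_{2^*}:=\sup_{u\in X_0\setminus\{0\}}\frac{\|u\|_{L^{2^*}(\mathbb R^n)}}{\|u\|}.$$ Let $r\in(0,1)$ and let $g:[0,+\infty)\to[0,+\infty)$ be continuous with $g(t)\le a_1+a_2t^{q-1}$ for all $t\ge0$, where $a_1,a_2\ge0$ and $q\in[1,2^*)$. For $\mu>0$ and $t\ge0$ put $$k_\mu(t):=\frac{t^{2-r}-\mu c_{2^*}^{2^*}t^{2^*-r}}{c_{2^*}^r|\Omega|^{\frac{2^*-r}{2^*}}+a_1c_{2^*}|\Omega|^{\frac{2^*-1}{2^*}}t^{1-r}+a_2c_{2^*}^q|\Omega|^{\frac{2^*-q}{2^*}}t^{q-r}} .$$ Then for every $\mu>0$ the maximum of $k_\mu$ on $[0,+\infty)$ exists and there is a non-empty open interval $\Lambda_\mu\subseteq\bigl(0,\max_{[0,+\infty)}k_\mu\bigr)$ such that, for every $\lambda\in\Lambda_\mu$, the problem $$-\mathcal L_Ku=\mu u^{2^*-1}+\lambda\bigl(u^{r-1}+g(u)\bigr)\ \text{ in }\Omega,\qquad u>0\ \text{ in }\Omega,\qquad u=0\ \text{ in }\mathbb R^n\setminus\Omega$$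 has a weak solution $u\in X_0$, that is: $u>0$ a.e. in $\Omega$; $u^{r-1}v\in L^1(\Omega)$ for every $v\in X_0$; and $$\langle u,v\rangle-\mu\int_\Omega u^{2^*-1}v\,dx-\lambda\int_\Omega\bigl(u^{r-1}+g(u)\bigr)v\,dx=0\quad\text{for every }v\in X_0 .$$ Moreover, $u$ can be chosen to be a local minimizer on $(X_0,\|\cdot\|)$ of the energy $$\mathcal E_{\lambda,\mu}(w)=\tfrac12\|w\|^2-\frac{\mu}{2^*}\int_\Omega(w^+)^{2^*}dx-\frac{\lambda}{r}\int_\Omega(w^+)^r\,dx-\lambda\int_\Omega G(w^+)\,dx,\qquad G(t):=\int_0^tg(\tau)\,d\tau,\quad w^+:=\max\{w,0\}.$$ -/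

import Mathlib

open MeasureTheory Set Filter
open scoped ENNReal NNReal

noncomputable section

namespace NonlocalCritical

/-- The boundary of `Ω` is Lipschitz: around each boundary point there are a direction `e` and a
Lipschitz function `φ` of the component of `y` orthogonal to `e` such that, locally, `Ω` is the set
of points lying strictly above the graph of `φ` in direction `e`. -/
def HasLipschitzBoundary {n : ℕ} (Ω : Set (EuclideanSpace ℝ (Fin n))) : Prop :=
  ∀ x ∈ frontier Ω, ∃ e : EuclideanSpace ℝ (Fin n), ‖e‖ = 1 ∧
    ∃ (C : ℝ≥0) (φ : EuclideanSpace ℝ (Fin n) → ℝ), LipschitzWith C φ ∧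
      ∃ ρ : ℝ, 0 < ρ ∧ ∀ y ∈ Metric.ball x ρ,
        (y ∈ Ω ↔ φ (y - (inner ℝ e y) • e) < inner ℝ e y)

/-- The fractional critical exponent `2^* = 2n / (n - 2s)`. -/
def twoStar (n : ℕ) (s : ℝ) : ℝ := 2 * n / (n - 2 * s)

/-- `Q = ℝ²ⁿ \ (Ωᶜ × Ωᶜ)`. -/
def Q {n : ℕ} (Ω : Set (EuclideanSpace ℝ (Fin n))) :
    Set (EuclideanSpace ℝ (Fin n) × EuclideanSpace ℝ (Fin n)) :=
  (Ωᶜ ×ˢ Ωᶜ)ᶜ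

/-- The space `X`: Lebesgue measurable functions `u`, square integrable on `Ω`, for which
`(x, y) ↦ (u x - u y) √K(x - y)` is square integrable on `Q`. -/
def X {n : ℕ} (K : EuclideanSpace ℝ (Fin n) → ℝ) (Ω : Set (EuclideanSpace ℝ (Fin n))) :
    Set (EuclideanSpace ℝ (Fin n) → ℝ) :=
  {u | AEStronglyMeasurable u volume ∧
    MemLp u 2 (volume.restrict Ω) ∧
    MemLp (fun p : EuclideanSpace ℝ (Fin n) × EuclideanSpace ℝ (Fin n) =>
      (u p.1 - u p.2) * √(K (p.1 - p.2))) 2 (volume.restrict (Q Ω))}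

/-- The space `X₀`: elements of `X` vanishing almost everywhere outside `Ω`
(functions, rather than classes of functions modulo almost everywhere equality). -/
def X₀ {n : ℕ} (K : EuclideanSpace ℝ (Fin n) → ℝ) (Ω : Set (EuclideanSpace ℝ (Fin n))) :
    Set (EuclideanSpace ℝ (Fin n) → ℝ) :=
  {u | u ∈ X K Ω ∧ ∀ᵐ x ∂(volume.restrict Ωᶜ), u x = 0}

/-- The scalar product of `X₀`. -/
def inner₀ {n : ℕ} (K : EuclideanSpace ℝ (Fin n) → ℝ) (Ω : Set (EuclideanSpace ℝ (Fin n)))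
    (u v : EuclideanSpace ℝ (Fin n) → ℝ) : ℝ :=
  ∫ p in Q Ω, (u p.1 - u p.2) * (v p.1 - v p.2) * K (p.1 - p.2)

/-- The norm of `X₀`. -/
def norm₀ {n : ℕ} (K : EuclideanSpace ℝ (Fin n) → ℝ) (Ω : Set (EuclideanSpace ℝ (Fin n)))
    (u : EuclideanSpace ℝ (Fin n) → ℝ) : ℝ :=
  √(∫ p in Q Ω, |u p.1 - u p.2| ^ 2 * K (p.1 - p.2))

/-- The best constant `c_p` of the embedding `X₀ ↪ L^p(ℝⁿ)`: the supremum of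
`‖u‖_{L^p(ℝⁿ)} / ‖u‖_{X₀}` over the elements `u` of `X₀` that are nonzero (that is, not almost
everywhere zero). The supremum is taken in `[0, ∞]` and then read as a real number. -/
def embConst {n : ℕ} (K : EuclideanSpace ℝ (Fin n) → ℝ) (Ω : Set (EuclideanSpace ℝ (Fin n)))
    (p : ℝ) : ℝ :=
  (⨆ (u : EuclideanSpace ℝ (Fin n) → ℝ) (_ : u ∈ X₀ K Ω) (_ : ¬ u =ᵐ[volume] 0),
    eLpNorm u (ENNReal.ofReal p) volume / ENNReal.ofReal (norm₀ K Ω u)).toReal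

/-- The rational function `k_μ`. -/
def kFun {n : ℕ} (s : ℝ) (K : EuclideanSpace ℝ (Fin n) → ℝ)
    (Ω : Set (EuclideanSpace ℝ (Fin n))) (r a₁ a₂ q μ t : ℝ) : ℝ :=
  (t ^ (2 - r) - μ * embConst K Ω (twoStar n s) ^ twoStar n s * t ^ (twoStar n s - r)) /
    (embConst K Ω (twoStar n s) ^ r * volume.real Ω ^ ((twoStar n s - r) / twoStar n s)
      + a₁ * embConst K Ω (twoStar n s)
        * volume.real Ω ^ ((twoStar n s - 1) / twoStar n s) * t ^ (1 - r)
      + a₂ * embConst K Ω (twoStar n s) ^ q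
        * volume.real Ω ^ ((twoStar n s - q) / twoStar n s) * t ^ (q - r))

/-- Weak solutions of the singular critical problem
`-L_K u = μ u^{2^*-1} + lam (u^{r-1} + g u)`, `u > 0` in `Ω`, `u = 0` in `ℝⁿ \ Ω`. -/
structure IsWeakSolution {n : ℕ} (s : ℝ) (K : EuclideanSpace ℝ (Fin n) → ℝ)
    (Ω : Set (EuclideanSpace ℝ (Fin n))) (r : ℝ) (g : ℝ → ℝ) (lam μ : ℝ)
    (u : EuclideanSpace ℝ (Fin n) → ℝ) : Prop where
  mem : u ∈ X₀ K Ω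
  pos : ∀ᵐ x ∂(volume.restrict Ω), 0 < u x
  integrable : ∀ v ∈ X₀ K Ω, IntegrableOn (fun x => u x ^ (r - 1) * v x) Ω volume
  weak : ∀ v ∈ X₀ K Ω,
    inner₀ K Ω u v - μ * (∫ x in Ω, u x ^ (twoStar n s - 1) * v x)
      - lam * (∫ x in Ω, (u x ^ (r - 1) + g (u x)) * v x) = 0

/-- The energy of the singular critical problem; `max (u x) 0` is the positive part of `u`. -/
def energy {n : ℕ} (s : ℝ) (K : EuclideanSpace ℝ (Fin n) → ℝ)
    (Ω : Set (EuclideanSpace ℝ (Fin n))) (r : ℝ) (g : ℝ → ℝ) (lam μ : ℝ)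
    (u : EuclideanSpace ℝ (Fin n) → ℝ) : ℝ :=
  1 / 2 * norm₀ K Ω u ^ 2
    - μ / twoStar n s * (∫ x in Ω, max (u x) 0 ^ twoStar n s)
    - lam / r * (∫ x in Ω, max (u x) 0 ^ r)
    - lam * (∫ x in Ω, (∫ τ in (0 : ℝ)..(max (u x) 0), g τ))

/-- `u` is a local minimizer of `J` in `X₀`, with respect to the norm of `X₀`. -/
def IsLocalMinimizer {n : ℕ} (K : EuclideanSpace ℝ (Fin n) → ℝ)
    (Ω : Set (EuclideanSpace ℝ (Fin n))) (J : (EuclideanSpace ℝ (Fin n) → ℝ) → ℝ)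
    (u : EuclideanSpace ℝ (Fin n) → ℝ) : Prop :=
  u ∈ X₀ K Ω ∧ ∃ δ : ℝ, 0 < δ ∧ ∀ v ∈ X₀ K Ω, norm₀ K Ω (v - u) < δ → J u ≤ J v

end NonlocalCritical

end

noncomputable section

namespace NonlocalCritical

open scoped Topology

/-! The solution is a minimiser of the energy over the nonnegative functions in a small ball of
`X₀`, and $\lambda$ is taken small.

Existence. The critical power is not compact, but its convexity defect at a midpoint is at most
quadratic in $\|a-b\|$, with a constant that tends to $0$ with the radius
(`rpow_midpoint_defect_le`, `HasSobolevBound.integral_midpoint_defect_le`). On a small ball the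
parallelogram law for $\frac12\|\cdot\|^2$ absorbs this defect, so the energy is uniformly convex up
to its subcritical part (`HasSobolevBound.norm₀_sub_sq_le`). That part is controlled by the
$L^2(\Omega)$ distance, and bounded sequences of `X₀` have $L^2(\Omega)$-Cauchy subsequences. A
minimising sequence therefore has a subsequence that is Cauchy in norm, and its strong limit is a
minimiser; no weak topology is needed. The ingredients are a fractional Sobolev inequality,
compactness in $L^2$ and completeness. For small $\lambda$ the energy is positive on the sphere of
radius $\rho$ and vanishes at $0$, so the minimiser is interior.

Equation. The term $u^{r-1}$ makes the energy non-differentiable, so only one-sided comparisons are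
available. Moving from $u$ in a positive direction by $t$ would gain $t^r\gg t$ where $u=0$, hence
$u>0$ a.e. (`IsInteriorMinimizer.ae_pos`). Fatou's lemma then gives $\int f(u)v\le\langle
u,v\rangle$ for $v\ge0$, where $f(u)$ is the right-hand side of the equation, and comparison with
$(1-t)u$ gives $\|u\|^2\le\int f(u)u$. Testing the first inequality with $(ku-v)^+$ and letting
$k\to\infty$ turns it into an equality.

Local minimality. Replacing $w$ by $w^+$ does not increase the energy, so minimality among
nonnegative functions extends to a full ball about $u$. The interval of parameters has left endpoint
$0$; $k_\mu$ enters only through the positivity of its maximum. -/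

/-! ### Elementary inequalities for real powers -/

theorem rpow_tangent_le {p a b : ℝ} (hp : 1 < p) (ha : 0 ≤ a) (hb : 0 ≤ b) :
    p * a ^ (p - 1) * (b - a) ≤ b ^ p - a ^ p := by
  rcases ha.eq_or_lt with rfl | ha
  · rw [Real.zero_rpow (by linarith), Real.zero_rpow (by linarith)]
    simpa using Real.rpow_nonneg hb p
  · have h := one_add_mul_self_le_rpow_one_add (s := b / a - 1) (p := p)
      (by have : 0 ≤ b / a := by positivity
          linarith) hp.le
    rw [add_sub_cancel, Real.div_rpow hb ha.le, le_div_iff₀ (by positivity)] at h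
    have h2 : a ^ p = a ^ (p - 1) * a := by
      rw [← Real.rpow_add_one ha.ne', sub_add_cancel]
    have h3 : (1 + p * (b / a - 1)) * a ^ p = a ^ p + p * a ^ (p - 1) * (b - a) := by
      rw [h2]; field_simp
    linarith

/-- The convexity defect of `t ↦ t ^ p` at a midpoint is at most quadratic in the distance. -/
theorem rpow_midpoint_defect_le {p a b : ℝ} (hp : 2 < p) (ha : 0 ≤ a) (hb : 0 ≤ b) :
    (a ^ p + b ^ p) / 2 - ((a + b) / 2) ^ p
      ≤ p * (p - 1) / 4 * ((a - b) ^ 2 * (a + b) ^ (p - 2)) := by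
  wlog hab : a ≤ b generalizing a b
  · have := this hb ha (not_le.1 hab).le
    convert this using 2
    · ring
    · rw [add_comm]
    · ring_nf
  have hm : 0 ≤ (a + b) / 2 := by linarith
  -- The tangent inequalities at $a$ and $b$, evaluated at the midpoint, bound the defect by $\frac
  -- p4(b-a)(b^{p-1}-a^{p-1})$; a third one, for the exponent $p-1$, bounds the last factor.
  have h1 := rpow_tangent_le (p := p) (by linarith) hb hm
  have h2 := rpow_tangent_le (p := p) (by linarith) ha hm
  have h3 := rpow_tangent_le (p := p - 1) (by linarith) hb ha
  have h4 : b ^ (p - 1 - 1) ≤ (a + b) ^ (p - 2) := by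
    rw [show p - 1 - 1 = p - 2 by ring]
    exact Real.rpow_le_rpow hb (by linarith) (by linarith)
  have h5 : (p - 1) * (b ^ (p - 1 - 1) * (b - a)) ≤ (p - 1) * ((a + b) ^ (p - 2) * (b - a)) := by
    gcongr
    linarith
  have h6 : b ^ (p - 1) - a ^ (p - 1) ≤ (p - 1) * ((a + b) ^ (p - 2) * (b - a)) := by
    linarith
  have h7 : p * ((b - a) / 4) * (b ^ (p - 1) - a ^ (p - 1))
      ≤ p * ((b - a) / 4) * ((p - 1) * ((a + b) ^ (p - 2) * (b - a))) := by
    have : 0 ≤ b - a := by linarith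
    gcongr
  nlinarith

/-- The threshold $T$ solves $T^{q-p}=\varepsilon$: below it $t^q\le T^q$, above it
$t^q=t^{q-p}t^p\le\varepsilon t^p$. -/
theorem rpow_le_const_add_mul_rpow {p q ε : ℝ} (hq : 0 ≤ q) (hqp : q < p) (hε : 0 < ε) :
    ∃ C : ℝ, 0 ≤ C ∧ ∀ t : ℝ, 0 ≤ t → t ^ q ≤ C + ε * t ^ p := by
  set T : ℝ := ε ^ (1 / (q - p)) with hT
  have hT0 : 0 < T := Real.rpow_pos_of_pos hε _
  refine ⟨T ^ q, by positivity, fun t ht => ?_⟩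
  rcases le_total t T with h | h
  · have : t ^ q ≤ T ^ q := Real.rpow_le_rpow ht h hq
    have : 0 ≤ ε * t ^ p := by positivity
    linarith
  · have ht0 : 0 < t := hT0.trans_le h
    have h1 : t ^ (q - p) ≤ ε := by
      calc t ^ (q - p) ≤ T ^ (q - p) := Real.rpow_le_rpow_of_nonpos hT0 h (by linarith)
        _ = ε := by
          rw [hT, ← Real.rpow_mul hε.le, one_div, inv_mul_cancel₀ (by linarith), Real.rpow_one]
    have h2 : t ^ q = t ^ (q - p) * t ^ p := by
      rw [← Real.rpow_add ht0]; ring_nf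
    have h3 : t ^ (q - p) * t ^ p ≤ ε * t ^ p := by gcongr
    have : 0 ≤ T ^ q := by positivity
    linarith

/-- A continuous function of growth less than `t ^ p` has a modulus of continuity which is
quadratic up to a small multiple of `1 + a ^ p + b ^ p`. -/
theorem abs_sub_le_of_subcritical {p ε : ℝ} {H : ℝ → ℝ} (hp : 0 < p) (hH : ContinuousOn H (Ici 0))
    (hsub : ∀ ε : ℝ, 0 < ε → ∃ C : ℝ, 0 ≤ C ∧ ∀ t : ℝ, 0 ≤ t → |H t| ≤ C + ε * t ^ p)
    (hε : 0 < ε) :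
    ∃ C : ℝ, 0 ≤ C ∧ ∀ a b : ℝ, 0 ≤ a → 0 ≤ b →
      |H a - H b| ≤ ε * (1 + a ^ p + b ^ p) + C * (a - b) ^ 2 := by
  obtain ⟨C', hC', hg⟩ := hsub (ε / 2) (by positivity)
  -- With $R^p=4C'/\varepsilon$, the growth bound alone suffices as soon as $a$ or $b$ is at least
  -- $R$. On $[0,R]$, uniform continuity handles $|a-b|<\delta$, and for $|a-b|\ge\delta$ the crude
  -- bound $M$ is at most $M(a-b)^2/\delta^2$.
  set R : ℝ := (4 * C' / ε) ^ (1 / p) with hR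
  have hR0 : 0 ≤ R := by positivity
  have hRp : R ^ p = 4 * C' / ε := by
    rw [hR, ← Real.rpow_mul (by positivity), one_div, inv_mul_cancel₀ hp.ne', Real.rpow_one]
  have hcont : ContinuousOn H (Icc 0 R) := hH.mono Icc_subset_Ici_self
  have huc := (isCompact_Icc (a := (0 : ℝ)) (b := R)).uniformContinuousOn_of_continuous hcont
  obtain ⟨δ, hδ, hδ'⟩ := Metric.uniformContinuousOn_iff.1 huc ε hε
  set M : ℝ := 2 * C' + ε * R ^ p with hM
  have hM0 : 0 ≤ M := by positivity
  refine ⟨M / δ ^ 2, by positivity, fun a b ha hb => ?_⟩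
  have ha' : 0 ≤ a ^ p := by positivity
  have hb' : 0 ≤ b ^ p := by positivity
  have hab : |H a - H b| ≤ 2 * C' + ε / 2 * (a ^ p + b ^ p) := by
    have := abs_sub (H a) (H b)
    have := hg a ha
    have := hg b hb
    linarith
  by_cases hbig : R ≤ a ∨ R ≤ b
  · have h1 : 4 * C' / ε ≤ a ^ p + b ^ p := by
      rw [← hRp]
      rcases hbig with h | h
      · have := Real.rpow_le_rpow hR0 h hp.le
        linarith
      · have := Real.rpow_le_rpow hR0 h hp.le
        linarith
    rw [div_le_iff₀ hε] at h1
    have : 0 ≤ M / δ ^ 2 * (a - b) ^ 2 := by positivity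
    nlinarith
  · push Not at hbig
    by_cases hd : |a - b| < δ
    · have := hδ' a ⟨ha, hbig.1.le⟩ b ⟨hb, hbig.2.le⟩ (by rwa [Real.dist_eq])
      rw [Real.dist_eq] at this
      have h2 : 0 ≤ M / δ ^ 2 * (a - b) ^ 2 := by positivity
      nlinarith
    · have h1 : δ ^ 2 ≤ (a - b) ^ 2 := by
        rw [← sq_abs (a - b)]
        gcongr
        exact not_lt.1 hd
      have h2 : M ≤ M / δ ^ 2 * (a - b) ^ 2 := by
        rw [div_mul_eq_mul_div, le_div_iff₀ (by positivity)]
        gcongr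
      have h3 : a ^ p ≤ R ^ p := Real.rpow_le_rpow ha hbig.1.le hp.le
      have h4 : b ^ p ≤ R ^ p := Real.rpow_le_rpow hb hbig.2.le hp.le
      have h5 : ε / 2 * (a ^ p + b ^ p) ≤ ε * R ^ p := by nlinarith
      have : 0 ≤ ε * (1 + a ^ p + b ^ p) := by positivity
      linarith

/-- The elementary optimisation over the radius in the proof of the Sobolev inequality. -/
theorem rpow_le_of_forall_radius {n s A y m d : ℝ} (hs : 0 < s) (hns : 2 * s < n)
    (hA : 0 ≤ A) (hy : 0 ≤ y) (hm : 0 < m) (hd : 0 ≤ d)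
    (h : ∀ R : ℝ, 0 < R → y ≤ A * (R ^ (2 * s) * d + R ^ (-(n - 2 * s)) * m)) :
    y ^ (n / (n - 2 * s)) ≤ (2 * A) ^ (n / (n - 2 * s)) * m ^ (2 * s / (n - 2 * s)) * d := by
  have hn : 0 < n := by linarith
  have hns' : 0 < n - 2 * s := by linarith
  -- The radius $(m/e)^{1/n}$ equalises $R^{2s}e$ and $R^{-(n-2s)}m$. Working with $e>d$ and letting
  -- $e\downarrow d$ covers $d=0$.
  have key : ∀ e : ℝ, d < e →
      y ^ (n / (n - 2 * s)) ≤ (2 * A) ^ (n / (n - 2 * s)) * m ^ (2 * s / (n - 2 * s)) * e := by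
    intro e hde
    have he : 0 < e := hd.trans_lt hde
    have h1 := h ((m / e) ^ (1 / n)) (by positivity)
    have e1 : ((m / e) ^ (1 / n)) ^ (2 * s) * e = m ^ (2 * s / n) * e ^ ((n - 2 * s) / n) := by
      rw [← Real.rpow_mul (by positivity), Real.div_rpow hm.le he.le,
        show (n - 2 * s) / n = 1 - 1 / n * (2 * s) by field_simp, Real.rpow_sub he, Real.rpow_one,
        show 1 / n * (2 * s) = 2 * s / n by ring]
      ring
    have e2 : ((m / e) ^ (1 / n)) ^ (-(n - 2 * s)) * m
        = m ^ (2 * s / n) * e ^ ((n - 2 * s) / n) := by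
      rw [← Real.rpow_mul (by positivity), Real.div_rpow hm.le he.le,
        show 1 / n * -(n - 2 * s) = -((n - 2 * s) / n) by ring, Real.rpow_neg he.le,
        show 2 * s / n = -((n - 2 * s) / n) + 1 by field_simp; ring, Real.rpow_add_one hm.ne',
        div_inv_eq_mul]
      ring
    have h2 : y ≤ 2 * A * (m ^ (2 * s / n) * e ^ ((n - 2 * s) / n)) := by
      calc y ≤ A * (((m / e) ^ (1 / n)) ^ (2 * s) * d
              + ((m / e) ^ (1 / n)) ^ (-(n - 2 * s)) * m) := h1
        _ ≤ A * (((m / e) ^ (1 / n)) ^ (2 * s) * e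
              + ((m / e) ^ (1 / n)) ^ (-(n - 2 * s)) * m) := by gcongr
        _ = _ := by rw [e1, e2]; ring
    calc y ^ (n / (n - 2 * s))
        ≤ (2 * A * (m ^ (2 * s / n) * e ^ ((n - 2 * s) / n))) ^ (n / (n - 2 * s)) :=
          Real.rpow_le_rpow hy h2 (by positivity)
      _ = _ := by
        rw [Real.mul_rpow (x := 2 * A) (by positivity) (by positivity),
          Real.mul_rpow (x := m ^ _) (by positivity) (by positivity), ← Real.rpow_mul hm.le,
          ← Real.rpow_mul he.le, show (n - 2 * s) / n * (n / (n - 2 * s)) = 1 by field_simp,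
          Real.rpow_one, show 2 * s / n * (n / (n - 2 * s)) = 2 * s / (n - 2 * s) by field_simp]
        ring
  refine le_of_forall_pos_le_add fun ε hε => ?_
  set B := (2 * A) ^ (n / (n - 2 * s)) * m ^ (2 * s / (n - 2 * s))
  have hB : 0 ≤ B := by positivity
  have := key (d + ε / (B + 1)) (by linarith [show 0 < ε / (B + 1) by positivity])
  have h3 : B * (ε / (B + 1)) ≤ ε := by
    rw [mul_div_assoc', div_le_iff₀ (by positivity)]; nlinarith
  linarith

/-! ### The bilinear structure of `X₀` -/

section

variable {n : ℕ} {s : ℝ} {Ω : Set (EuclideanSpace ℝ (Fin n))}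
  {K u v w : EuclideanSpace ℝ (Fin n) → ℝ}

/-- The assumptions on the kernel `K`. -/
structure IsSingularKernel (s : ℝ) (K : EuclideanSpace ℝ (Fin n) → ℝ) : Prop where
  pos_dim : 0 < n
  integrable : Integrable (fun x => min (‖x‖ ^ 2) 1 * K x) volume
  lower : ∃ k₀ : ℝ, 0 < k₀ ∧ ∀ x, x ≠ 0 → k₀ / ‖x‖ ^ ((n : ℝ) + 2 * s) ≤ K x

/-- The weighted increments of `u`; the norm of `X₀` is their `L²` norm. -/
def incr (K u : EuclideanSpace ℝ (Fin n) → ℝ)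
    (p : EuclideanSpace ℝ (Fin n) × EuclideanSpace ℝ (Fin n)) : ℝ :=
  (u p.1 - u p.2) * √(K (p.1 - p.2))

theorem incr_add : incr K (u + v) = incr K u + incr K v := by
  ext p; simp [incr]; ring

theorem incr_sub : incr K (u - v) = incr K u - incr K v := by
  ext p; simp [incr]; ring

theorem incr_smul (c : ℝ) : incr K (c • u) = c • incr K u := by
  ext p; simp [incr]; ring

theorem measurableSet_Q (hΩ : MeasurableSet Ω) : MeasurableSet (Q Ω) :=
  (hΩ.compl.prod hΩ.compl).compl

namespace IsSingularKernel

variable (hK : IsSingularKernel s K)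
include hK

theorem nonneg {x : EuclideanSpace ℝ (Fin n)} (hx : x ≠ 0) : 0 ≤ K x := by
  obtain ⟨k, hk, h⟩ := hK.lower
  exact le_trans (by positivity) (h x hx)

theorem nontrivial : Nontrivial (EuclideanSpace ℝ (Fin n)) := by
  have : Nonempty (Fin n) := ⟨⟨0, hK.pos_dim⟩⟩
  infer_instance

theorem ae_ne_zero : ∀ᵐ x : EuclideanSpace ℝ (Fin n), x ≠ 0 := by
  have := hK.nontrivial
  exact Measure.ae_ne volume 0

theorem ae_sub_ne_zero :
    ∀ᵐ p : EuclideanSpace ℝ (Fin n) × EuclideanSpace ℝ (Fin n), p.1 - p.2 ≠ 0 :=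
  (quasiMeasurePreserving_sub_of_right_invariant volume volume).ae hK.ae_ne_zero

theorem aestronglyMeasurable : AEStronglyMeasurable K volume := by
  have h1 : AEStronglyMeasurable (fun x : EuclideanSpace ℝ (Fin n) =>
      (min (‖x‖ ^ 2) 1)⁻¹ * (min (‖x‖ ^ 2) 1 * K x)) volume := by
    refine AEStronglyMeasurable.mul ?_ hK.integrable.1
    exact (by fun_prop : Measurable fun x : EuclideanSpace ℝ (Fin n) =>
      (min (‖x‖ ^ 2) 1)⁻¹).aestronglyMeasurable
  refine h1.congr ?_
  filter_upwards [hK.ae_ne_zero] with x hx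
  rw [inv_mul_cancel_left₀]
  have : 0 < ‖x‖ := norm_pos_iff.2 hx
  positivity

theorem aestronglyMeasurable_sub : AEStronglyMeasurable
    (fun p : EuclideanSpace ℝ (Fin n) × EuclideanSpace ℝ (Fin n) => K (p.1 - p.2))
    (volume.prod volume) :=
  hK.aestronglyMeasurable.comp_quasiMeasurePreserving
    (quasiMeasurePreserving_sub_of_right_invariant volume volume)

theorem aestronglyMeasurable_incr (hu : AEStronglyMeasurable u volume) :
    AEStronglyMeasurable (incr K u) (volume.prod volume) :=
  (hu.comp_fst.sub hu.comp_snd).mul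
    (Real.continuous_sqrt.comp_aestronglyMeasurable hK.aestronglyMeasurable_sub)

/-- Stability under normal contractions, applied below to positive parts and absolute values: the
weighted increments of `w` are dominated pointwise by those of `u`. -/
theorem mem_X₀_of_abs_le (hu : u ∈ X₀ K Ω) (hw : AEStronglyMeasurable w volume)
    (h1 : ∀ x, |w x| ≤ |u x|) (h2 : ∀ x y, |w x - w y| ≤ |u x - u y|) : w ∈ X₀ K Ω := by
  refine ⟨⟨hw, hu.1.2.1.mono hw.restrict (.of_forall h1), ?_⟩, ?_⟩
  · refine hu.1.2.2.mono (hK.aestronglyMeasurable_incr hw).restrict (.of_forall fun p => ?_)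
    simp only [norm_mul, Real.norm_eq_abs]
    exact mul_le_mul_of_nonneg_right (h2 _ _) (abs_nonneg _)
  · filter_upwards [hu.2] with x hx
    have := h1 x
    rw [hx, abs_zero] at this
    exact abs_eq_zero.1 (this.antisymm (abs_nonneg _))

theorem inner₀_eq : inner₀ K Ω u v = ∫ p in Q Ω, incr K u p * incr K v p := by
  refine integral_congr_ae (ae_restrict_of_ae ?_)
  filter_upwards [hK.ae_sub_ne_zero] with p hp
  simp only [incr]
  rw [mul_mul_mul_comm, Real.mul_self_sqrt (hK.nonneg hp)]

end IsSingularKernel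

theorem X₀_add (hu : u ∈ X₀ K Ω) (hv : v ∈ X₀ K Ω) : u + v ∈ X₀ K Ω := by
  refine ⟨⟨hu.1.1.add hv.1.1, hu.1.2.1.add hv.1.2.1, ?_⟩, ?_⟩
  · change MemLp (incr K (u + v)) 2 _
    rw [incr_add]
    exact MemLp.add hu.1.2.2 hv.1.2.2
  · filter_upwards [hu.2, hv.2] with x h1 h2
    simp [h1, h2]

theorem X₀_smul (c : ℝ) (hu : u ∈ X₀ K Ω) : c • u ∈ X₀ K Ω := by
  refine ⟨⟨hu.1.1.const_smul c, hu.1.2.1.const_smul c, ?_⟩, ?_⟩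
  · change MemLp (incr K (c • u)) 2 _
    rw [incr_smul]
    exact MemLp.const_smul hu.1.2.2 c
  · filter_upwards [hu.2] with x h1
    simp [h1]

theorem X₀_sub (hu : u ∈ X₀ K Ω) (hv : v ∈ X₀ K Ω) : u - v ∈ X₀ K Ω := by
  have := X₀_add hu (X₀_smul (-1) hv)
  rwa [neg_one_smul, ← sub_eq_add_neg] at this

theorem X₀_zero : (0 : EuclideanSpace ℝ (Fin n) → ℝ) ∈ X₀ K Ω := by
  refine ⟨⟨aestronglyMeasurable_zero, MemLp.zero, ?_⟩, by simp⟩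
  simp

theorem memLp_incr (hu : u ∈ X₀ K Ω) : MemLp (incr K u) 2 (volume.restrict (Q Ω)) := hu.1.2.2

theorem inner₀_comm : inner₀ K Ω u v = inner₀ K Ω v u := by
  simp only [inner₀]
  congr 1; ext p; ring

theorem norm₀_nonneg : 0 ≤ norm₀ K Ω u := Real.sqrt_nonneg _

namespace IsSingularKernel

variable (hK : IsSingularKernel s K)
include hK

theorem inner₀_add_left (hu : u ∈ X₀ K Ω) (hv : v ∈ X₀ K Ω) (hw : w ∈ X₀ K Ω) :
    inner₀ K Ω (u + v) w = inner₀ K Ω u w + inner₀ K Ω v w := by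
  rw [hK.inner₀_eq, hK.inner₀_eq, hK.inner₀_eq, ← integral_add]
  · simp [incr_add, add_mul]
  · exact (memLp_incr hu).integrable_mul (memLp_incr hw)
  · exact (memLp_incr hv).integrable_mul (memLp_incr hw)

theorem inner₀_smul_left (c : ℝ) : inner₀ K Ω (c • u) v = c * inner₀ K Ω u v := by
  rw [hK.inner₀_eq, hK.inner₀_eq, ← integral_const_mul]
  simp [incr_smul, mul_assoc]

theorem inner₀_sub_left (hu : u ∈ X₀ K Ω) (hv : v ∈ X₀ K Ω) (hw : w ∈ X₀ K Ω) :
    inner₀ K Ω (u - v) w = inner₀ K Ω u w - inner₀ K Ω v w := by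
  have := hK.inner₀_add_left hu (X₀_smul (-1) hv) hw
  rw [hK.inner₀_smul_left, neg_one_smul, ← sub_eq_add_neg] at this
  linarith

theorem inner₀_add_right (hu : u ∈ X₀ K Ω) (hv : v ∈ X₀ K Ω) (hw : w ∈ X₀ K Ω) :
    inner₀ K Ω w (u + v) = inner₀ K Ω w u + inner₀ K Ω w v := by
  rw [inner₀_comm, hK.inner₀_add_left hu hv hw, inner₀_comm, inner₀_comm (u := v)]

theorem inner₀_sub_right (hu : u ∈ X₀ K Ω) (hv : v ∈ X₀ K Ω) (hw : w ∈ X₀ K Ω) :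
    inner₀ K Ω w (u - v) = inner₀ K Ω w u - inner₀ K Ω w v := by
  rw [inner₀_comm, hK.inner₀_sub_left hu hv hw, inner₀_comm, inner₀_comm (u := v)]

theorem inner₀_smul_right (c : ℝ) : inner₀ K Ω u (c • v) = c * inner₀ K Ω u v := by
  rw [inner₀_comm, hK.inner₀_smul_left, inner₀_comm]

theorem norm₀_eq : norm₀ K Ω u = √(∫ p in Q Ω, ‖incr K u p‖ ^ 2) := by
  rw [norm₀]
  congr 1
  refine integral_congr_ae (ae_restrict_of_ae ?_)
  filter_upwards [hK.ae_sub_ne_zero] with p hp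
  rw [incr, norm_mul, mul_pow, Real.norm_eq_abs, Real.norm_eq_abs, sq_abs (√_),
    Real.sq_sqrt (hK.nonneg hp)]

theorem norm₀_sq : norm₀ K Ω u ^ 2 = inner₀ K Ω u u := by
  rw [hK.norm₀_eq, hK.inner₀_eq, Real.sq_sqrt (integral_nonneg fun _ => by positivity)]
  simp [sq]

theorem ofReal_norm₀ (hu : u ∈ X₀ K Ω) :
    ENNReal.ofReal (norm₀ K Ω u) = eLpNorm (incr K u) 2 (volume.restrict (Q Ω)) := by
  rw [(memLp_incr hu).eLpNorm_eq_integral_rpow_norm (by simp) (by simp), hK.norm₀_eq,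
    Real.sqrt_eq_rpow]
  simp

theorem norm₀_add_le (hu : u ∈ X₀ K Ω) (hv : v ∈ X₀ K Ω) :
    norm₀ K Ω (u + v) ≤ norm₀ K Ω u + norm₀ K Ω v := by
  rw [← ENNReal.ofReal_le_ofReal_iff (add_nonneg norm₀_nonneg norm₀_nonneg),
    ENNReal.ofReal_add norm₀_nonneg norm₀_nonneg, hK.ofReal_norm₀ hu, hK.ofReal_norm₀ hv,
    hK.ofReal_norm₀ (X₀_add hu hv), incr_add]
  exact eLpNorm_add_le (memLp_incr hu).1 (memLp_incr hv).1 (by norm_num)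

theorem norm₀_smul (c : ℝ) : norm₀ K Ω (c • u) = |c| * norm₀ K Ω u := by
  rw [← sq_eq_sq₀ norm₀_nonneg (mul_nonneg (abs_nonneg _) norm₀_nonneg), hK.norm₀_sq, mul_pow,
    hK.norm₀_sq, hK.inner₀_smul_left, hK.inner₀_smul_right, sq_abs]
  ring

theorem norm₀_le_of_abs_le (hu : u ∈ X₀ K Ω) (hw : AEStronglyMeasurable w volume)
    (h1 : ∀ x, |w x| ≤ |u x|) (h2 : ∀ x y, |w x - w y| ≤ |u x - u y|) :
    norm₀ K Ω w ≤ norm₀ K Ω u := by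
  rw [← ENNReal.ofReal_le_ofReal_iff norm₀_nonneg, hK.ofReal_norm₀ hu,
    hK.ofReal_norm₀ (hK.mem_X₀_of_abs_le hu hw h1 h2)]
  refine eLpNorm_mono fun p => ?_
  simp only [incr, norm_mul, Real.norm_eq_abs]
  exact mul_le_mul_of_nonneg_right (h2 _ _) (abs_nonneg _)

theorem norm₀_add_sq (hu : u ∈ X₀ K Ω) (hv : v ∈ X₀ K Ω) :
    norm₀ K Ω (u + v) ^ 2 = norm₀ K Ω u ^ 2 + 2 * inner₀ K Ω u v + norm₀ K Ω v ^ 2 := by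
  simp only [hK.norm₀_sq]
  rw [hK.inner₀_add_left hu hv (X₀_add hu hv), hK.inner₀_add_right hu hv hu,
    hK.inner₀_add_right hu hv hv, inner₀_comm (u := v) (v := u)]
  ring

theorem norm₀_sub_sq (hu : u ∈ X₀ K Ω) (hv : v ∈ X₀ K Ω) :
    norm₀ K Ω (u - v) ^ 2 = norm₀ K Ω u ^ 2 - 2 * inner₀ K Ω u v + norm₀ K Ω v ^ 2 := by
  have := hK.norm₀_add_sq hu (X₀_smul (-1) hv)
  rw [neg_one_smul, ← sub_eq_add_neg, ← neg_one_smul ℝ v, hK.norm₀_smul,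
    hK.inner₀_smul_right] at this
  rw [this]; simp; ring

theorem mem_X₀_posPart (hu : u ∈ X₀ K Ω) : (fun x => max (u x) 0) ∈ X₀ K Ω := by
  refine hK.mem_X₀_of_abs_le hu (hu.1.1.sup aestronglyMeasurable_const) (fun x => ?_)
    (fun x y => abs_max_sub_max_le_abs _ _ _)
  simpa using abs_max_sub_max_le_abs (u x) 0 0

theorem norm₀_posPart_le (hu : u ∈ X₀ K Ω) : norm₀ K Ω (fun x => max (u x) 0) ≤ norm₀ K Ω u := by
  refine hK.norm₀_le_of_abs_le hu (hu.1.1.sup aestronglyMeasurable_const) (fun x => ?_)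
    (fun x y => abs_max_sub_max_le_abs _ _ _)
  simpa using abs_max_sub_max_le_abs (u x) 0 0

/-- Integrated form of $(\alpha^+-\beta^+)^2\le(\alpha-\beta)(\alpha^+-\beta^+)$. -/
theorem norm₀_posPart_sq_le_inner₀ (hu : u ∈ X₀ K Ω) :
    norm₀ K Ω (fun x => max (u x) 0) ^ 2 ≤ inner₀ K Ω u (fun x => max (u x) 0) := by
  have hp := hK.mem_X₀_posPart hu
  rw [hK.norm₀_sq, hK.inner₀_eq, hK.inner₀_eq]
  refine integral_mono ((memLp_incr hp).integrable_mul (memLp_incr hp))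
    ((memLp_incr hu).integrable_mul (memLp_incr hp)) fun p => ?_
  simp only [incr]
  rw [mul_mul_mul_comm, mul_mul_mul_comm (u p.1 - u p.2)]
  refine mul_le_mul_of_nonneg_right ?_ (mul_self_nonneg _)
  rcases le_total (u p.1) 0 with h1 | h1 <;> rcases le_total (u p.2) 0 with h2 | h2 <;>
    simp only [max_eq_left, max_eq_right, h1, h2] <;> nlinarith

end IsSingularKernel

/-- This makes the norm, an integral over `Q Ω`, an integral over all of $\mathbb R^{2n}$, so that
it can be compared with the Gagliardo seminorm. -/
theorem ae_incr_eq_zero (hu : ∀ᵐ x ∂(volume.restrict Ωᶜ), u x = 0) (hΩ : MeasurableSet Ω) :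
    ∀ᵐ p : EuclideanSpace ℝ (Fin n) × EuclideanSpace ℝ (Fin n), p ∉ Q Ω → incr K u p = 0 := by
  rw [ae_restrict_iff' hΩ.compl] at hu
  have h1 : ∀ᵐ p : EuclideanSpace ℝ (Fin n) × EuclideanSpace ℝ (Fin n), p.1 ∈ Ωᶜ → u p.1 = 0 :=
    Measure.quasiMeasurePreserving_fst.ae hu
  have h2 : ∀ᵐ p : EuclideanSpace ℝ (Fin n) × EuclideanSpace ℝ (Fin n), p.2 ∈ Ωᶜ → u p.2 = 0 :=
    Measure.quasiMeasurePreserving_snd.ae hu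
  filter_upwards [h1, h2] with p hp1 hp2 hp
  simp only [Q, notMem_compl_iff, mem_prod] at hp
  rw [incr, hp1 hp.1, hp2 hp.2]; simp

end

/-! ### The fractional Sobolev inequality -/

section

variable {n : ℕ} {s : ℝ} {Ω : Set (EuclideanSpace ℝ (Fin n))}
  {K u v w : EuclideanSpace ℝ (Fin n) → ℝ}

/-- The inner integral in the Gagliardo seminorm. -/
def gagliardoDensity (s : ℝ) (u : EuclideanSpace ℝ (Fin n) → ℝ) (x : EuclideanSpace ℝ (Fin n)) :
    ℝ≥0∞ :=
  ∫⁻ y, ENNReal.ofReal ((u x - u y) ^ 2 / ‖x - y‖ ^ ((n : ℝ) + 2 * s))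

theorem aemeasurable_gagliardo (hu : AEStronglyMeasurable u volume) :
    AEMeasurable (fun p : EuclideanSpace ℝ (Fin n) × EuclideanSpace ℝ (Fin n) =>
      ENNReal.ofReal ((u p.1 - u p.2) ^ 2 / ‖p.1 - p.2‖ ^ ((n : ℝ) + 2 * s)))
      (volume.prod volume) := by
  refine AEMeasurable.ennreal_ofReal (AEMeasurable.div ?_ ?_)
  · exact ((hu.comp_fst.sub hu.comp_snd).aemeasurable.pow_const 2)
  · exact (by fun_prop : Measurable fun p : EuclideanSpace ℝ (Fin n) × EuclideanSpace ℝ (Fin n) =>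
      ‖p.1 - p.2‖ ^ ((n : ℝ) + 2 * s)).aemeasurable

theorem aemeasurable_gagliardoDensity (hu : AEStronglyMeasurable u volume) :
    AEMeasurable (gagliardoDensity s u) volume :=
  (aemeasurable_gagliardo hu).lintegral_prod_right'

theorem gagliardoDensity_mono (h : ∀ x y, |v x - v y| ≤ |u x - u y|)
    (x : EuclideanSpace ℝ (Fin n)) : gagliardoDensity s v x ≤ gagliardoDensity s u x := by
  refine lintegral_mono fun y => ENNReal.ofReal_le_ofReal ?_
  exact div_le_div_of_nonneg_right (sq_le_sq.2 (h x y)) (by positivity)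

/-- On `B` one has $|x-y|\le R$, so the Gagliardo weight is at least $R^{-(n+2s)}$ off the diagonal.
-/
theorem setLIntegral_sq_sub_le {x : EuclideanSpace ℝ (Fin n)} {R : ℝ} (hs : 0 < s) (hR : 0 < R)
    {B : Set (EuclideanSpace ℝ (Fin n))} (hB : MeasurableSet B) (hBR : B ⊆ Metric.closedBall x R) :
    ∫⁻ y in B, ENNReal.ofReal ((u x - u y) ^ 2)
      ≤ ENNReal.ofReal (R ^ ((n : ℝ) + 2 * s)) * gagliardoDensity s u x := by
  rw [gagliardoDensity, ← lintegral_const_mul' _ _ ENNReal.ofReal_ne_top]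
  refine le_trans (setLIntegral_mono' hB fun y hy => ?_) (setLIntegral_le_lintegral B _)
  rw [← ENNReal.ofReal_mul (by positivity)]
  refine ENNReal.ofReal_le_ofReal ?_
  rcases eq_or_ne x y with rfl | hxy
  · simp
  · have h0 : 0 < ‖x - y‖ := norm_pos_iff.2 (sub_ne_zero.2 hxy)
    have h1 : ‖x - y‖ ≤ R := by
      have := hBR hy
      rwa [Metric.mem_closedBall, dist_comm, dist_eq_norm] at this
    have h2 : ‖x - y‖ ^ ((n : ℝ) + 2 * s) ≤ R ^ ((n : ℝ) + 2 * s) :=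
      Real.rpow_le_rpow h0.le h1 (by positivity)
    rw [mul_div_assoc', le_div_iff₀ (by positivity), mul_comm]
    gcongr

theorem IsSingularKernel.lintegral_incr_eq (hK : IsSingularKernel s K) (hΩ : MeasurableSet Ω)
    (hu : u ∈ X₀ K Ω) :
    ∫⁻ p : EuclideanSpace ℝ (Fin n) × EuclideanSpace ℝ (Fin n),
      ENNReal.ofReal (incr K u p ^ 2) = ENNReal.ofReal (norm₀ K Ω u ^ 2) := by
  rw [hK.norm₀_eq, Real.sq_sqrt (integral_nonneg fun _ => by positivity),
    ofReal_integral_eq_lintegral_ofReal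
      ((memLp_two_iff_integrable_sq_norm (memLp_incr hu).1).1 (memLp_incr hu)) (.of_forall fun _ => by positivity), ← lintegral_indicator (measurableSet_Q hΩ)]
  refine lintegral_congr_ae ?_
  filter_upwards [ae_incr_eq_zero (K := K) hu.2 hΩ] with p hp
  by_cases h : p ∈ Q Ω
  · simp [h]
  · simp [h, hp h]

theorem IsSingularKernel.exists_gagliardo_le (hK : IsSingularKernel s K) (hΩ : MeasurableSet Ω) :
    ∃ C : ℝ, 0 < C ∧ ∀ u ∈ X₀ K Ω,
      ∫⁻ x, gagliardoDensity s u x ≤ ENNReal.ofReal (C * norm₀ K Ω u ^ 2) := by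
  obtain ⟨k, hk, hk'⟩ := hK.lower
  refine ⟨k⁻¹, by positivity, fun u hu => ?_⟩
  simp only [gagliardoDensity]
  rw [← lintegral_prod _ (aemeasurable_gagliardo hu.1.1), ENNReal.ofReal_mul (by positivity),
    ← hK.lintegral_incr_eq hΩ hu, ← lintegral_const_mul' _ _ ENNReal.ofReal_ne_top]
  refine lintegral_mono_ae ?_
  filter_upwards [hK.ae_sub_ne_zero] with p hp
  rw [← ENNReal.ofReal_mul (by positivity)]
  refine ENNReal.ofReal_le_ofReal ?_
  have h0 : 0 < ‖p.1 - p.2‖ := norm_pos_iff.2 hp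
  have h1 := hk' _ hp
  rw [incr, mul_pow, Real.sq_sqrt (hK.nonneg hp), div_eq_mul_inv, mul_left_comm]
  gcongr
  rw [← div_eq_inv_mul, le_div_iff₀ hk, mul_comm, ← div_eq_mul_inv]
  exact h1

/-- Integration over the ball of $u(x)^2\le2(u(x)-u(y))^2+2u(y)^2$ in $y$. -/
theorem sq_mul_measure_le (x : EuclideanSpace ℝ (Fin n)) {R : ℝ} (hs : 0 < s) (hR : 0 < R)
    (hu : AEStronglyMeasurable u volume) :
    ENNReal.ofReal (u x ^ 2) * volume (Metric.ball x R)
      ≤ 2 * (ENNReal.ofReal (R ^ ((n : ℝ) + 2 * s)) * gagliardoDensity s u x)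
        + 2 * ∫⁻ y in Metric.ball x R, ENNReal.ofReal (u y ^ 2) := by
  rw [← setLIntegral_const]
  calc ∫⁻ _ in Metric.ball x R, ENNReal.ofReal (u x ^ 2)
      ≤ ∫⁻ y in Metric.ball x R, (2 * ENNReal.ofReal ((u x - u y) ^ 2)
          + 2 * ENNReal.ofReal (u y ^ 2)) := by
        refine lintegral_mono fun y => ?_
        have h2 : (2 : ℝ≥0∞) = ENNReal.ofReal 2 := by simp
        rw [h2, ← ENNReal.ofReal_mul (by norm_num), ← ENNReal.ofReal_mul (by norm_num),
          ← ENNReal.ofReal_add (by positivity) (by positivity)]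
        refine ENNReal.ofReal_le_ofReal ?_
        nlinarith [sq_nonneg (u x - u y - u y)]
    _ = 2 * (∫⁻ y in Metric.ball x R, ENNReal.ofReal ((u x - u y) ^ 2))
          + 2 * ∫⁻ y in Metric.ball x R, ENNReal.ofReal (u y ^ 2) := by
        rw [lintegral_add_right', lintegral_const_mul' _ _ (by simp),
          lintegral_const_mul' _ _ (by simp)]
        exact ((hu.restrict.aemeasurable.pow_const 2).ennreal_ofReal).const_mul 2
    _ ≤ _ := by
        gcongr
        exact setLIntegral_sq_sub_le hs hR measurableSet_ball Metric.ball_subset_closedBall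

theorem lintegral_ofReal_sq_eq {α : Type*} [MeasurableSpace α] (ν : Measure α) (f : α → ℝ) :
    ∫⁻ y, ENNReal.ofReal (f y ^ 2) ∂ν = eLpNorm f 2 ν ^ 2 := by
  have := eLpNorm_nnreal_pow_eq_lintegral (f := f) (μ := ν) (p := 2) (by norm_num)
  simp only [NNReal.coe_ofNat, ENNReal.coe_ofNat, ENNReal.rpow_ofNat] at this
  rw [this]
  refine lintegral_congr fun y => ?_
  rw [← sq_abs, ENNReal.ofReal_pow (abs_nonneg _), ← Real.norm_eq_abs, ofReal_norm]

theorem lintegral_ofReal_abs_rpow_eq {α : Type*} [MeasurableSpace α] (ν : Measure α) (f : α → ℝ)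
    {p : ℝ} (hp : 0 < p) :
    ∫⁻ y, ENNReal.ofReal (|f y| ^ p) ∂ν = eLpNorm f (ENNReal.ofReal p) ν ^ p := by
  have := eLpNorm_nnreal_pow_eq_lintegral (f := f) (μ := ν) (p := p.toNNReal) (by simpa using hp)
  rw [Real.coe_toNNReal _ hp.le] at this
  rw [show ENNReal.ofReal p = (p.toNNReal : ℝ≥0∞) from rfl, this]
  refine lintegral_congr fun y => ?_
  rw [← ENNReal.ofReal_rpow_of_nonneg (abs_nonneg _) hp.le, ← Real.norm_eq_abs, ofReal_norm]

theorem two_lt_twoStar (hs : 0 < s) (hns : 2 * s < n) : 2 < twoStar n s := by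
  rw [twoStar, lt_div_iff₀ (by linarith)]
  linarith

/-- The radius-dependent bound underlying the fractional Sobolev inequality. -/
theorem exists_sq_le_radius (hs : 0 < s) (hns : 2 * s < n) :
    ∃ A : ℝ, 0 < A ∧ ∀ u : EuclideanSpace ℝ (Fin n) → ℝ,
      MemLp u (ENNReal.ofReal (twoStar n s)) volume → ∀ x, gagliardoDensity s u x ≠ ∞ →
      ∀ R : ℝ, 0 < R → u x ^ 2 ≤ A * (R ^ (2 * s) * (gagliardoDensity s u x).toReal
        + R ^ (-(n - 2 * s)) * (eLpNorm u (ENNReal.ofReal (twoStar n s)) volume).toReal ^ 2) := by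
  have hn : (0 : ℝ) < n := by linarith
  have hns' : 0 < n - 2 * s := by linarith
  have hp2 := two_lt_twoStar hs hns
  set p := twoStar n s with hp
  set ω : ℝ := volume.real (Metric.ball (0 : EuclideanSpace ℝ (Fin n)) 1) with hω
  have hω0 : 0 < ω := by
    refine ENNReal.toReal_pos ?_ measure_ball_lt_top.ne
    exact (Metric.measure_ball_pos _ _ one_pos).ne'
  refine ⟨2 / ω + 2 * ω ^ (-((n - 2 * s) / n)), by positivity, fun u hu x hx R hR => ?_⟩
  set d := (gagliardoDensity s u x).toReal with hd
  set N := (eLpNorm u (ENNReal.ofReal p) volume).toReal with hN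
  have hd0 : 0 ≤ d := ENNReal.toReal_nonneg
  have hN0 : 0 ≤ N := ENNReal.toReal_nonneg
  have hvol : volume (Metric.ball x R) = ENNReal.ofReal (ω * R ^ (n : ℝ)) := by
    have : Nonempty (Fin n) := ⟨⟨0, by exact_mod_cast hn⟩⟩
    rw [Measure.addHaar_ball _ _ hR.le, finrank_euclideanSpace_fin, mul_comm,
      ENNReal.ofReal_mul hω0.le, Real.rpow_natCast, hω, measureReal_def, ENNReal.ofReal_toReal]
    exact measure_ball_lt_top.ne
  -- Hölder's inequality on the ball, with $\frac12-\frac1{2^*}=\frac sn$.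
  have hL2 : ∫⁻ y in Metric.ball x R, ENNReal.ofReal (u y ^ 2)
      ≤ ENNReal.ofReal (N ^ 2 * (ω * R ^ (n : ℝ)) ^ (2 * s / n)) := by
    rw [lintegral_ofReal_sq_eq]
    have h1 := eLpNorm_le_eLpNorm_mul_rpow_measure_univ (μ := volume.restrict (Metric.ball x R))
      (p := 2) (q := ENNReal.ofReal p) (f := u)
      (by rw [← ENNReal.ofReal_ofNat]; exact ENNReal.ofReal_le_ofReal hp2.le) hu.1.restrict
    rw [ENNReal.toReal_ofReal (by linarith), Measure.restrict_apply_univ, hvol] at h1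
    have h2 : eLpNorm u (ENNReal.ofReal p) (volume.restrict (Metric.ball x R))
        ≤ ENNReal.ofReal N := by
      rw [hN, ENNReal.ofReal_toReal hu.2.ne]
      exact eLpNorm_mono_measure _ Measure.restrict_le_self
    have h3 : (1 / (2 : ℝ≥0∞).toReal - 1 / p) = s / n := by
      rw [hp, twoStar]
      simp only [ENNReal.toReal_ofNat]
      field_simp
      ring
    rw [h3, ENNReal.ofReal_rpow_of_nonneg (by positivity) (by positivity)] at h1
    calc eLpNorm u 2 (volume.restrict (Metric.ball x R)) ^ 2
        ≤ (ENNReal.ofReal N * ENNReal.ofReal ((ω * R ^ (n : ℝ)) ^ (s / n))) ^ 2 := by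
          gcongr
          exact h1.trans (by gcongr)
      _ = _ := by
          rw [← ENNReal.ofReal_mul hN0, ← ENNReal.ofReal_pow (by positivity), mul_pow,
            ← Real.rpow_natCast ((ω * R ^ (n : ℝ)) ^ (s / n)), ← Real.rpow_mul (by positivity)]
          congr 3
          push_cast
          ring
  have h := sq_mul_measure_le (s := s) x hs hR hu.1
  have hreal : u x ^ 2 * (ω * R ^ (n : ℝ)) ≤ 2 * (R ^ ((n : ℝ) + 2 * s) * d)
      + 2 * (N ^ 2 * (ω * R ^ (n : ℝ)) ^ (2 * s / n)) := by
    rw [← ENNReal.ofReal_le_ofReal_iff (by positivity)]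
    rw [hvol, ← ENNReal.ofReal_mul (by positivity)] at h
    refine h.trans ?_
    rw [ENNReal.ofReal_add (by positivity) (by positivity), ENNReal.ofReal_mul zero_le_two,
      ENNReal.ofReal_mul zero_le_two, ENNReal.ofReal_mul (by positivity), hd,
      ENNReal.ofReal_toReal hx, ENNReal.ofReal_ofNat]
    gcongr
  have hdiv : u x ^ 2 ≤ 2 / ω * (R ^ (2 * s) * d)
      + 2 * ω ^ (-((n - 2 * s) / n)) * (R ^ (-(n - 2 * s)) * N ^ 2) := by
    rw [← le_div_iff₀ (by positivity)] at hreal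
    refine hreal.trans_eq ?_
    rw [add_div]
    congr 1
    · rw [Real.rpow_add hR]
      field_simp
    · have e1 : (ω * R ^ (n : ℝ)) ^ (2 * s / n)
          = (ω * R ^ (n : ℝ)) ^ (-((n - 2 * s) / n)) * (ω * R ^ (n : ℝ)) := by
        rw [← Real.rpow_add_one (by positivity)]
        congr 1
        field_simp
        ring
      rw [e1, Real.mul_rpow hω0.le (by positivity), ← Real.rpow_mul hR.le]
      have e2 : (n : ℝ) * -((n - 2 * s) / n) = -(n - 2 * s) := by field_simp
      rw [e2]
      field_simp
  have hA1 : 0 ≤ 2 / ω * (R ^ (-(n - 2 * s)) * N ^ 2) := by positivity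
  have hA2 : 0 ≤ 2 * ω ^ (-((n - 2 * s) / n)) * (R ^ (2 * s) * d) := by positivity
  linarith

/-- Optimising the radius at each point gives $|u|^{2^*}\le C N^{2^*-2}G$, where $N=\|u\|_{2^*}$ and
$G$ is the Gagliardo density. Integration yields $N^{2^*}\le CN^{2^*-2}\int G$, and one divides by
$N^{2^*-2}$; this is where $N<\infty$ must be known in advance. -/
theorem exists_eLpNorm_sq_le_of_memLp (hs : 0 < s) (hns : 2 * s < n) :
    ∃ C : ℝ, 0 < C ∧ ∀ u : EuclideanSpace ℝ (Fin n) → ℝ,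
      MemLp u (ENNReal.ofReal (twoStar n s)) volume →
      eLpNorm u (ENNReal.ofReal (twoStar n s)) volume ^ 2
        ≤ ENNReal.ofReal C * ∫⁻ x, gagliardoDensity s u x := by
  obtain ⟨A, hA, hrad⟩ := exists_sq_le_radius (n := n) hs hns
  have hn : (0 : ℝ) < n := by linarith
  have hns' : 0 < n - 2 * s := by linarith
  have hp2 := two_lt_twoStar hs hns
  refine ⟨(2 * A) ^ (n / (n - 2 * s)), by positivity, fun u hu => ?_⟩
  set p := twoStar n s with hp
  set C := (2 * A) ^ (n / (n - 2 * s)) with hC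
  have hC0 : 0 < C := by positivity
  by_cases hG : ∫⁻ x, gagliardoDensity s u x = ∞
  · rw [hG, ENNReal.mul_top]
    · exact le_top
    · simpa using hC0
  set N := (eLpNorm u (ENNReal.ofReal p) volume).toReal with hN
  have hNe : eLpNorm u (ENNReal.ofReal p) volume = ENNReal.ofReal N :=
    (ENNReal.ofReal_toReal hu.2.ne).symm
  rcases (ENNReal.toReal_nonneg : 0 ≤ N).eq_or_lt with h0 | hN0
  · rw [hNe, hN, ← h0]; simp
  have hae : ∀ᵐ x, ENNReal.ofReal (|u x| ^ p)
      ≤ ENNReal.ofReal (C * (N ^ 2) ^ (2 * s / (n - 2 * s))) * gagliardoDensity s u x := by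
    filter_upwards [ae_lt_top' (aemeasurable_gagliardoDensity hu.1) hG] with x hx
    have h1 := rpow_le_of_forall_radius hs hns hA.le (sq_nonneg (u x)) (by positivity : 0 < N ^ 2)
      ENNReal.toReal_nonneg (hrad u hu x hx.ne)
    rw [← ENNReal.ofReal_toReal hx.ne, ← ENNReal.ofReal_mul (by positivity)]
    refine ENNReal.ofReal_le_ofReal (le_trans (le_of_eq ?_) h1)
    rw [← sq_abs, ← Real.rpow_natCast, ← Real.rpow_mul (abs_nonneg _), hp, twoStar]
    congr 1
    push_cast; ring
  have hint := lintegral_mono_ae hae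
  rw [lintegral_const_mul' _ _ ENNReal.ofReal_ne_top,
    lintegral_ofReal_abs_rpow_eq _ _ (by linarith), hNe,
    ENNReal.ofReal_rpow_of_pos hN0, ← ENNReal.ofReal_toReal hG,
    ← ENNReal.ofReal_mul (by positivity)] at hint
  rw [hNe, ← ENNReal.ofReal_toReal hG, ← ENNReal.ofReal_mul hC0.le, ← ENNReal.ofReal_pow hN0.le]
  refine ENNReal.ofReal_le_ofReal ?_
  have hG0 : 0 ≤ (∫⁻ x, gagliardoDensity s u x).toReal := ENNReal.toReal_nonneg
  rw [ENNReal.ofReal_le_ofReal_iff (by positivity)] at hint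
  have e1 : N ^ p = N ^ 2 * (N ^ 2) ^ (2 * s / (n - 2 * s)) := by
    rw [← Real.rpow_natCast N 2, ← Real.rpow_mul hN0.le, ← Real.rpow_add hN0, hp, twoStar]
    congr 1
    push_cast
    field_simp
    ring
  rw [e1] at hint
  have h3 : 0 < (N ^ 2) ^ (2 * s / (n - 2 * s)) := by positivity
  refine le_of_mul_le_mul_right (hint.trans_eq ?_) h3
  ring

/-- The fractional Sobolev inequality, for functions supported in a bounded set. -/
theorem exists_eLpNorm_sq_le (hs : 0 < s) (hns : 2 * s < n) :
    ∃ C : ℝ, 0 < C ∧ ∀ (Ω : Set (EuclideanSpace ℝ (Fin n))), Bornology.IsBounded Ω →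
      MeasurableSet Ω → ∀ u : EuclideanSpace ℝ (Fin n) → ℝ, AEStronglyMeasurable u volume →
      (∀ᵐ x ∂(volume.restrict Ωᶜ), u x = 0) →
      eLpNorm u (ENNReal.ofReal (twoStar n s)) volume ^ 2
        ≤ ENNReal.ofReal C * ∫⁻ x, gagliardoDensity s u x := by
  obtain ⟨C, hC, h⟩ := exists_eLpNorm_sq_le_of_memLp (n := n) hs hns
  refine ⟨C, hC, fun Ω hΩb hΩ u hu hu0 => ?_⟩
  set p := twoStar n s with hp
  -- Truncations of `u` are bounded and vanish a.e. outside a set of finite measure, hence lie in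
  -- $L^{2^*}$, and truncating does not increase the Gagliardo density. Fatou's lemma then removes
  -- the a priori integrability.
  set T : ℕ → EuclideanSpace ℝ (Fin n) → ℝ := fun k x => max (min (u x) k) (-k) with hT
  have hTm : ∀ k, AEStronglyMeasurable (T k) volume := fun k =>
    (hu.inf aestronglyMeasurable_const).sup aestronglyMeasurable_const
  have hTL : ∀ k x y, |T k x - T k y| ≤ |u x - u y| := fun k x y =>
    (abs_max_sub_max_le_abs _ _ _).trans (abs_min_sub_min_le_max _ _ _ _ |>.trans (by simp))
  have hTlim : ∀ x, Tendsto (fun k => T k x) atTop (𝓝 (u x)) := by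
    intro x
    refine tendsto_const_nhds.congr' ?_
    filter_upwards [eventually_ge_atTop ⌈|u x|⌉₊] with k hk
    have hk' : |u x| ≤ k := (Nat.le_ceil _).trans (by exact_mod_cast hk)
    rw [abs_le] at hk'
    simp only [hT]
    rw [min_eq_left hk'.2, max_eq_left hk'.1]
  have hTmem : ∀ k, MemLp (T k) (ENNReal.ofReal p) volume := by
    intro k
    have hle : MemLp (Ω.indicator fun _ => (k : ℝ)) (ENNReal.ofReal p) volume :=
      (memLp_indicator_const _ hΩ _ (Or.inr hΩb.measure_lt_top.ne))
    refine hle.mono (hTm k) ?_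
    rw [ae_restrict_iff' hΩ.compl] at hu0
    filter_upwards [hu0] with x hx
    have hk : (0 : ℝ) ≤ k := Nat.cast_nonneg k
    by_cases hxΩ : x ∈ Ω
    · simp only [hT, hxΩ, indicator_of_mem, Real.norm_eq_abs, abs_of_nonneg hk]
      rw [abs_le]
      exact ⟨le_max_right _ _, max_le (min_le_right _ _) (by linarith)⟩
    · simp [hT, hx hxΩ]
  have hbound : ∀ k, eLpNorm (T k) (ENNReal.ofReal p) volume
      ≤ (ENNReal.ofReal C * ∫⁻ x, gagliardoDensity s u x) ^ (2⁻¹ : ℝ) := by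
    intro k
    have h1 := (h (T k) (hTmem k)).trans
      (mul_le_mul_right (lintegral_mono (gagliardoDensity_mono (hTL k))) _)
    rw [ENNReal.le_rpow_inv_iff (by norm_num)]
    simpa using h1
  have hlim := Lp.eLpNorm_lim_le_liminf_eLpNorm (p := ENNReal.ofReal p) hTm u
    (.of_forall hTlim)
  have hfin : eLpNorm u (ENNReal.ofReal p) volume
      ≤ (ENNReal.ofReal C * ∫⁻ x, gagliardoDensity s u x) ^ (2⁻¹ : ℝ) :=
    hlim.trans (liminf_le_of_le (by isBoundedDefault) fun b hb => by
      obtain ⟨k, hk⟩ := hb.exists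
      exact hk.trans (hbound k))
  rw [ENNReal.le_rpow_inv_iff (by norm_num)] at hfin
  simpa using hfin

/-- The Sobolev embedding of `X₀`. -/
theorem IsSingularKernel.exists_sobolev (hK : IsSingularKernel s K) (hs : 0 < s) (hns : 2 * s < n)
    (hΩb : Bornology.IsBounded Ω) (hΩ : MeasurableSet Ω) :
    ∃ S : ℝ, 0 < S ∧ ∀ u ∈ X₀ K Ω,
      eLpNorm u (ENNReal.ofReal (twoStar n s)) volume ≤ ENNReal.ofReal (S * norm₀ K Ω u) := by
  obtain ⟨C, hC, h⟩ := exists_eLpNorm_sq_le (n := n) hs hns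
  obtain ⟨D, hD, h'⟩ := hK.exists_gagliardo_le hΩ
  refine ⟨√(C * D), by positivity, fun u hu => ?_⟩
  have h1 := (h Ω hΩb hΩ u hu.1.1 hu.2).trans (mul_le_mul_right (h' u hu) _)
  rw [← ENNReal.ofReal_mul hC.le] at h1
  have h2 : C * (D * norm₀ K Ω u ^ 2) = (√(C * D) * norm₀ K Ω u) ^ 2 := by
    rw [mul_pow, Real.sq_sqrt (by positivity)]; ring
  rw [h2, ENNReal.ofReal_pow (mul_nonneg (Real.sqrt_nonneg _) norm₀_nonneg)] at h1
  exact (ENNReal.pow_le_pow_left_iff two_ne_zero).1 h1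

end

/-! ### Compactness of the embedding into $L^2(\Omega)$ -/

section

variable {n : ℕ} {s : ℝ} {Ω : Set (EuclideanSpace ℝ (Fin n))}
  {K u v w : EuclideanSpace ℝ (Fin n) → ℝ}

theorem memLp_of_restrict {p : ℝ≥0∞} (hΩ : MeasurableSet Ω)
    (hu : MemLp u p (volume.restrict Ω))
    (hu0 : ∀ᵐ x ∂(volume.restrict Ωᶜ), u x = 0) : MemLp u p volume := by
  rw [← memLp_indicator_iff_restrict hΩ] at hu
  refine hu.ae_eq ?_
  rw [ae_restrict_iff' hΩ.compl] at hu0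
  filter_upwards [hu0] with x hx
  by_cases h : x ∈ Ω
  · simp [h]
  · simp [h, hx h]

theorem X₀_memLp_two (hΩ : MeasurableSet Ω) (hu : u ∈ X₀ K Ω) : MemLp u 2 volume :=
  memLp_of_restrict hΩ hu.1.2.1 hu.2

/-- On a ball, a function is controlled by its fractional oscillation and its mean. -/
theorem sq_le_of_mem_ball (hs : 0 < s) (hw : MemLp w 2 volume) {c x : EuclideanSpace ℝ (Fin n)}
    {ε : ℝ} (hε : 0 < ε) (hx : x ∈ Metric.ball c ε) (hd : gagliardoDensity s w x ≠ ∞) :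
    w x ^ 2 ≤ 2 * (2 * ε) ^ ((n : ℝ) + 2 * s) / volume.real (Metric.ball c ε)
        * (gagliardoDensity s w x).toReal
      + 4 / volume.real (Metric.ball c ε) ^ 2 * (∫ y in Metric.ball c ε, w y) ^ 2 := by
  set B := Metric.ball c ε with hB
  set b := volume.real B with hb
  have hb0 : 0 < b := ENNReal.toReal_pos (Metric.measure_ball_pos _ _ hε).ne'
    measure_ball_lt_top.ne
  have hfin : volume B ≠ ∞ := measure_ball_lt_top.ne
  have : IsFiniteMeasure (volume.restrict B) := isFiniteMeasure_restrict.2 hfin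
  have hwB : MemLp w 2 (volume.restrict B) := hw.restrict B
  have hi1 : Integrable w (volume.restrict B) := hwB.integrable (by norm_num)
  have hi2 : Integrable (fun y => w y ^ 2) (volume.restrict B) :=
    (memLp_two_iff_integrable_sq hwB.1).1 hwB
  set m := ∫ y in B, w y with hm
  -- Expanding the square leaves a cross term $2w(x)m$, half of which Young's inequality (`hyoung`)
  -- puts back into $w(x)^2|B|$.
  have hexp : ∫ y in B, (w x - w y) ^ 2 = w x ^ 2 * b - 2 * w x * m + ∫ y in B, w y ^ 2 := by
    have : (fun y => (w x - w y) ^ 2) = fun y => (w x ^ 2 - 2 * w x * w y) + w y ^ 2 := by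
      ext y; ring
    rw [this, integral_add (f := fun y => w x ^ 2 - 2 * w x * w y)
      ((integrable_const _).sub (hi1.const_mul _)) hi2,
      integral_sub (integrable_const _) (hi1.const_mul _), integral_const_mul]
    simp [hb, hm, mul_comm]
  have hosc : ∫ y in B, (w x - w y) ^ 2
      ≤ (2 * ε) ^ ((n : ℝ) + 2 * s) * (gagliardoDensity s w x).toReal := by
    have hi : Integrable (fun y => (w x - w y) ^ 2) (volume.restrict B) :=
      (memLp_two_iff_integrable_sq ((integrable_const _).1.sub hwB.1)).1
        ((memLp_const _).sub hwB)
    rw [← ENNReal.ofReal_le_ofReal_iff (by positivity), ofReal_integral_eq_lintegral_ofReal hi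
      (.of_forall fun _ => by positivity), ENNReal.ofReal_mul (by positivity),
      ENNReal.ofReal_toReal hd]
    refine setLIntegral_sq_sub_le hs (by positivity) measurableSet_ball fun y hy => ?_
    have h1 := Metric.mem_ball.1 hx
    have h2 := Metric.mem_ball.1 hy
    have := dist_triangle_right y x c
    exact Metric.mem_closedBall.2 (by linarith)
  have h0 : 0 ≤ ∫ y in B, w y ^ 2 := integral_nonneg fun _ => by positivity
  have hyoung : 2 * w x * m ≤ w x ^ 2 * b / 2 + 2 * m ^ 2 / b := by
    have : 0 ≤ (w x * b - 2 * m) ^ 2 / (2 * b) := by positivity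
    have e : (w x * b - 2 * m) ^ 2 / (2 * b)
        = w x ^ 2 * b / 2 + 2 * m ^ 2 / b - 2 * w x * m := by field_simp; ring
    linarith
  set d := (gagliardoDensity s w x).toReal
  have hfinal : w x ^ 2 * b ≤ 2 * ((2 * ε) ^ ((n : ℝ) + 2 * s) * d) + 4 * m ^ 2 / b := by
    have e : 4 * m ^ 2 / b = 2 * (2 * m ^ 2 / b) := by ring
    linarith
  rw [← le_div_iff₀ hb0] at hfinal
  refine hfinal.trans_eq ?_
  field_simp

/-- A quantitative form of the compactness of the embedding `X₀ ↪ L²(Ω)`. -/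
theorem IsSingularKernel.exists_integral_sq_le (hK : IsSingularKernel s K) (hs : 0 < s)
    (hΩb : Bornology.IsBounded Ω) (hΩ : MeasurableSet Ω) {η : ℝ} (hη : 0 < η) :
    ∃ (t : Finset (EuclideanSpace ℝ (Fin n))) (ε C : ℝ), 0 ≤ C ∧ ∀ w ∈ X₀ K Ω,
      ∫ x in Ω, w x ^ 2 ≤ η * norm₀ K Ω w ^ 2
        + C * ∑ c ∈ t, (∫ y in Metric.ball c ε, w y) ^ 2 := by
  obtain ⟨D, hD, hG⟩ := hK.exists_gagliardo_le hΩ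
  have : Nonempty (Fin n) := ⟨⟨0, hK.pos_dim⟩⟩
  set ω : ℝ := volume.real (Metric.ball (0 : EuclideanSpace ℝ (Fin n)) 1) with hω
  have hω0 : 0 < ω := by
    refine ENNReal.toReal_pos ?_ measure_ball_lt_top.ne
    exact (Metric.measure_ball_pos _ _ one_pos).ne'
  set c₁ : ℝ := 2 * 2 ^ ((n : ℝ) + 2 * s) / ω with hc₁
  have hc₁0 : 0 < c₁ := by positivity
  -- The coefficient of the Gagliardo density in `sq_le_of_mem_ball` is $c_1\varepsilon^{2s}$; this
  -- radius makes it $\eta/D$, and $D$ cancels when the density is integrated.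
  set ε : ℝ := (η / (c₁ * D)) ^ (1 / (2 * s)) with hε
  have hε0 : 0 < ε := by positivity
  have hεs : ε ^ (2 * s) = η / (c₁ * D) := by
    rw [hε, ← Real.rpow_mul (by positivity), one_div, inv_mul_cancel₀ (by positivity),
      Real.rpow_one]
  have hvol : ∀ c : EuclideanSpace ℝ (Fin n), volume.real (Metric.ball c ε) = ω * ε ^ (n : ℝ) := by
    intro c
    rw [measureReal_def, Measure.addHaar_ball _ _ hε0.le, finrank_euclideanSpace_fin,
      ENNReal.toReal_mul, ENNReal.toReal_ofReal (by positivity), mul_comm, Real.rpow_natCast]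
    rfl
  obtain ⟨t, htf, ht⟩ := Metric.totallyBounded_iff.1
    (hΩb.isCompact_closure.totallyBounded.subset subset_closure) ε hε0
  lift t to Finset (EuclideanSpace ℝ (Fin n)) using htf
  set b := ω * ε ^ (n : ℝ) with hb
  have hb0 : 0 < b := by positivity
  refine ⟨t, ε, 4 / b ^ 2 * volume.real Ω, by positivity, fun w hw => ?_⟩
  have hw2 := X₀_memLp_two hΩ hw
  have hGfin : ∫⁻ x, gagliardoDensity s w x ≠ ∞ :=
    ((hG w hw).trans_lt ENNReal.ofReal_lt_top).ne
  set σ := ∑ c ∈ t, (∫ y in Metric.ball c ε, w y) ^ 2 with hσ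
  have hσ0 : 0 ≤ σ := Finset.sum_nonneg fun _ _ => by positivity
  have hae : ∀ᵐ x ∂(volume.restrict Ω), ENNReal.ofReal (w x ^ 2)
      ≤ ENNReal.ofReal (η / D) * gagliardoDensity s w x + ENNReal.ofReal (4 / b ^ 2 * σ) := by
    filter_upwards [ae_restrict_of_ae (ae_lt_top' (aemeasurable_gagliardoDensity hw.1.1) hGfin),
      ae_restrict_mem hΩ] with x hx hxΩ
    obtain ⟨c, hc, hxc⟩ := mem_iUnion₂.1 (ht hxΩ)
    have h1 := sq_le_of_mem_ball hs hw2 hε0 hxc hx.ne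
    rw [hvol] at h1
    rw [← ENNReal.ofReal_toReal hx.ne, ← ENNReal.ofReal_mul (by positivity),
      ← ENNReal.ofReal_add (by positivity) (by positivity)]
    refine ENNReal.ofReal_le_ofReal (h1.trans ?_)
    have e1 : 2 * (2 * ε) ^ ((n : ℝ) + 2 * s) / b = η / D := by
      rw [Real.mul_rpow (by norm_num) hε0.le, Real.rpow_add hε0, hεs, hb, hc₁]
      field_simp
    rw [e1]
    gcongr
    exact Finset.single_le_sum (f := fun c => (∫ y in Metric.ball c ε, w y) ^ 2)
      (fun _ _ => by positivity) hc
  have hint := lintegral_mono_ae hae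
  rw [lintegral_add_right' _ aemeasurable_const,
    lintegral_const_mul' _ _ ENNReal.ofReal_ne_top, lintegral_const,
    Measure.restrict_apply_univ] at hint
  have hwΩ : Integrable (fun x => w x ^ 2) (volume.restrict Ω) :=
    (memLp_two_iff_integrable_sq hw.1.2.1.1).1 hw.1.2.1
  rw [← ofReal_integral_eq_lintegral_ofReal hwΩ (.of_forall fun _ => by positivity)] at hint
  rw [← ENNReal.ofReal_le_ofReal_iff (by positivity)]
  refine hint.trans ?_
  rw [ENNReal.ofReal_add (by positivity) (by positivity)]
  refine add_le_add ?_ (le_of_eq ?_)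
  · calc ENNReal.ofReal (η / D) * ∫⁻ x in Ω, gagliardoDensity s w x
        ≤ ENNReal.ofReal (η / D) * ENNReal.ofReal (D * norm₀ K Ω w ^ 2) := by
          gcongr
          exact (setLIntegral_le_lintegral _ _).trans (hG w hw)
      _ = _ := by
          rw [← ENNReal.ofReal_mul (by positivity)]
          congr 1
          field_simp
  · rw [← ENNReal.ofReal_toReal hΩb.measure_lt_top.ne, ← ENNReal.ofReal_mul (by positivity),
      measureReal_def]
    congr 1
    ring

/-- Hölder on a set of finite measure followed by Sobolev. It makes the integrals over balls of a
norm-bounded sequence bounded sequences of reals. -/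
theorem IsSingularKernel.exists_abs_setIntegral_le (hK : IsSingularKernel s K) (hs : 0 < s)
    (hns : 2 * s < n) (hΩb : Bornology.IsBounded Ω) (hΩ : MeasurableSet Ω)
    {B : Set (EuclideanSpace ℝ (Fin n))} (hB : volume B ≠ ∞) :
    ∃ M : ℝ, ∀ u ∈ X₀ K Ω, |∫ y in B, u y| ≤ M * norm₀ K Ω u := by
  obtain ⟨S, hS, h⟩ := hK.exists_sobolev hs hns hΩb hΩ
  have hp2 := two_lt_twoStar hs hns
  set p := twoStar n s
  refine ⟨S * (volume B).toReal ^ (1 - 1 / p), fun u hu => ?_⟩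
  have hp : (1 : ℝ≥0∞) ≤ ENNReal.ofReal p := by
    rw [← ENNReal.ofReal_one]; exact ENNReal.ofReal_le_ofReal (by linarith)
  have h1 := eLpNorm_le_eLpNorm_mul_rpow_measure_univ (μ := volume.restrict B)
    hp (hu.1.1.restrict (s := B))
  rw [ENNReal.toReal_ofReal (by linarith), Measure.restrict_apply_univ, ENNReal.toReal_one,
    div_one] at h1
  have hexp : 0 ≤ 1 - 1 / p := by
    rw [sub_nonneg, div_le_one (by linarith)]; linarith
  rw [← ENNReal.ofReal_le_ofReal_iff
    (mul_nonneg (mul_nonneg hS.le (by positivity)) norm₀_nonneg), ← Real.norm_eq_abs, ofReal_norm]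
  calc ‖∫ y in B, u y‖ₑ ≤ ∫⁻ y in B, ‖u y‖ₑ := enorm_integral_le_lintegral_enorm _
    _ = eLpNorm u 1 (volume.restrict B) := eLpNorm_one_eq_lintegral_enorm.symm
    _ ≤ eLpNorm u (ENNReal.ofReal p) (volume.restrict B) * volume B ^ (1 - 1 / p) := h1
    _ ≤ ENNReal.ofReal (S * norm₀ K Ω u) * volume B ^ (1 - 1 / p) := by
        gcongr
        exact (eLpNorm_mono_measure _ Measure.restrict_le_self).trans (h u hu)
    _ = _ := by
        rw [← ENNReal.ofReal_toReal hB, ENNReal.ofReal_rpow_of_nonneg (by positivity) hexp,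
          ← ENNReal.ofReal_mul (mul_nonneg hS.le norm₀_nonneg), ENNReal.ofReal_toReal hB]
        congr 1; ring

/-- Compactness of the embedding `X₀ ↪ L²(Ω)`: bounded sequences have Cauchy subsequences. -/
theorem IsSingularKernel.exists_subseq_cauchy (hK : IsSingularKernel s K) (hs : 0 < s)
    (hns : 2 * s < n) (hΩb : Bornology.IsBounded Ω) (hΩ : MeasurableSet Ω)
    {U : ℕ → EuclideanSpace ℝ (Fin n) → ℝ} {ρ : ℝ} (hU : ∀ k, U k ∈ X₀ K Ω)
    (hρ : ∀ k, norm₀ K Ω (U k) ≤ ρ) :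
    ∃ φ : ℕ → ℕ, StrictMono φ ∧
      Tendsto (fun p : ℕ × ℕ => ∫ x in Ω, (U (φ p.1) x - U (φ p.2) x) ^ 2) atTop (𝓝 0) := by
  have hηj : ∀ j : ℕ, 0 < 1 / ((j : ℝ) + 1) := fun j => by positivity
  choose t ε C hC hcpt using fun j : ℕ => hK.exists_integral_sq_le hs hΩb hΩ (hηj j)
  have hρ0 : 0 ≤ ρ := norm₀_nonneg.trans (hρ 0)
  choose M hM using fun i : (Σ j : ℕ, t j) => hK.exists_abs_setIntegral_le hs hns hΩb hΩ
    (B := Metric.ball (i.2 : EuclideanSpace ℝ (Fin n)) (ε i.1)) measure_ball_lt_top.ne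
  set F : ℕ → (Σ j : ℕ, t j) → ℝ := fun k i =>
    ∫ y in Metric.ball (i.2 : EuclideanSpace ℝ (Fin n)) (ε i.1), U k y with hF
  -- All ball integrals, for every precision $1/(j+1)$ at once, form a sequence in a countable
  -- product of compact intervals; sequential compactness of the product replaces a diagonal
  -- extraction.
  have hcomp : IsCompact (Set.pi univ fun i : (Σ j : ℕ, t j) => Icc (-(|M i| * ρ)) (|M i| * ρ)) :=
    isCompact_univ_pi fun _ => isCompact_Icc
  have hmem : ∀ k, F k ∈ Set.pi univ fun i : (Σ j : ℕ, t j) =>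
      Icc (-(|M i| * ρ)) (|M i| * ρ) := by
    intro k i _
    refine abs_le.1 ((hM i _ (hU k)).trans ?_)
    exact mul_le_mul (le_abs_self _) (hρ k) norm₀_nonneg (abs_nonneg _)
  obtain ⟨a, -, φ, hφ, hlim⟩ := hcomp.tendsto_subseq hmem
  refine ⟨φ, hφ, ?_⟩
  rw [tendsto_pi_nhds] at hlim
  have hX : ∀ p : ℕ × ℕ, U (φ p.1) - U (φ p.2) ∈ X₀ K Ω := fun p => X₀_sub (hU _) (hU _)
  have hnorm : ∀ p : ℕ × ℕ, norm₀ K Ω (U (φ p.1) - U (φ p.2)) ^ 2 ≤ (2 * ρ) ^ 2 := by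
    intro p
    have h1 := hK.norm₀_add_le (hU (φ p.1)) (X₀_smul (-1) (hU (φ p.2)))
    rw [hK.norm₀_smul, neg_one_smul, ← sub_eq_add_neg] at h1
    have h2 := hρ (φ p.1)
    have h3 := hρ (φ p.2)
    refine pow_le_pow_left₀ norm₀_nonneg ?_ 2
    simp at h1
    linarith
  rw [tendsto_order]
  refine ⟨fun b hb => .of_forall fun p => hb.trans_le (integral_nonneg fun _ => by positivity),
    fun δ hδ => ?_⟩
  -- Precision for which the norm term, at most $(2\rho)^2/(j+1)$, stays below $\delta/2$; the ball
  -- integrals contribute the other half.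
  obtain ⟨j, hj⟩ := exists_nat_one_div_lt (show 0 < δ / (2 * ((2 * ρ) ^ 2 + 1)) by positivity)
  have hsum : Tendsto (fun p : ℕ × ℕ => C j * ∑ c ∈ t j,
      (∫ y in Metric.ball c (ε j), (U (φ p.1) - U (φ p.2)) y) ^ 2) atTop (𝓝 0) := by
    have : Tendsto (fun p : ℕ × ℕ => C j * ∑ c ∈ t j,
        (∫ y in Metric.ball c (ε j), (U (φ p.1) - U (φ p.2)) y) ^ 2) atTop
        (𝓝 (C j * ∑ c ∈ t j, 0)) := by
      refine Tendsto.const_mul _ (tendsto_finsetSum _ fun c hc => ?_)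
      have hl := hlim ⟨j, ⟨c, hc⟩⟩
      have h1 : Tendsto (fun p : ℕ × ℕ => F (φ p.1) ⟨j, ⟨c, hc⟩⟩ - F (φ p.2) ⟨j, ⟨c, hc⟩⟩) atTop
          (𝓝 (a ⟨j, ⟨c, hc⟩⟩ - a ⟨j, ⟨c, hc⟩⟩)) := by
        rw [← prod_atTop_atTop_eq]
        exact (hl.comp tendsto_fst).sub (hl.comp tendsto_snd)
      have h2 := h1.pow 2
      simp only [sub_self, ne_eq, OfNat.ofNat_ne_zero, not_false_eq_true, zero_pow] at h2
      refine h2.congr fun p => ?_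
      have hi : ∀ k, IntegrableOn (U k) (Metric.ball c (ε j)) volume := fun k => by
        have : IsFiniteMeasure (volume.restrict (Metric.ball c (ε j))) :=
          isFiniteMeasure_restrict.2 measure_ball_lt_top.ne
        exact ((X₀_memLp_two hΩ (hU k)).restrict _).integrable (by norm_num)
      simp only [hF, Pi.sub_apply]
      rw [integral_sub (hi _) (hi _)]
    simpa using this
  filter_upwards [hsum.eventually (gt_mem_nhds (half_pos hδ))] with p hp
  have h1 := hcpt j _ (hX p)
  have h2 : 1 / ((j : ℝ) + 1) * norm₀ K Ω (U (φ p.1) - U (φ p.2)) ^ 2 ≤ δ / 2 := by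
    calc 1 / ((j : ℝ) + 1) * norm₀ K Ω (U (φ p.1) - U (φ p.2)) ^ 2
        ≤ δ / (2 * ((2 * ρ) ^ 2 + 1)) * (2 * ρ) ^ 2 :=
          mul_le_mul hj.le (hnorm p) (by positivity) (by positivity)
      _ ≤ δ / 2 := by
          rw [div_mul_eq_mul_div, div_le_div_iff₀ (by positivity) (by positivity)]
          nlinarith
  calc ∫ x in Ω, (U (φ p.1) x - U (φ p.2) x) ^ 2
      ≤ _ := h1
    _ < δ := by linarith

end

/-! ### A positive element of `X₀`, the embedding constant, completeness -/

section

variable {n : ℕ} {s : ℝ} {Ω : Set (EuclideanSpace ℝ (Fin n))}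
  {K u v w : EuclideanSpace ℝ (Fin n) → ℝ}

/-- `Q Ω` is covered by $\Omega\times\mathbb R^n$ and $\mathbb R^n\times\Omega$; Tonelli and
translation invariance bound each part by $|\Omega|\int h$. -/
theorem lintegral_Q_sub_lt_top {h : EuclideanSpace ℝ (Fin n) → ℝ≥0∞}
    (hΩf : volume Ω ≠ ∞) (hm : AEMeasurable h volume)
    (hh : ∫⁻ x, h x ≠ ∞) : ∫⁻ p in Q Ω, h (p.1 - p.2) < ∞ := by
  have hQ : Q Ω ⊆ (Ω ×ˢ univ) ∪ (univ ×ˢ Ω) := by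
    intro p hp
    simp only [Q, mem_compl_iff, mem_prod, not_and_or, not_not] at hp
    simpa using hp
  have hm2 : AEMeasurable (fun p : EuclideanSpace ℝ (Fin n) × EuclideanSpace ℝ (Fin n) =>
      h (p.1 - p.2)) (volume.prod volume) :=
    hm.comp_quasiMeasurePreserving (quasiMeasurePreserving_sub_of_right_invariant volume volume)
  refine ((lintegral_mono_set hQ).trans (lintegral_union_le _ _ _)).trans_lt ?_
  refine ENNReal.add_lt_top.2 ⟨?_, ?_⟩
  · rw [Measure.volume_eq_prod, setLIntegral_prod _ hm2.restrict]
    simp only [Measure.restrict_univ]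
    simp_rw [lintegral_sub_left_eq_self h, setLIntegral_const]
    exact ENNReal.mul_lt_top hh.lt_top hΩf.lt_top
  · rw [Measure.volume_eq_prod, setLIntegral_prod_symm _ hm2.restrict]
    simp only [Measure.restrict_univ]
    simp_rw [lintegral_sub_right_eq_self h, setLIntegral_const]
    exact ENNReal.mul_lt_top hh.lt_top hΩf.lt_top

theorem infDist_compl_pos (hΩo : IsOpen Ω) (hne : Ωᶜ.Nonempty)
    {x : EuclideanSpace ℝ (Fin n)} (hx : x ∈ Ω) : 0 < Metric.infDist x Ωᶜ :=
  (hΩo.isClosed_compl.notMem_iff_infDist_pos hne).1 (by simpa using hx)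

namespace IsSingularKernel

variable (hK : IsSingularKernel s K)
include hK

theorem compl_nonempty (hΩb : Bornology.IsBounded Ω) : Ωᶜ.Nonempty := by
  have := hK.nontrivial
  rw [nonempty_compl]
  rintro rfl
  exact NormedSpace.unbounded_univ ℝ _ hΩb

/-- An explicit element of `X₀` that is positive throughout $\Omega$. The distance is 1-Lipschitz
and bounded by $M$, so its squared increments are at most $(1+M^2)\min(|x-y|^2,1)$, which is
integrable against the kernel over `Q Ω`. -/
theorem infDist_mem_X₀ (hΩb : Bornology.IsBounded Ω) (hΩ : MeasurableSet Ω) :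
    (fun x => Metric.infDist x Ωᶜ) ∈ X₀ K Ω := by
  obtain ⟨y, hy⟩ := hK.compl_nonempty hΩb
  obtain ⟨R, hR⟩ := hΩb.subset_ball y
  set M : ℝ := max R 0 with hM
  have hb : ∀ x, Metric.infDist x Ωᶜ ≤ M := by
    intro x
    by_cases hx : x ∈ Ω
    · exact (Metric.infDist_le_dist_of_mem hy).trans
        ((Metric.mem_ball.1 (hR hx)).le.trans (le_max_left _ _))
    · rw [Metric.infDist_zero_of_mem hx]; exact le_max_right _ _
  have hM0 : 0 ≤ M := le_max_right _ _
  have hc : Continuous fun x => Metric.infDist x Ωᶜ := Metric.continuous_infDist_pt _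
  have hfin : volume Ω ≠ ∞ := hΩb.measure_lt_top.ne
  have : IsFiniteMeasure (volume.restrict Ω) := isFiniteMeasure_restrict.2 hfin
  have hmeas := hK.aestronglyMeasurable_incr (hc.aestronglyMeasurable (μ := volume))
  refine ⟨⟨hc.aestronglyMeasurable, ?_, ?_⟩, ?_⟩
  · refine MemLp.of_bound hc.aestronglyMeasurable M (.of_forall fun x => ?_)
    rw [Real.norm_eq_abs, abs_of_nonneg Metric.infDist_nonneg]
    exact hb x
  · refine (memLp_two_iff_integrable_sq hmeas.restrict).2
      ⟨(hmeas.restrict.aemeasurable.pow_const 2).aestronglyMeasurable, ?_⟩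
    have hi := hK.integrable.const_mul (1 + M ^ 2)
    have hlt := lintegral_Q_sub_lt_top hfin hi.1.enorm hi.2.ne
    refine lt_of_le_of_lt (lintegral_mono_ae (ae_restrict_of_ae ?_)) hlt
    filter_upwards [hK.ae_sub_ne_zero] with p hp
    have hk := hK.nonneg hp
    refine enorm_le_iff_norm_le.2 ?_
    rw [Real.norm_eq_abs, Real.norm_eq_abs, abs_of_nonneg (by positivity),
      abs_of_nonneg (by positivity), incr, mul_pow, Real.sq_sqrt hk, ← mul_assoc]
    gcongr
    have h1 : |Metric.infDist p.1 Ωᶜ - Metric.infDist p.2 Ωᶜ| ≤ ‖p.1 - p.2‖ := by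
      have := (Metric.lipschitz_infDist_pt Ωᶜ).dist_le_mul p.1 p.2
      rwa [Real.dist_eq, NNReal.coe_one, one_mul, dist_eq_norm] at this
    have h2 : |Metric.infDist p.1 Ωᶜ - Metric.infDist p.2 Ωᶜ| ≤ M := by
      rw [abs_le]
      constructor <;> linarith [hb p.1, hb p.2, Metric.infDist_nonneg (x := p.1) (s := Ωᶜ),
        Metric.infDist_nonneg (x := p.2) (s := Ωᶜ)]
    rw [← sq_abs]
    rcases le_total (‖p.1 - p.2‖ ^ 2) 1 with h | h
    · rw [min_eq_left h]
      have : |Metric.infDist p.1 Ωᶜ - Metric.infDist p.2 Ωᶜ| ^ 2 ≤ ‖p.1 - p.2‖ ^ 2 := by gcongr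
      nlinarith [sq_nonneg ‖p.1 - p.2‖, sq_nonneg M, mul_nonneg (sq_nonneg M) (sq_nonneg ‖p.1 - p.2‖)]
    · rw [min_eq_right h]
      have : |Metric.infDist p.1 Ωᶜ - Metric.infDist p.2 Ωᶜ| ^ 2 ≤ M ^ 2 := by gcongr
      linarith
  · filter_upwards [ae_restrict_mem hΩ.compl] with x hx
    exact Metric.infDist_zero_of_mem hx

/-- The distance function makes the supremum nonzero. Its finiteness, from the Sobolev inequality,
matters just as much, since `toReal` sends $\infty$ to $0$. -/
theorem embConst_pos (hs : 0 < s) (hns : 2 * s < n) (hΩo : IsOpen Ω)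
    (hΩb : Bornology.IsBounded Ω) (hΩne : Ω.Nonempty) : 0 < embConst K Ω (twoStar n s) := by
  have hΩ := hΩo.measurableSet
  obtain ⟨S, hS, hsob⟩ := hK.exists_sobolev hs hns hΩb hΩ
  have hp2 := two_lt_twoStar hs hns
  have hv := hK.infDist_mem_X₀ hΩb hΩ
  set v : EuclideanSpace ℝ (Fin n) → ℝ := fun x => Metric.infDist x Ωᶜ with hvdef
  have hvne : ¬ v =ᵐ[volume] 0 := by
    intro h0
    have h1 : volume Ω = 0 := by
      refine measure_mono_null (fun x hx => ?_) (ae_iff.1 h0)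
      exact (infDist_compl_pos hΩo (hK.compl_nonempty hΩb) hx).ne'
    exact (hΩo.measure_pos volume hΩne).ne' h1
  refine ENNReal.toReal_pos (ne_of_gt ?_) (ne_of_lt ?_)
  · refine lt_of_lt_of_le ?_ (le_iSup₂_of_le v hv (le_iSup_of_le hvne le_rfl))
    refine ENNReal.div_pos ?_ ENNReal.ofReal_ne_top
    rwa [ne_eq, eLpNorm_eq_zero_iff hv.1.1 (by simpa using by linarith)]
  · refine lt_of_le_of_lt (iSup₂_le fun u hu => iSup_le fun _ => ?_)
      (ENNReal.ofReal_lt_top (r := S))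
    refine ENNReal.div_le_of_le_mul ?_
    rw [← ENNReal.ofReal_mul hS.le]
    exact hsob u hu

/-- Cauchy sequences of nonnegative elements of `X₀` converge. -/
theorem exists_limit (hs : 0 < s) (hns : 2 * s < n) (hΩb : Bornology.IsBounded Ω)
    (hΩ : MeasurableSet Ω) {U : ℕ → EuclideanSpace ℝ (Fin n) → ℝ} (hU : ∀ k, U k ∈ X₀ K Ω)
    (hU0 : ∀ k x, 0 ≤ U k x)
    (hcau : Tendsto (fun p : ℕ × ℕ => norm₀ K Ω (U p.1 - U p.2)) atTop (𝓝 0)) :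
    ∃ u ∈ X₀ K Ω, (∀ x, 0 ≤ u x) ∧ Tendsto (fun k => norm₀ K Ω (U k - u)) atTop (𝓝 0) := by
  obtain ⟨S, hS, hsob⟩ := hK.exists_sobolev hs hns hΩb hΩ
  have hp2 := two_lt_twoStar hs hns
  set p := twoStar n s
  have hp1 : (1 : ℝ≥0∞) ≤ ENNReal.ofReal p := by
    rw [← ENNReal.ofReal_one]; exact ENNReal.ofReal_le_ofReal (by linarith)
  have : Fact (1 ≤ ENNReal.ofReal p) := ⟨hp1⟩
  have hLp : ∀ w ∈ X₀ K Ω, MemLp w (ENNReal.ofReal p) volume := fun w hw =>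
    ⟨hw.1.1, (hsob w hw).trans_lt ENNReal.ofReal_lt_top⟩
  have hN : ∀ ε : ℝ, 0 < ε → ∃ N, ∀ k ≥ N, ∀ l ≥ N, norm₀ K Ω (U k - U l) < ε := by
    intro ε hε
    obtain ⟨⟨a, b⟩, hab⟩ := eventually_atTop.1 (hcau.eventually (gt_mem_nhds hε))
    exact ⟨max a b, fun k hk l hl => hab (k, l)
      ⟨(le_max_left _ _).trans hk, (le_max_right _ _).trans hl⟩⟩
  have hcs : CauchySeq fun k => (hLp _ (hU k)).toLp (U k) := by
    rw [Metric.cauchySeq_iff]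
    intro ε hε
    obtain ⟨N, hN⟩ := hN (ε / S) (by positivity)
    refine ⟨N, fun k hk l hl => ?_⟩
    rw [Lp.dist_edist, Lp.edist_toLp_toLp]
    have h1 := ENNReal.toReal_mono ENNReal.ofReal_ne_top (hsob _ (X₀_sub (hU k) (hU l)))
    rw [ENNReal.toReal_ofReal (mul_nonneg hS.le norm₀_nonneg)] at h1
    refine h1.trans_lt ?_
    have := hN k hk l hl
    rwa [lt_div_iff₀ hS, mul_comm] at this
  obtain ⟨f, hf⟩ := cauchySeq_tendsto_of_complete hcs
  have hfm := tendstoInMeasure_of_tendsto_Lp hf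
  obtain ⟨ψ, hψ, hae⟩ := hfm.exists_seq_tendsto_ae
  have hae' : ∀ᵐ x, Tendsto (fun k => U (ψ k) x) atTop (𝓝 (f x)) := by
    have h2 : ∀ᵐ x, ∀ k, (hLp _ (hU k)).toLp (U k) x = U k x :=
      ae_all_iff.2 fun k => (hLp _ (hU k)).coeFn_toLp
    filter_upwards [hae, h2] with x hx hx2
    simpa [hx2] using hx
  -- The limit comes from completeness of $L^{2^*}$; taking its positive part changes it only on a
  -- null set and makes the representative nonnegative everywhere.
  set u : EuclideanSpace ℝ (Fin n) → ℝ := fun x => max (f x) 0 with hu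
  have hum : AEStronglyMeasurable u volume :=
    (Lp.aestronglyMeasurable f).sup aestronglyMeasurable_const
  have hlim : ∀ᵐ x, Tendsto (fun k => U (ψ k) x) atTop (𝓝 (u x)) := by
    filter_upwards [hae'] with x hx
    have : 0 ≤ f x := ge_of_tendsto' hx fun k => hU0 _ _
    simpa only [hu, max_eq_left this] using hx
  have huLp : MemLp u (ENNReal.ofReal p) volume := (Lp.memLp f).pos_part
  have hu0 : ∀ᵐ x ∂(volume.restrict Ωᶜ), u x = 0 := by
    filter_upwards [ae_restrict_of_ae hlim, ae_all_iff.2 fun k => (hU (ψ k)).2] with x hx h0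
    refine tendsto_nhds_unique hx ?_
    simp [h0]
  have hfin : IsFiniteMeasure (volume.restrict Ω) :=
    isFiniteMeasure_restrict.2 hΩb.measure_lt_top.ne
  -- Fatou's lemma for the increments, along the a.e. convergent subsequence. It yields both the
  -- membership of `u` in `X₀` and the convergence in norm.
  have hbound : ∀ k (ε : ℝ), (∀ᶠ l in atTop, norm₀ K Ω (U k - U l) < ε) →
      eLpNorm (incr K (U k - u)) 2 (volume.restrict (Q Ω)) ≤ ENNReal.ofReal ε := by
    intro k ε hε
    have hl1 : ∀ᵐ q : EuclideanSpace ℝ (Fin n) × EuclideanSpace ℝ (Fin n),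
        Tendsto (fun l => U (ψ l) q.1) atTop (𝓝 (u q.1)) :=
      Measure.quasiMeasurePreserving_fst.ae hlim
    have hl2 : ∀ᵐ q : EuclideanSpace ℝ (Fin n) × EuclideanSpace ℝ (Fin n),
        Tendsto (fun l => U (ψ l) q.2) atTop (𝓝 (u q.2)) :=
      Measure.quasiMeasurePreserving_snd.ae hlim
    have h := Lp.eLpNorm_lim_le_liminf_eLpNorm (p := 2) (μ := volume.restrict (Q Ω))
      (f := fun l => incr K (U k - U (ψ l)))
      (fun l => (memLp_incr (X₀_sub (hU k) (hU (ψ l)))).1) (incr K (U k - u))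
      (by
        filter_upwards [ae_restrict_of_ae hl1, ae_restrict_of_ae hl2] with q h1 h2
        simp only [incr, Pi.sub_apply]
        exact (((tendsto_const_nhds.sub h1).sub (tendsto_const_nhds.sub h2)).mul_const _))
    refine h.trans (liminf_le_of_le (by isBoundedDefault) fun b hb => ?_)
    obtain ⟨l, hl, hl'⟩ := (hb.and (hψ.tendsto_atTop.eventually hε)).exists
    rw [← hK.ofReal_norm₀ (X₀_sub (hU k) (hU (ψ l)))] at hl
    exact hl.trans (ENNReal.ofReal_le_ofReal hl'.le)
  have hev : ∀ ε : ℝ, 0 < ε → ∃ N, ∀ k ≥ N, ∀ᶠ l in atTop, norm₀ K Ω (U k - U l) < ε :=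
    fun ε hε => by
      obtain ⟨N, hN⟩ := hN ε hε
      exact ⟨N, fun k hk => (eventually_ge_atTop N).mono fun l hl => hN k hk l hl⟩
  have huX : u ∈ X₀ K Ω := by
    refine ⟨⟨hum, ?_, ?_⟩, hu0⟩
    · refine (huLp.restrict Ω).mono_exponent ?_
      rw [← ENNReal.ofReal_ofNat]
      exact ENNReal.ofReal_le_ofReal hp2.le
    · obtain ⟨N, hN⟩ := hev 1 one_pos
      have h1 : MemLp (incr K (U N - u)) 2 (volume.restrict (Q Ω)) :=
        ⟨(hK.aestronglyMeasurable_incr ((hU N).1.1.sub hum)).restrict,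
          (hbound N 1 (hN N le_rfl)).trans_lt ENNReal.ofReal_lt_top⟩
      have h2 := (memLp_incr (hU N)).sub h1
      rw [← incr_sub, sub_sub_cancel] at h2
      exact h2
  refine ⟨u, huX, fun x => le_max_right _ _, ?_⟩
  rw [Metric.tendsto_atTop]
  intro ε hε
  obtain ⟨N, hN⟩ := hev (ε / 2) (by positivity)
  refine ⟨N, fun k hk => ?_⟩
  have h1 := hbound k _ (hN k hk)
  rw [← hK.ofReal_norm₀ (X₀_sub (hU k) huX), ENNReal.ofReal_le_ofReal_iff (by positivity)] at h1
  rw [Real.dist_eq, sub_zero, abs_of_nonneg norm₀_nonneg]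
  linarith

end IsSingularKernel

end

/-! ### Integral functionals on `X₀` -/

section

variable {n : ℕ} {s : ℝ} {Ω : Set (EuclideanSpace ℝ (Fin n))}
  {K u v w a b : EuclideanSpace ℝ (Fin n) → ℝ} {p S r q a₁ a₂ ρ : ℝ} {g : ℝ → ℝ}

/-- The embedding `X₀ ↪ L^p` holds with constant `S`, for a superquadratic exponent `p`. -/
structure HasSobolevBound (K : EuclideanSpace ℝ (Fin n) → ℝ) (Ω : Set (EuclideanSpace ℝ (Fin n)))
    (p S : ℝ) : Prop where
  two_lt : 2 < p
  pos : 0 < S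
  bound : ∀ u ∈ X₀ K Ω, eLpNorm u (ENNReal.ofReal p) volume ≤ ENNReal.ofReal (S * norm₀ K Ω u)

/-- Continuous nonnegative nonlinearities of growth below `t ^ (p - 1)`. -/
structure IsSubcritical (p a₁ a₂ q : ℝ) (g : ℝ → ℝ) : Prop where
  continuous : Continuous g
  nonneg : ∀ t, 0 ≤ g t
  a₁_nonneg : 0 ≤ a₁
  a₂_nonneg : 0 ≤ a₂
  one_le : 1 ≤ q
  lt : q < p
  growth : ∀ t, 0 ≤ t → g t ≤ a₁ + a₂ * t ^ (q - 1)

/-- The primitive of `t ^ (r - 1) + g t`. -/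
def lowerPrimitive (r : ℝ) (g : ℝ → ℝ) (t : ℝ) : ℝ := t ^ r / r + ∫ τ in (0 : ℝ)..t, g τ

namespace IsSubcritical

variable (hg : IsSubcritical p a₁ a₂ q g)
include hg

theorem continuous_primitive : Continuous fun t => ∫ τ in (0 : ℝ)..t, g τ :=
  intervalIntegral.continuous_primitive (fun _ _ => hg.continuous.intervalIntegrable _ _) 0

theorem primitive_nonneg {t : ℝ} (ht : 0 ≤ t) : 0 ≤ ∫ τ in (0 : ℝ)..t, g τ :=
  intervalIntegral.integral_nonneg ht fun τ _ => hg.nonneg τ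

theorem primitive_le {t : ℝ} (ht : 0 ≤ t) :
    ∫ τ in (0 : ℝ)..t, g τ ≤ a₁ * t + a₂ * t ^ q := by
  have h := intervalIntegral.norm_integral_le_of_norm_le_const (a := 0) (b := t) (f := g)
    (C := a₁ + a₂ * t ^ (q - 1)) fun τ hτ => by
      rw [uIoc_of_le ht] at hτ
      rw [Real.norm_eq_abs, abs_of_nonneg (hg.nonneg τ)]
      refine (hg.growth τ hτ.1.le).trans ?_
      have := hg.a₂_nonneg
      have : τ ^ (q - 1) ≤ t ^ (q - 1) :=
        Real.rpow_le_rpow hτ.1.le hτ.2 (by linarith [hg.one_le])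
      gcongr
  rw [Real.norm_eq_abs, abs_of_nonneg (hg.primitive_nonneg ht), sub_zero, abs_of_nonneg ht] at h
  refine h.trans_eq ?_
  have : t ^ q = t ^ (q - 1) * t := by
    rcases ht.eq_or_lt with rfl | ht
    · rw [Real.zero_rpow (by linarith [hg.one_le]), mul_zero]
    · rw [← Real.rpow_add_one ht.ne', sub_add_cancel]
  rw [this]; ring

theorem continuous_lowerPrimitive (hr : 0 < r) : Continuous (lowerPrimitive r g) :=
  ((Real.continuous_rpow_const hr.le).div_const r).add hg.continuous_primitive

theorem lowerPrimitive_nonneg (hr : 0 < r) {t : ℝ} (ht : 0 ≤ t) : 0 ≤ lowerPrimitive r g t :=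
  add_nonneg (by positivity) (hg.primitive_nonneg ht)

theorem lowerPrimitive_subcritical (hr : 0 < r) (hrp : r < p) {ε : ℝ} (hε : 0 < ε) :
    ∃ C : ℝ, 0 ≤ C ∧ ∀ t : ℝ, 0 ≤ t → |lowerPrimitive r g t| ≤ C + ε * t ^ p := by
  have h1 := hg.one_le
  have h2 := hg.lt
  have h3 := hg.a₁_nonneg
  have h4 := hg.a₂_nonneg
  -- The error `δ * t ^ p` occurs with the weights $1/r$, $a_1$ and $a_2$; this choice makes the
  -- total `ε * t ^ p`.
  set δ := ε / (1 / r + a₁ + a₂) with hδ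
  have hδ0 : 0 < δ := by positivity
  obtain ⟨C₁, hC₁, hC₁'⟩ := rpow_le_const_add_mul_rpow hr.le hrp hδ0
  obtain ⟨C₂, hC₂, hC₂'⟩ := rpow_le_const_add_mul_rpow zero_le_one (h1.trans_lt h2) hδ0
  obtain ⟨C₃, hC₃, hC₃'⟩ := rpow_le_const_add_mul_rpow (by linarith) h2 hδ0
  refine ⟨C₁ / r + a₁ * C₂ + a₂ * C₃, by positivity, fun t ht => ?_⟩
  rw [abs_of_nonneg (hg.lowerPrimitive_nonneg hr ht), lowerPrimitive]
  have e1 : t ^ r / r ≤ (C₁ + δ * t ^ p) / r := by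
    have := hC₁' t ht
    gcongr
  have e2 : a₁ * t ≤ a₁ * (C₂ + δ * t ^ p) := by
    have := hC₂' t ht
    rw [Real.rpow_one] at this
    gcongr
  have e3 : a₂ * t ^ q ≤ a₂ * (C₃ + δ * t ^ p) := by
    have := hC₃' t ht
    gcongr
  have e4 := hg.primitive_le ht
  have e5 : ε * t ^ p = δ * t ^ p / r + a₁ * (δ * t ^ p) + a₂ * (δ * t ^ p) := by
    have : ε = δ * (1 / r + a₁ + a₂) := by
      rw [hδ, div_mul_cancel₀]
      positivity
    rw [this]; ring
  rw [add_div] at e1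
  linarith

end IsSubcritical

namespace HasSobolevBound

variable (hS : HasSobolevBound K Ω p S)
include hS

theorem memLp (hu : u ∈ X₀ K Ω) : MemLp u (ENNReal.ofReal p) (volume.restrict Ω) :=
  MemLp.restrict Ω ⟨hu.1.1, (hS.bound u hu).trans_lt ENNReal.ofReal_lt_top⟩

theorem toReal_eLpNorm_le (hu : u ∈ X₀ K Ω) :
    (eLpNorm u (ENNReal.ofReal p) (volume.restrict Ω)).toReal ≤ S * norm₀ K Ω u := by
  refine ENNReal.toReal_le_of_le_ofReal (mul_nonneg hS.pos.le norm₀_nonneg) ?_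
  exact (eLpNorm_mono_measure _ Measure.restrict_le_self).trans (hS.bound u hu)

theorem integrable_rpow (hu : u ∈ X₀ K Ω) (hu0 : ∀ x, 0 ≤ u x) :
    IntegrableOn (fun x => u x ^ p) Ω volume := by
  have h2 := hS.two_lt
  have := (hS.memLp hu).integrable_norm_rpow (by simpa using by linarith) (by simp)
  rw [ENNReal.toReal_ofReal (by linarith)] at this
  refine this.congr (.of_forall fun x => ?_)
  simp [abs_of_nonneg (hu0 x)]

theorem integral_rpow_eq (hu : u ∈ X₀ K Ω) (hu0 : ∀ x, 0 ≤ u x) :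
    ∫ x in Ω, u x ^ p = (eLpNorm u (ENNReal.ofReal p) (volume.restrict Ω)).toReal ^ p := by
  have h2 := hS.two_lt
  rw [integral_eq_lintegral_of_nonneg_ae (.of_forall fun x => Real.rpow_nonneg (hu0 x) _)
    (hS.integrable_rpow hu hu0).1, ENNReal.toReal_rpow,
    ← lintegral_ofReal_abs_rpow_eq _ _ (by linarith)]
  simp only [abs_of_nonneg (hu0 _)]

theorem integral_rpow_le (hu : u ∈ X₀ K Ω) (hu0 : ∀ x, 0 ≤ u x) :
    ∫ x in Ω, u x ^ p ≤ (S * norm₀ K Ω u) ^ p := by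
  rw [hS.integral_rpow_eq hu hu0]
  exact Real.rpow_le_rpow ENNReal.toReal_nonneg (hS.toReal_eLpNorm_le hu)
    (by linarith [hS.two_lt])

theorem integrable_comp (hΩf : volume Ω ≠ ∞) {F : ℝ → ℝ} {C D : ℝ} (hF : Continuous F)
    (hb : ∀ t, 0 ≤ t → |F t| ≤ C + D * t ^ p) (hu : u ∈ X₀ K Ω) (hu0 : ∀ x, 0 ≤ u x) :
    IntegrableOn (fun x => F (u x)) Ω volume := by
  have : IsFiniteMeasure (volume.restrict Ω) := isFiniteMeasure_restrict.2 hΩf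
  refine Integrable.mono' ((integrable_const C).add ((hS.integrable_rpow hu hu0).const_mul D))
    (hF.comp_aestronglyMeasurable hu.1.1.restrict) (.of_forall fun x => hb _ (hu0 x))

/-- The integral is a power of the $L^p(\Omega)$ norm, which is Lipschitz for the norm of `X₀`.
Strong convergence is what allows the critical exponent. -/
theorem tendsto_integral_rpow (hK : IsSingularKernel s K)
    {U : ℕ → EuclideanSpace ℝ (Fin n) → ℝ} (hU : ∀ k, U k ∈ X₀ K Ω) (hU0 : ∀ k x, 0 ≤ U k x)
    (hu : u ∈ X₀ K Ω) (hu0 : ∀ x, 0 ≤ u x)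
    (hlim : Tendsto (fun k => norm₀ K Ω (U k - u)) atTop (𝓝 0)) :
    Tendsto (fun k => ∫ x in Ω, U k x ^ p) atTop (𝓝 (∫ x in Ω, u x ^ p)) := by
  have h2 := hS.two_lt
  have hp1 : (1 : ℝ≥0∞) ≤ ENNReal.ofReal p := by
    rw [← ENNReal.ofReal_one]; exact ENNReal.ofReal_le_ofReal (by linarith)
  rw [hS.integral_rpow_eq hu hu0]
  simp_rw [fun k => hS.integral_rpow_eq (hU k) (hU0 k)]
  refine Tendsto.rpow_const ?_ (Or.inr (by linarith))
  have htri : ∀ a ∈ X₀ K Ω, ∀ b ∈ X₀ K Ω,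
      (eLpNorm a (ENNReal.ofReal p) (volume.restrict Ω)).toReal
        ≤ (eLpNorm b (ENNReal.ofReal p) (volume.restrict Ω)).toReal
          + S * norm₀ K Ω (a - b) := by
    intro a ha b hb
    have hab := X₀_sub ha hb
    have h1 := eLpNorm_add_le (hS.memLp hb).1 (hS.memLp hab).1 hp1
    rw [add_sub_cancel] at h1
    have h3 := ENNReal.toReal_mono (ENNReal.add_ne_top.2 ⟨(hS.memLp hb).2.ne,
      (hS.memLp hab).2.ne⟩) h1
    rw [ENNReal.toReal_add (hS.memLp hb).2.ne (hS.memLp hab).2.ne] at h3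
    linarith [hS.toReal_eLpNorm_le hab]
  rw [tendsto_iff_norm_sub_tendsto_zero]
  have hlim' := hlim.const_mul S
  rw [mul_zero] at hlim'
  refine squeeze_zero (fun _ => norm_nonneg _) (fun k => ?_) hlim'
  have h1 := htri _ (hU k) _ hu
  have h3 := htri _ hu _ (hU k)
  have h4 : norm₀ K Ω (u - U k) = norm₀ K Ω (U k - u) := by
    rw [← neg_sub, ← neg_one_smul ℝ (U k - u), hK.norm₀_smul]; simp
  rw [h4] at h3
  rw [Real.norm_eq_abs, abs_le]
  constructor <;> linarith

/-- Hölder with exponents $p/2$ and $p/(p-2)$: both factors become $p$-th powers, so no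
integrability beyond the critical one is used. -/
theorem integral_sq_mul_rpow_le (ha : a ∈ X₀ K Ω) (hb : b ∈ X₀ K Ω) (hb0 : ∀ x, 0 ≤ b x) :
    IntegrableOn (fun x => a x ^ 2 * b x ^ (p - 2)) Ω volume ∧
    ∫ x in Ω, a x ^ 2 * b x ^ (p - 2)
      ≤ (S * norm₀ K Ω a) ^ 2 * (S * norm₀ K Ω b) ^ (p - 2) := by
  have h2 := hS.two_lt
  have hA : 0 ≤ S * norm₀ K Ω a := mul_nonneg hS.pos.le norm₀_nonneg
  have hB : 0 ≤ S * norm₀ K Ω b := mul_nonneg hS.pos.le norm₀_nonneg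
  have hconj : (p / 2).HolderConjugate (p / (p - 2)) := by
    rw [Real.holderConjugate_iff]
    refine ⟨by rw [lt_div_iff₀ two_pos]; linarith, ?_⟩
    field_simp
    ring
  have hm1 : AEMeasurable (fun x => ENNReal.ofReal (a x ^ 2)) (volume.restrict Ω) :=
    (ha.1.1.restrict.aemeasurable.pow_const 2).ennreal_ofReal
  have hm2 : AEMeasurable (fun x => ENNReal.ofReal (b x ^ (p - 2))) (volume.restrict Ω) :=
    (hb.1.1.restrict.aemeasurable.pow_const (p - 2)).ennreal_ofReal
  have hpow : ∀ f ∈ X₀ K Ω, ∫⁻ x in Ω, ENNReal.ofReal (|f x| ^ p)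
      ≤ ENNReal.ofReal ((S * norm₀ K Ω f) ^ p) := by
    intro f hf
    rw [lintegral_ofReal_abs_rpow_eq _ _ (by linarith), ← ENNReal.ofReal_rpow_of_nonneg
      (mul_nonneg hS.pos.le norm₀_nonneg) (by linarith)]
    gcongr
    exact (eLpNorm_mono_measure _ Measure.restrict_le_self).trans (hS.bound f hf)
  have h := ENNReal.lintegral_mul_le_Lp_mul_Lq (volume.restrict Ω) hconj hm1 hm2
  have e1 : ∀ x, ENNReal.ofReal (a x ^ 2) ^ (p / 2) = ENNReal.ofReal (|a x| ^ p) := by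
    intro x
    rw [ENNReal.ofReal_rpow_of_nonneg (by positivity) (by linarith), ← sq_abs,
      ← Real.rpow_natCast, ← Real.rpow_mul (abs_nonneg _)]
    congr 2
    push_cast; ring
  have e2 : ∀ x, ENNReal.ofReal (b x ^ (p - 2)) ^ (p / (p - 2)) = ENNReal.ofReal (|b x| ^ p) := by
    intro x
    have : p - 2 ≠ 0 := by linarith
    rw [ENNReal.ofReal_rpow_of_nonneg (Real.rpow_nonneg (hb0 x) _)
      (div_nonneg (by linarith) (by linarith)), ← Real.rpow_mul (hb0 x), abs_of_nonneg (hb0 x)]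
    congr 2
    field_simp
  simp only [e1, e2] at h
  have hle : ∫⁻ x in Ω, ENNReal.ofReal (a x ^ 2 * b x ^ (p - 2))
      ≤ ENNReal.ofReal ((S * norm₀ K Ω a) ^ 2 * (S * norm₀ K Ω b) ^ (p - 2)) := by
    calc ∫⁻ x in Ω, ENNReal.ofReal (a x ^ 2 * b x ^ (p - 2))
        = ∫⁻ x in Ω, ((fun x => ENNReal.ofReal (a x ^ 2))
            * fun x => ENNReal.ofReal (b x ^ (p - 2))) x := by
          refine lintegral_congr fun x => ?_
          rw [ENNReal.ofReal_mul (by positivity), Pi.mul_apply]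
      _ ≤ _ := h
      _ ≤ (ENNReal.ofReal ((S * norm₀ K Ω a) ^ p)) ^ (1 / (p / 2))
            * (ENNReal.ofReal ((S * norm₀ K Ω b) ^ p)) ^ (1 / (p / (p - 2))) := by
          have : 0 ≤ 1 / (p / (p - 2)) :=
            one_div_nonneg.2 (div_nonneg (by linarith) (by linarith))
          gcongr
          · exact hpow a ha
          · exact hpow b hb
      _ = _ := by
          have h3 : p - 2 ≠ 0 := by linarith
          have h4 : p ≠ 0 := by linarith
          rw [ENNReal.ofReal_rpow_of_nonneg (by positivity) (by positivity),
            ENNReal.ofReal_rpow_of_nonneg (by positivity)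
            (one_div_nonneg.2 (div_nonneg (by linarith) (by linarith))),
            ← ENNReal.ofReal_mul (by positivity), ← Real.rpow_mul hA, ← Real.rpow_mul hB,
            ← Real.rpow_natCast (S * norm₀ K Ω a) 2]
          congr 3
          · push_cast; field_simp
          · field_simp
  have hmeas : AEStronglyMeasurable (fun x => a x ^ 2 * b x ^ (p - 2)) (volume.restrict Ω) :=
    ((ha.1.1.restrict.aemeasurable.pow_const 2).mul
      (hb.1.1.restrict.aemeasurable.pow_const (p - 2))).aestronglyMeasurable
  have hnn : ∀ x, 0 ≤ a x ^ 2 * b x ^ (p - 2) := fun x =>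
    mul_nonneg (sq_nonneg _) (Real.rpow_nonneg (hb0 x) _)
  have hint : IntegrableOn (fun x => a x ^ 2 * b x ^ (p - 2)) Ω volume := by
    refine ⟨hmeas, ?_⟩
    rw [hasFiniteIntegral_iff_ofReal (.of_forall hnn)]
    exact hle.trans_lt ENNReal.ofReal_lt_top
  refine ⟨hint, ?_⟩
  rw [← ENNReal.ofReal_le_ofReal_iff (by positivity),
    ofReal_integral_eq_lintegral_ofReal hint (.of_forall hnn)]
  exact hle

/-- The critical term has at most a quadratic convexity defect, which is small on small balls. -/
theorem integral_midpoint_defect_le (hK : IsSingularKernel s K)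
    (ha : a ∈ X₀ K Ω) (hb : b ∈ X₀ K Ω) (ha0 : ∀ x, 0 ≤ a x) (hb0 : ∀ x, 0 ≤ b x)
    (haρ : norm₀ K Ω a ≤ ρ) (hbρ : norm₀ K Ω b ≤ ρ) :
    ((∫ x in Ω, a x ^ p) + ∫ x in Ω, b x ^ p) / 2 - ∫ x in Ω, ((2⁻¹ : ℝ) • (a + b)) x ^ p
      ≤ p * (p - 1) / 4 * (S ^ 2 * (2 * S * ρ) ^ (p - 2)) * norm₀ K Ω (a - b) ^ 2 := by
  have h2 := hS.two_lt
  have hab := X₀_add ha hb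
  have hm := X₀_smul (2⁻¹ : ℝ) hab
  have hm0 : ∀ x, 0 ≤ ((2⁻¹ : ℝ) • (a + b)) x := fun x => by
    have := ha0 x
    have := hb0 x
    simp only [Pi.smul_apply, Pi.add_apply, smul_eq_mul]
    positivity
  obtain ⟨hi, hle⟩ := hS.integral_sq_mul_rpow_le (X₀_sub ha hb) hab
    (fun x => add_nonneg (ha0 x) (hb0 x))
  have hSp := hS.pos
  have hnab : norm₀ K Ω (a + b) ≤ 2 * ρ := by
    linarith [hK.norm₀_add_le ha hb]
  have hia := hS.integrable_rpow ha ha0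
  have hib := hS.integrable_rpow hb hb0
  have him := hS.integrable_rpow hm hm0
  calc ((∫ x in Ω, a x ^ p) + ∫ x in Ω, b x ^ p) / 2 - ∫ x in Ω, ((2⁻¹ : ℝ) • (a + b)) x ^ p
      = ∫ x in Ω, ((a x ^ p + b x ^ p) / 2 - ((2⁻¹ : ℝ) • (a + b)) x ^ p) := by
        rw [integral_sub (f := fun x => (a x ^ p + b x ^ p) / 2) ((hia.add hib).div_const 2) him,
          integral_div, integral_add hia hib]
    _ ≤ ∫ x in Ω, p * (p - 1) / 4 * ((a - b) x ^ 2 * (a + b) x ^ (p - 2)) := by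
        refine integral_mono (((hia.add hib).div_const 2).sub him) (hi.const_mul _) fun x => ?_
        have h := rpow_midpoint_defect_le h2 (ha0 x) (hb0 x)
        simp only [Pi.smul_apply, Pi.add_apply, Pi.sub_apply, smul_eq_mul]
        rwa [inv_mul_eq_div]
    _ = p * (p - 1) / 4 * ∫ x in Ω, (a - b) x ^ 2 * (a + b) x ^ (p - 2) :=
        integral_const_mul _ _
    _ ≤ p * (p - 1) / 4 * ((S * norm₀ K Ω (a - b)) ^ 2 * (2 * S * ρ) ^ (p - 2)) := by
        have h3 : 0 ≤ p * (p - 1) / 4 := by nlinarith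
        refine mul_le_mul_of_nonneg_left (hle.trans ?_) h3
        refine mul_le_mul_of_nonneg_left ?_ (sq_nonneg _)
        refine Real.rpow_le_rpow (mul_nonneg hSp.le norm₀_nonneg) ?_ (by linarith)
        nlinarith
    _ = _ := by ring

/-- The subcritical part of the energy is uniformly continuous in `L²` on bounded sets. -/
theorem exists_lowerPrimitive_sub_le (hg : IsSubcritical p a₁ a₂ q g) (hΩf : volume Ω ≠ ∞)
    (hr : 0 < r) (hr1 : r < 1) (hρ : 0 ≤ ρ) {ε : ℝ} (hε : 0 < ε) :
    ∃ C : ℝ, 0 ≤ C ∧ ∀ a ∈ X₀ K Ω, ∀ b ∈ X₀ K Ω, (∀ x, 0 ≤ a x) → (∀ x, 0 ≤ b x) →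
      norm₀ K Ω a ≤ ρ → norm₀ K Ω b ≤ ρ →
      |(∫ x in Ω, lowerPrimitive r g (a x)) - ∫ x in Ω, lowerPrimitive r g (b x)|
        ≤ ε + C * ∫ x in Ω, (a x - b x) ^ 2 := by
  have h2 := hS.two_lt
  have hSp := hS.pos
  have hfin : IsFiniteMeasure (volume.restrict Ω) := isFiniteMeasure_restrict.2 hΩf
  have hsub := fun ε (hε : 0 < ε) =>
    hg.lowerPrimitive_subcritical hr (by linarith : r < p) hε
  have hcont := hg.continuous_lowerPrimitive hr
  -- An upper bound for $|\Omega|+\int a^p+\int b^p$ on the ball, so that the modulus of continuity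
  -- taken with $\varepsilon/T$ integrates to at most $\varepsilon$.
  set T : ℝ := volume.real Ω + 2 * (S * ρ) ^ p + 1 with hT
  have hT0 : 0 < T := by positivity
  obtain ⟨C, hC, hCb⟩ := abs_sub_le_of_subcritical (by linarith) hcont.continuousOn hsub
    (show 0 < ε / T by positivity)
  obtain ⟨C₁, hC₁, hC₁b⟩ := hsub 1 one_pos
  refine ⟨C, hC, fun a ha b hb ha0 hb0 haρ hbρ => ?_⟩
  have hia := hS.integrable_rpow ha ha0
  have hib := hS.integrable_rpow hb hb0
  have hiA := hS.integrable_comp hΩf hcont hC₁b ha ha0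
  have hiB := hS.integrable_comp hΩf hcont hC₁b hb hb0
  have hisq : IntegrableOn (fun x => (a x - b x) ^ 2) Ω volume :=
    (memLp_two_iff_integrable_sq (X₀_sub ha hb).1.2.1.1).1 (X₀_sub ha hb).1.2.1
  have hpow : ∀ f ∈ X₀ K Ω, (∀ x, 0 ≤ f x) → norm₀ K Ω f ≤ ρ →
      ∫ x in Ω, f x ^ p ≤ (S * ρ) ^ p := fun f hf hf0 hfρ =>
    (hS.integral_rpow_le hf hf0).trans
      (Real.rpow_le_rpow (mul_nonneg hSp.le norm₀_nonneg) (by gcongr) (by linarith))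
  have hi1 : IntegrableOn (fun x => 1 + a x ^ p + b x ^ p) Ω volume :=
    ((integrable_const 1).add hia).add hib
  rw [← integral_sub hiA hiB, ← Real.norm_eq_abs]
  calc ‖∫ x in Ω, (lowerPrimitive r g (a x) - lowerPrimitive r g (b x))‖
      ≤ ∫ x in Ω, (ε / T * (1 + a x ^ p + b x ^ p) + C * (a x - b x) ^ 2) :=
        norm_integral_le_of_norm_le ((hi1.const_mul _).add (hisq.const_mul C))
          (.of_forall fun x => hCb _ _ (ha0 x) (hb0 x))
    _ = ε / T * ((volume.real Ω + ∫ x in Ω, a x ^ p) + ∫ x in Ω, b x ^ p)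
          + C * ∫ x in Ω, (a x - b x) ^ 2 := by
        rw [integral_add (hi1.const_mul _) (hisq.const_mul C), integral_const_mul,
          integral_const_mul, integral_add (f := fun x => 1 + a x ^ p)
          ((integrable_const 1).add hia) hib, integral_add (integrable_const 1) hia]
        simp
    _ ≤ ε / T * T + C * ∫ x in Ω, (a x - b x) ^ 2 := by
        gcongr
        linarith [hpow a ha ha0 haρ, hpow b hb hb0 hbρ]
    _ = _ := by rw [div_mul_cancel₀ _ hT0.ne']

theorem exists_lowerPrimitive_le (hg : IsSubcritical p a₁ a₂ q g) (hΩf : volume Ω ≠ ∞)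
    (hr : 0 < r) (hr1 : r < 1) (hρ : 0 ≤ ρ) :
    ∃ M : ℝ, 0 ≤ M ∧ ∀ a ∈ X₀ K Ω, (∀ x, 0 ≤ a x) → norm₀ K Ω a ≤ ρ →
      ∫ x in Ω, lowerPrimitive r g (a x) ≤ M := by
  have h2 := hS.two_lt
  have hSp := hS.pos
  have hfin : IsFiniteMeasure (volume.restrict Ω) := isFiniteMeasure_restrict.2 hΩf
  obtain ⟨C, hC, hCb⟩ := hg.lowerPrimitive_subcritical hr (by linarith : r < p) one_pos
  refine ⟨C * volume.real Ω + (S * ρ) ^ p, by positivity, fun a ha ha0 haρ => ?_⟩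
  have hia := hS.integrable_rpow ha ha0
  calc ∫ x in Ω, lowerPrimitive r g (a x) ≤ ∫ x in Ω, (C + a x ^ p) :=
        integral_mono (hS.integrable_comp hΩf (hg.continuous_lowerPrimitive hr) hCb ha ha0)
          ((integrable_const C).add hia) fun x =>
            (le_abs_self _).trans ((hCb _ (ha0 x)).trans_eq (by rw [one_mul]))
    _ = C * volume.real Ω + ∫ x in Ω, a x ^ p := by
        rw [integral_add (integrable_const C) hia]
        simp [mul_comm]
    _ ≤ _ := by
        gcongr
        exact (hS.integral_rpow_le ha ha0).trans
          (Real.rpow_le_rpow (mul_nonneg hSp.le norm₀_nonneg) (by gcongr) (by linarith))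

end HasSobolevBound

end

/-! ### Minimisation over nonnegative functions in a small ball -/

section

variable {n : ℕ} {s : ℝ} {Ω : Set (EuclideanSpace ℝ (Fin n))}
  {K u v w a b : EuclideanSpace ℝ (Fin n) → ℝ} {p S r q a₁ a₂ ρ lam μ : ℝ} {g : ℝ → ℝ}

/-- The energy of nonnegative functions. -/
def coneEnergy (K : EuclideanSpace ℝ (Fin n) → ℝ) (Ω : Set (EuclideanSpace ℝ (Fin n)))
    (p r : ℝ) (g : ℝ → ℝ) (lam μ : ℝ) (w : EuclideanSpace ℝ (Fin n) → ℝ) : ℝ :=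
  1 / 2 * norm₀ K Ω w ^ 2 - μ / p * (∫ x in Ω, w x ^ p)
    - lam * ∫ x in Ω, lowerPrimitive r g (w x)

/-- The nonnegative elements of the closed ball of radius `ρ` of `X₀`. -/
def coneBall (K : EuclideanSpace ℝ (Fin n) → ℝ) (Ω : Set (EuclideanSpace ℝ (Fin n))) (ρ : ℝ) :
    Set (EuclideanSpace ℝ (Fin n) → ℝ) :=
  {w | w ∈ X₀ K Ω ∧ (∀ x, 0 ≤ w x) ∧ norm₀ K Ω w ≤ ρ}

/-- The compactness estimate with $\eta=1$, its ball integrals being bounded by the norm. -/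
theorem IsSingularKernel.exists_integral_sq_le_norm₀ (hK : IsSingularKernel s K) (hs : 0 < s)
    (hns : 2 * s < n) (hΩb : Bornology.IsBounded Ω) (hΩ : MeasurableSet Ω) :
    ∃ C : ℝ, ∀ w ∈ X₀ K Ω, ∫ x in Ω, w x ^ 2 ≤ C * norm₀ K Ω w ^ 2 := by
  obtain ⟨t, ε, C, hC, h⟩ := hK.exists_integral_sq_le hs hΩb hΩ one_pos
  choose M hM using fun c : EuclideanSpace ℝ (Fin n) => hK.exists_abs_setIntegral_le hs hns hΩb hΩ
    (B := Metric.ball c ε) measure_ball_lt_top.ne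
  refine ⟨1 + C * ∑ c ∈ t, M c ^ 2, fun w hw => (h w hw).trans ?_⟩
  rw [add_mul, mul_assoc, Finset.sum_mul]
  gcongr with c hc
  rw [← mul_pow, ← sq_abs]
  exact pow_le_pow_left₀ (abs_nonneg _) (hM c w hw) 2

theorem IsSingularKernel.norm₀_sub_comm (hK : IsSingularKernel s K) :
    norm₀ K Ω (a - b) = norm₀ K Ω (b - a) := by
  rw [← neg_sub, ← neg_one_smul ℝ (b - a), hK.norm₀_smul]; simp

theorem IsSingularKernel.midpoint_mem_coneBall (hK : IsSingularKernel s K)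
    (ha : a ∈ coneBall K Ω ρ) (hb : b ∈ coneBall K Ω ρ) :
    (2⁻¹ : ℝ) • (a + b) ∈ coneBall K Ω ρ := by
  refine ⟨X₀_smul _ (X₀_add ha.1 hb.1), fun x => ?_, ?_⟩
  · have := ha.2.1 x
    have := hb.2.1 x
    simp only [Pi.smul_apply, Pi.add_apply, smul_eq_mul]
    positivity
  · rw [hK.norm₀_smul, abs_of_pos (by norm_num)]
    linarith [hK.norm₀_add_le ha.1 hb.1, ha.2.2, hb.2.2]

/-- Up to the subcritical part, the energy is uniformly convex on small balls. -/
theorem HasSobolevBound.norm₀_sub_sq_le (hS : HasSobolevBound K Ω p S)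
    (hK : IsSingularKernel s K) (hμ : 0 ≤ μ)
    (hsmall : μ * (p - 1) / 4 * (S ^ 2 * (2 * S * ρ) ^ (p - 2)) ≤ 1 / 16)
    (ha : a ∈ coneBall K Ω ρ) (hb : b ∈ coneBall K Ω ρ) :
    1 / 16 * norm₀ K Ω (a - b) ^ 2
      ≤ (coneEnergy K Ω p r g lam μ a + coneEnergy K Ω p r g lam μ b) / 2
        - coneEnergy K Ω p r g lam μ ((2⁻¹ : ℝ) • (a + b))
        + lam * (((∫ x in Ω, lowerPrimitive r g (a x)) + ∫ x in Ω, lowerPrimitive r g (b x)) / 2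
          - ∫ x in Ω, lowerPrimitive r g (((2⁻¹ : ℝ) • (a + b)) x)) := by
  have h2 := hS.two_lt
  have hdef := hS.integral_midpoint_defect_le hK ha.1 hb.1 ha.2.1 hb.2.1 ha.2.2 hb.2.2
  -- The parallelogram law contributes $\frac18\|a-b\|^2$ to the convexity of the energy; by
  -- `hsmall` the critical term consumes at most $\frac1{16}$, and $\frac1{16}$ remains.
  have hpar : norm₀ K Ω ((2⁻¹ : ℝ) • (a + b)) ^ 2
      = norm₀ K Ω a ^ 2 / 2 + norm₀ K Ω b ^ 2 / 2 - norm₀ K Ω (a - b) ^ 2 / 4 := by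
    rw [hK.norm₀_smul, mul_pow, hK.norm₀_add_sq ha.1 hb.1, hK.norm₀_sub_sq ha.1 hb.1, sq_abs]
    ring
  have hμp : 0 ≤ μ / p := div_nonneg hμ (by linarith)
  have h3 := mul_le_mul_of_nonneg_left hdef hμp
  have h4 : μ / p * (p * (p - 1) / 4 * (S ^ 2 * (2 * S * ρ) ^ (p - 2)) * norm₀ K Ω (a - b) ^ 2)
      = μ * (p - 1) / 4 * (S ^ 2 * (2 * S * ρ) ^ (p - 2)) * norm₀ K Ω (a - b) ^ 2 := by
    have : p ≠ 0 := by linarith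
    field_simp
  have h5 := mul_le_mul_of_nonneg_right hsmall (sq_nonneg (norm₀ K Ω (a - b)))
  rw [h4] at h3
  simp only [coneEnergy, hpar]
  linarith

/-- Existence of a minimiser of the energy among nonnegative functions of a small ball. -/
theorem HasSobolevBound.exists_minimizer (hS : HasSobolevBound K Ω p S)
    (hK : IsSingularKernel s K) (hs : 0 < s) (hns : 2 * s < n)
    (hΩb : Bornology.IsBounded Ω) (hΩ : MeasurableSet Ω) (hg : IsSubcritical p a₁ a₂ q g)
    (hr : 0 < r) (hr1 : r < 1) (hρ : 0 ≤ ρ) (hμ : 0 ≤ μ) (hlam : 0 ≤ lam)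
    (hsmall : μ * (p - 1) / 4 * (S ^ 2 * (2 * S * ρ) ^ (p - 2)) ≤ 1 / 16) :
    ∃ u ∈ coneBall K Ω ρ, ∀ w ∈ coneBall K Ω ρ,
      coneEnergy K Ω p r g lam μ u ≤ coneEnergy K Ω p r g lam μ w := by
  have h2 := hS.two_lt
  have hSp := hS.pos
  have hΩf : volume Ω ≠ ∞ := hΩb.measure_lt_top.ne
  set J := coneEnergy K Ω p r g lam μ with hJ
  set B : (EuclideanSpace ℝ (Fin n) → ℝ) → ℝ := fun w => ∫ x in Ω, lowerPrimitive r g (w x) with hB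
  obtain ⟨M, hM, hMb⟩ := hS.exists_lowerPrimitive_le hg hΩf hr hr1 hρ
  have hbdd : BddBelow (J '' coneBall K Ω ρ) := by
    refine ⟨-(μ / p * (S * ρ) ^ p) - lam * M, ?_⟩
    rintro _ ⟨w, hw, rfl⟩
    have e1 : μ / p * (∫ x in Ω, w x ^ p) ≤ μ / p * (S * ρ) ^ p := by
      refine mul_le_mul_of_nonneg_left ?_ (div_nonneg hμ (by linarith))
      refine (hS.integral_rpow_le hw.1 hw.2.1).trans ?_
      exact Real.rpow_le_rpow (mul_nonneg hSp.le norm₀_nonneg)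
        (mul_le_mul_of_nonneg_left hw.2.2 hSp.le) (by linarith)
    have e2 : lam * (∫ x in Ω, lowerPrimitive r g (w x)) ≤ lam * M :=
      mul_le_mul_of_nonneg_left (hMb w hw.1 hw.2.1 hw.2.2) hlam
    have e3 := sq_nonneg (norm₀ K Ω w)
    simp only [hJ, coneEnergy]
    linarith
  have hne : (J '' coneBall K Ω ρ).Nonempty := by
    refine ⟨_, 0, ⟨X₀_zero, fun _ => le_rfl, ?_⟩, rfl⟩
    have := hK.norm₀_smul (Ω := Ω) (u := 0) 0
    rw [zero_smul, abs_zero, zero_mul] at this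
    rwa [this]
  set m := sInf (J '' coneBall K Ω ρ) with hm
  have hmle : ∀ w ∈ coneBall K Ω ρ, m ≤ J w := fun w hw => csInf_le hbdd ⟨w, hw, rfl⟩
  obtain ⟨y, -, hy, hyJ⟩ := exists_seq_tendsto_sInf hne hbdd
  choose U hU hUy using hyJ
  obtain ⟨φ, hφ, hcau⟩ := hK.exists_subseq_cauchy hs hns hΩb hΩ (fun k => (hU k).1)
    (fun k => (hU k).2.2)
  set V := fun k => U (φ k) with hV
  have hVm : ∀ k, V k ∈ coneBall K Ω ρ := fun k => hU (φ k)
  have hVJ : Tendsto (fun k => J (V k)) atTop (𝓝 m) := by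
    have := hy.comp hφ.tendsto_atTop
    refine this.congr fun k => ?_
    simp [hV, hUy]
  -- The energies of `V k.1` and `V k.2` tend to the infimum while that of their midpoint is not
  -- below it. Uniform convexity therefore makes the sequence Cauchy, up to the subcritical part,
  -- which the $L^2$-Cauchy property controls.
  have hVcau : Tendsto (fun k : ℕ × ℕ => norm₀ K Ω (V k.1 - V k.2)) atTop (𝓝 0) := by
    have hsq : Tendsto (fun k : ℕ × ℕ => norm₀ K Ω (V k.1 - V k.2) ^ 2) atTop (𝓝 0) := by
      rw [tendsto_order]
      refine ⟨fun b hb => .of_forall fun k => hb.trans_le (sq_nonneg _), fun δ hδ => ?_⟩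
      -- After multiplication by $\lambda$ and by $16$, this error is at most $\delta/2$.
      obtain ⟨C, hC, hCb⟩ := hS.exists_lowerPrimitive_sub_le hg hΩf hr hr1 hρ
        (show 0 < δ / (32 * (lam + 1)) by positivity)
      have hlim : Tendsto (fun k : ℕ × ℕ => 16 * ((J (V k.1) - m) / 2 + (J (V k.2) - m) / 2
          + lam * (C * (4⁻¹ * ∫ x in Ω, (V k.1 x - V k.2 x) ^ 2)))) atTop
          (𝓝 (16 * ((m - m) / 2 + (m - m) / 2 + lam * (C * (4⁻¹ * 0))))) := by
        have t1 : Tendsto (fun k : ℕ × ℕ => J (V k.1)) atTop (𝓝 m) := by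
          rw [← prod_atTop_atTop_eq]; exact hVJ.comp tendsto_fst
        have t2 : Tendsto (fun k : ℕ × ℕ => J (V k.2)) atTop (𝓝 m) := by
          rw [← prod_atTop_atTop_eq]; exact hVJ.comp tendsto_snd
        exact ((((t1.sub_const m).div_const 2).add ((t2.sub_const m).div_const 2)).add
          (((hcau.const_mul 4⁻¹).const_mul C).const_mul lam)).const_mul 16
      simp only [sub_self, zero_div, mul_zero, add_zero] at hlim
      filter_upwards [hlim.eventually (gt_mem_nhds (half_pos hδ))] with k hk
      have hmid := hK.midpoint_mem_coneBall (hVm k.1) (hVm k.2)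
      have key := hS.norm₀_sub_sq_le hK hμ hsmall (hVm k.1) (hVm k.2) (r := r) (g := g)
        (lam := lam)
      have hmk := hmle _ hmid
      set I := ∫ x in Ω, (V k.1 x - V k.2 x) ^ 2 with hI
      have i1 : ∫ x in Ω, (V k.1 x - ((2⁻¹ : ℝ) • (V k.1 + V k.2)) x) ^ 2 = 4⁻¹ * I := by
        rw [hI, ← integral_const_mul]
        congr 1; ext x
        simp only [Pi.smul_apply, Pi.add_apply, smul_eq_mul]; ring
      have i2 : ∫ x in Ω, (V k.2 x - ((2⁻¹ : ℝ) • (V k.1 + V k.2)) x) ^ 2 = 4⁻¹ * I := by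
        rw [hI, ← integral_const_mul]
        congr 1; ext x
        simp only [Pi.smul_apply, Pi.add_apply, smul_eq_mul]; ring
      have b1 := hCb _ (hVm k.1).1 _ hmid.1 (hVm k.1).2.1 hmid.2.1 (hVm k.1).2.2 hmid.2.2
      have b2 := hCb _ (hVm k.2).1 _ hmid.1 (hVm k.2).2.1 hmid.2.1 (hVm k.2).2.2 hmid.2.2
      rw [i1] at b1
      rw [i2] at b2
      have b3 : lam * (((∫ x in Ω, lowerPrimitive r g (V k.1 x))
          + ∫ x in Ω, lowerPrimitive r g (V k.2 x)) / 2
          - ∫ x in Ω, lowerPrimitive r g (((2⁻¹ : ℝ) • (V k.1 + V k.2)) x))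
          ≤ lam * (δ / (32 * (lam + 1)) + C * (4⁻¹ * I)) := by
        refine mul_le_mul_of_nonneg_left ?_ hlam
        linarith [(abs_le.1 b1).2, (abs_le.1 b2).2]
      have b4 : lam * (δ / (32 * (lam + 1))) ≤ δ / 32 := by
        rw [mul_div_assoc', div_le_div_iff₀ (by positivity) (by norm_num)]
        nlinarith
      simp only [← hJ] at key
      linarith
    have := hsq.sqrt
    simpa [Real.sqrt_sq norm₀_nonneg] using this
  obtain ⟨u, hu, hu0, hlim⟩ := hK.exists_limit hs hns hΩb hΩ (fun k => (hVm k).1)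
    (fun k => (hVm k).2.1) hVcau
  have hnorm : Tendsto (fun k => norm₀ K Ω (V k)) atTop (𝓝 (norm₀ K Ω u)) := by
    rw [tendsto_iff_norm_sub_tendsto_zero]
    refine squeeze_zero (fun _ => norm_nonneg _) (fun k => ?_) hlim
    have e1 := hK.norm₀_add_le hu (X₀_sub (hVm k).1 hu)
    have e2 := hK.norm₀_add_le (hVm k).1 (X₀_sub hu (hVm k).1)
    rw [add_sub_cancel] at e1 e2
    rw [hK.norm₀_sub_comm] at e2
    rw [Real.norm_eq_abs, abs_le]
    constructor <;> linarith
  have huρ : norm₀ K Ω u ≤ ρ := le_of_tendsto' hnorm fun k => (hVm k).2.2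
  have hpow := hS.tendsto_integral_rpow hK (fun k => (hVm k).1) (fun k => (hVm k).2.1) hu hu0 hlim
  have hBlim : Tendsto (fun k => B (V k)) atTop (𝓝 (B u)) := by
    obtain ⟨D, hD⟩ := hK.exists_integral_sq_le_norm₀ hs hns hΩb hΩ
    have hL2 : Tendsto (fun k => ∫ x in Ω, (V k x - u x) ^ 2) atTop (𝓝 0) := by
      have := (hlim.pow 2).const_mul D
      simp only [ne_eq, OfNat.ofNat_ne_zero, not_false_eq_true, zero_pow, mul_zero] at this
      exact squeeze_zero (fun _ => integral_nonneg fun _ => sq_nonneg _)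
        (fun k => hD _ (X₀_sub (hVm k).1 hu)) this
    rw [Metric.tendsto_atTop']
    intro ε hε
    obtain ⟨C, hC, hCb⟩ := hS.exists_lowerPrimitive_sub_le hg hΩf hr hr1 hρ (half_pos hε)
    have h3 := hL2.const_mul C
    rw [mul_zero] at h3
    obtain ⟨N, hN⟩ := eventually_atTop.1 (h3.eventually (gt_mem_nhds (half_pos hε)))
    refine ⟨N, fun k hk => ?_⟩
    rw [Real.dist_eq]
    refine (hCb _ (hVm k).1 _ hu (hVm k).2.1 hu0 (hVm k).2.2 huρ).trans_lt ?_
    linarith [hN k hk.le]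
  have hJlim : Tendsto (fun k => J (V k)) atTop (𝓝 (J u)) :=
    (((hnorm.pow 2).const_mul _).sub (hpow.const_mul _)).sub (hBlim.const_mul _)
  refine ⟨u, ⟨hu, hu0, huρ⟩, fun w hw => ?_⟩
  rw [tendsto_nhds_unique hJlim hVJ]
  exact hmle w hw

end

/-! ### The Euler–Lagrange equation of an interior minimiser -/

section

variable {n : ℕ} {s : ℝ} {Ω : Set (EuclideanSpace ℝ (Fin n))}
  {K u v w : EuclideanSpace ℝ (Fin n) → ℝ} {p S r q a₁ a₂ ρ lam μ : ℝ} {g : ℝ → ℝ}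

/-- The right-hand side of the equation. -/
def reaction (p r : ℝ) (g : ℝ → ℝ) (lam μ t : ℝ) : ℝ :=
  μ * t ^ (p - 1) + lam * (t ^ (r - 1) + g t)

/-- The primitive of the right-hand side of the equation. -/
def potential (p r : ℝ) (g : ℝ → ℝ) (lam μ t : ℝ) : ℝ :=
  μ / p * t ^ p + lam * lowerPrimitive r g t

/-- A minimiser of the energy in `coneBall K Ω ρ` which is not on the sphere of radius `ρ`. -/
structure IsInteriorMinimizer (K : EuclideanSpace ℝ (Fin n) → ℝ)
    (Ω : Set (EuclideanSpace ℝ (Fin n))) (p r : ℝ) (g : ℝ → ℝ) (lam μ ρ : ℝ)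
    (u : EuclideanSpace ℝ (Fin n) → ℝ) : Prop where
  mem : u ∈ X₀ K Ω
  nonneg : ∀ x, 0 ≤ u x
  norm_lt : norm₀ K Ω u < ρ
  le : ∀ w ∈ coneBall K Ω ρ, coneEnergy K Ω p r g lam μ u ≤ coneEnergy K Ω p r g lam μ w

namespace IsSubcritical

variable (hg : IsSubcritical p a₁ a₂ q g)
include hg

theorem p_pos : 0 < p := by linarith [hg.one_le, hg.lt]

theorem reaction_nonneg (hlam : 0 ≤ lam) (hμ : 0 ≤ μ) {t : ℝ} (ht : 0 ≤ t) :
    0 ≤ reaction p r g lam μ t := by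
  have := hg.nonneg t
  unfold reaction
  positivity

theorem continuous_potential (hr : 0 < r) : Continuous (potential p r g lam μ) :=
  ((Real.continuous_rpow_const hg.p_pos.le).const_mul _).add
    ((hg.continuous_lowerPrimitive hr).const_mul _)

theorem measurable_reaction : Measurable (reaction p r g lam μ) := by
  have := hg.continuous.measurable
  unfold reaction
  fun_prop

theorem lowerPrimitive_terms_mono (hr : 0 < r) {x y : ℝ} (hx : 0 ≤ x) (hxy : x ≤ y) :
    x ^ r / r ≤ y ^ r / r ∧ ∫ τ in (0 : ℝ)..x, g τ ≤ ∫ τ in (0 : ℝ)..y, g τ := by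
  constructor
  · have := Real.rpow_le_rpow hx hxy hr.le
    gcongr
  · have h := intervalIntegral.integral_add_adjacent_intervals
      (hg.continuous.intervalIntegrable (μ := volume) 0 x)
      (hg.continuous.intervalIntegrable (μ := volume) x y)
    have h2 : 0 ≤ ∫ τ in x..y, g τ := intervalIntegral.integral_nonneg hxy fun τ _ => hg.nonneg τ
    linarith

theorem potential_mono (hr : 0 < r) (hlam : 0 ≤ lam) (hμ : 0 ≤ μ) {x y : ℝ} (hx : 0 ≤ x)
    (hxy : x ≤ y) : potential p r g lam μ x ≤ potential p r g lam μ y := by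
  have hp := hg.p_pos
  obtain ⟨h1, h2⟩ := hg.lowerPrimitive_terms_mono hr hx hxy
  have h3 : x ^ p ≤ y ^ p := Real.rpow_le_rpow hx hxy hp.le
  unfold potential lowerPrimitive
  gcongr

theorem potential_zero (hr : 0 < r) : potential p r g lam μ 0 = 0 := by
  simp [potential, lowerPrimitive, Real.zero_rpow hr.ne', Real.zero_rpow hg.p_pos.ne']

theorem le_potential (hμ : 0 ≤ μ) (hlam : 0 ≤ lam) {t : ℝ} (ht : 0 ≤ t) :
    lam / r * t ^ r ≤ potential p r g lam μ t := by
  have hp := hg.p_pos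
  have h1 := mul_nonneg hlam (hg.primitive_nonneg ht)
  have h2 : 0 ≤ μ / p * t ^ p := by positivity
  have e : lam * (t ^ r / r) = lam / r * t ^ r := by ring
  rw [potential, lowerPrimitive, mul_add, e]
  linarith

theorem hasDerivAt_potential (hr : 0 < r) {t : ℝ} (ht : 0 < t) :
    HasDerivAt (potential p r g lam μ) (reaction p r g lam μ t) t := by
  have h1 := ((Real.hasDerivAt_rpow_const (x := t) (p := p) (Or.inl ht.ne')).const_mul (μ / p))
  have h2 := (Real.hasDerivAt_rpow_const (x := t) (p := r) (Or.inl ht.ne')).div_const r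
  have h3 := intervalIntegral.integral_hasDerivAt_right
    (hg.continuous.intervalIntegrable (μ := volume) 0 t)
    hg.continuous.stronglyMeasurable.stronglyMeasurableAtFilter hg.continuous.continuousAt
  have h := h1.add ((h2.add h3).const_mul lam)
  have hp := hg.p_pos
  have e : reaction p r g lam μ t
      = μ / p * (p * t ^ (p - 1)) + lam * (r * t ^ (r - 1) / r + g t) := by
    unfold reaction
    field_simp
  rw [e]
  exact h

end IsSubcritical

theorem HasSobolevBound.integrable_potential (hS : HasSobolevBound K Ω p S) (hΩf : volume Ω ≠ ∞)
    (hg : IsSubcritical p a₁ a₂ q g) (hr : 0 < r) (hr1 : r < 1) (hw : w ∈ X₀ K Ω)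
    (hw0 : ∀ x, 0 ≤ w x) : IntegrableOn (fun x => potential p r g lam μ (w x)) Ω volume := by
  have h2 := hS.two_lt
  obtain ⟨C, hC, hCb⟩ := hg.lowerPrimitive_subcritical hr (by linarith : r < p) one_pos
  exact ((hS.integrable_rpow hw hw0).const_mul _).add
    ((hS.integrable_comp hΩf (hg.continuous_lowerPrimitive hr) hCb hw hw0).const_mul _)

theorem HasSobolevBound.coneEnergy_eq (hS : HasSobolevBound K Ω p S) (hΩf : volume Ω ≠ ∞)
    (hg : IsSubcritical p a₁ a₂ q g) (hr : 0 < r) (hr1 : r < 1) (hw : w ∈ X₀ K Ω)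
    (hw0 : ∀ x, 0 ≤ w x) :
    coneEnergy K Ω p r g lam μ w
      = 1 / 2 * norm₀ K Ω w ^ 2 - ∫ x in Ω, potential p r g lam μ (w x) := by
  have h2 := hS.two_lt
  obtain ⟨C, hC, hCb⟩ := hg.lowerPrimitive_subcritical hr (by linarith : r < p) one_pos
  simp only [potential, coneEnergy]
  rw [integral_add ((hS.integrable_rpow hw hw0).const_mul _)
    ((hS.integrable_comp hΩf (hg.continuous_lowerPrimitive hr) hCb hw hw0).const_mul _),
    integral_const_mul, integral_const_mul]
  ring

theorem HasSobolevBound.integrable_rpow_of_lt (hS : HasSobolevBound K Ω p S) (hΩf : volume Ω ≠ ∞)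
    {e : ℝ} (he : 0 ≤ e) (hep : e < p) (hw : w ∈ X₀ K Ω) (hw0 : ∀ x, 0 ≤ w x) :
    IntegrableOn (fun x => w x ^ e) Ω volume := by
  obtain ⟨C, hC, h⟩ := rpow_le_const_add_mul_rpow he hep one_pos
  refine hS.integrable_comp hΩf (C := C) (D := 1) (Real.continuous_rpow_const he) (fun t ht => ?_) hw hw0
  rw [abs_of_nonneg (by positivity)]
  exact h t ht

namespace IsInteriorMinimizer

variable (hu : IsInteriorMinimizer K Ω p r g lam μ ρ u) (hK : IsSingularKernel s K)
  (hS : HasSobolevBound K Ω p S) (hΩf : volume Ω ≠ ∞) (hg : IsSubcritical p a₁ a₂ q g)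
  (hr : 0 < r) (hr1 : r < 1) (hlam : 0 < lam) (hμ : 0 < μ)

include hu hK hS hΩf hg hr hr1

/-- Comparison with $u+tv$, which is admissible for small $t>0$ because $v\ge0$ and $\|u\|<\rho$.
The increment of the potential is left undivided, since the potential has infinite slope at the
zeros of `u`. -/
theorem eventually_integral_le (hv : v ∈ X₀ K Ω) (hv0 : ∀ x, 0 ≤ v x) :
    ∀ᶠ t : ℝ in 𝓝[>] 0, ∫ x in Ω, (potential p r g lam μ (u x + t * v x)
      - potential p r g lam μ (u x)) ≤ t * inner₀ K Ω u v + t ^ 2 / 2 * norm₀ K Ω v ^ 2 := by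
  have hlim : Tendsto (fun t : ℝ => norm₀ K Ω u + |t| * norm₀ K Ω v) (𝓝[>] 0)
      (𝓝 (norm₀ K Ω u + |0| * norm₀ K Ω v)) :=
    ((continuous_const.add (continuous_abs.mul continuous_const)).tendsto 0).mono_left
      nhdsWithin_le_nhds
  simp only [abs_zero, zero_mul, add_zero] at hlim
  filter_upwards [hlim.eventually (gt_mem_nhds hu.norm_lt), self_mem_nhdsWithin] with t ht ht0
  have ht0' : 0 < t := ht0
  have htv := X₀_smul t hv
  have hmem : u + t • v ∈ coneBall K Ω ρ := by
    refine ⟨X₀_add hu.mem htv, fun x => ?_, ?_⟩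
    · have := hu.nonneg x
      have := hv0 x
      simp only [Pi.add_apply, Pi.smul_apply, smul_eq_mul]
      positivity
    · have := hK.norm₀_add_le hu.mem htv
      rw [hK.norm₀_smul] at this
      linarith
  have h := hu.le _ hmem
  rw [hS.coneEnergy_eq hΩf hg hr hr1 hu.mem hu.nonneg,
    hS.coneEnergy_eq hΩf hg hr hr1 hmem.1 hmem.2.1, hK.norm₀_add_sq hu.mem htv,
    hK.inner₀_smul_right, hK.norm₀_smul, mul_pow, sq_abs] at h
  have hi := hS.integrable_potential (lam := lam) (μ := μ) hΩf hg hr hr1 hmem.1 hmem.2.1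
  have e := integral_sub hi (hS.integrable_potential (lam := lam) (μ := μ) hΩf hg hr hr1 hu.mem hu.nonneg)
  simp only [Pi.add_apply, Pi.smul_apply, smul_eq_mul] at e h
  rw [e]
  linarith

include hlam hμ

/-- The potential is nondecreasing on $[0,\infty)$, so the increments in `eventually_integral_le`
are nonnegative; divide by $t$ and let $t\to0$. -/
theorem inner₀_nonneg (hv : v ∈ X₀ K Ω) (hv0 : ∀ x, 0 ≤ v x) : 0 ≤ inner₀ K Ω u v := by
  have h := hu.eventually_integral_le hK hS hΩf hg hr hr1 hv hv0
  have h2 : ∀ᶠ t : ℝ in 𝓝[>] 0, 0 ≤ inner₀ K Ω u v + t / 2 * norm₀ K Ω v ^ 2 := by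
    filter_upwards [h, self_mem_nhdsWithin] with t ht ht0
    have ht0' : 0 < t := ht0
    have h3 : 0 ≤ ∫ x in Ω, (potential p r g lam μ (u x + t * v x)
        - potential p r g lam μ (u x)) := integral_nonneg fun x => sub_nonneg.2 <|
      hg.potential_mono hr hlam.le hμ.le (hu.nonneg x) (by
        have := hv0 x
        linarith [mul_nonneg ht0'.le this])
    have h4 : 0 ≤ t * (inner₀ K Ω u v + t / 2 * norm₀ K Ω v ^ 2) :=
      h3.trans (ht.trans_eq (by ring))
    exact nonneg_of_mul_nonneg_right h4 ht0'
  have hlim : Tendsto (fun t : ℝ => inner₀ K Ω u v + t / 2 * norm₀ K Ω v ^ 2) (𝓝[>] 0)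
      (𝓝 (inner₀ K Ω u v + 0 / 2 * norm₀ K Ω v ^ 2)) :=
    (Continuous.tendsto (by fun_prop) 0).mono_left nhdsWithin_le_nhds
  simp only [zero_div, zero_mul, add_zero] at hlim
  exact ge_of_tendsto hlim h2

/-- The singular term forces positivity of the minimiser. -/
theorem ae_pos (hΩo : IsOpen Ω) (hΩb : Bornology.IsBounded Ω) :
    ∀ᵐ x ∂(volume.restrict Ω), 0 < u x := by
  have hp := hS.two_lt
  have hΩ := hΩo.measurableSet
  have hv := hK.infDist_mem_X₀ hΩb hΩ
  set v : EuclideanSpace ℝ (Fin n) → ℝ := fun x => Metric.infDist x Ωᶜ with hvdef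
  have hv0 : ∀ x, 0 ≤ v x := fun x => Metric.infDist_nonneg
  set χ : ℝ → ℝ := ({0} : Set ℝ).indicator fun _ => 1 with hχ
  have hχm : Measurable χ := measurable_const.indicator (measurableSet_singleton 0)
  have hχ0 : ∀ t, 0 ≤ χ t := fun t => indicator_nonneg (fun _ _ => zero_le_one) t
  have hχ1 : ∀ t, χ t ≤ 1 := fun t => indicator_le_self' (fun _ _ => zero_le_one) t
  have hvr := hS.integrable_rpow_of_lt hΩf hr.le (by linarith) hv hv0
  have hi : IntegrableOn (fun x => χ (u x) * v x ^ r) Ω volume := by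
    refine Integrable.mono' hvr
      ((hχm.comp_aemeasurable hu.mem.1.1.restrict.aemeasurable).aestronglyMeasurable.mul hvr.1)
      (.of_forall fun x => ?_)
    have h1 : 0 ≤ v x ^ r := Real.rpow_nonneg (hv0 x) r
    rw [Real.norm_eq_abs, abs_of_nonneg (mul_nonneg (hχ0 _) h1)]
    exact mul_le_of_le_one_left h1 (hχ1 _)
  have hnn : ∀ x, 0 ≤ χ (u x) * v x ^ r := fun x =>
    mul_nonneg (hχ0 _) (Real.rpow_nonneg (hv0 x) r)
  -- `c` weighs the zero set of `u` by $v^r$. There the potential gains at least $\frac\lambda r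
  -- t^rv^r$, against a quadratic cost of order $t$; dividing by $t^r$ forces `c` to vanish, while
  -- $v>0$ in $\Omega$.
  set c := ∫ x in Ω, χ (u x) * v x ^ r with hc
  have hev : ∀ᶠ t : ℝ in 𝓝[>] 0, lam / r * c
      ≤ t ^ (1 - r) * (inner₀ K Ω u v + t / 2 * norm₀ K Ω v ^ 2) := by
    filter_upwards [hu.eventually_integral_le hK hS hΩf hg hr hr1 hv hv0, self_mem_nhdsWithin]
      with t ht ht0
    have ht0' : 0 < t := ht0
    have htv : ∀ x, 0 ≤ t * v x := fun x => mul_nonneg ht0'.le (hv0 x)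
    have hmem := X₀_add hu.mem (X₀_smul t hv)
    have hle : lam / r * t ^ r * c ≤ ∫ x in Ω, (potential p r g lam μ (u x + t * v x)
        - potential p r g lam μ (u x)) := by
      rw [hc, ← integral_const_mul]
      refine integral_mono (hi.const_mul _) ((hS.integrable_potential hΩf hg hr hr1 hmem
        fun x => add_nonneg (hu.nonneg x) (htv x)).sub
        (hS.integrable_potential hΩf hg hr hr1 hu.mem hu.nonneg)) fun x => ?_
      by_cases hx : u x = 0
      · have h1 := hg.le_potential (r := r) hμ.le hlam.le (htv x)
        rw [Real.mul_rpow ht0'.le (hv0 x)] at h1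
        simp only [hx, hχ, zero_add,
          hg.potential_zero hr, sub_zero, mem_singleton_iff, indicator_of_mem, one_mul]
        linarith
      · have h1 : χ (u x) = 0 := indicator_of_notMem (by simpa using hx) _
        simp only [h1, zero_mul, mul_zero]
        exact sub_nonneg.2 (hg.potential_mono hr hlam.le hμ.le (hu.nonneg x)
          (by simpa using htv x))
    have h1 := hle.trans ht
    have e : t ^ (1 - r) * t ^ r = t := by
      rw [← Real.rpow_add ht0', sub_add_cancel, Real.rpow_one]
    have h2 : t ^ r * (lam / r * c)
        ≤ t ^ r * (t ^ (1 - r) * (inner₀ K Ω u v + t / 2 * norm₀ K Ω v ^ 2)) := by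
      calc t ^ r * (lam / r * c) = lam / r * t ^ r * c := by ring
        _ ≤ t * inner₀ K Ω u v + t ^ 2 / 2 * norm₀ K Ω v ^ 2 := h1
        _ = (t ^ (1 - r) * t ^ r) * (inner₀ K Ω u v + t / 2 * norm₀ K Ω v ^ 2) := by
          rw [e]; ring
        _ = _ := by ring
    exact le_of_mul_le_mul_left h2 (by positivity)
  have hlim : Tendsto (fun t : ℝ => t ^ (1 - r) * (inner₀ K Ω u v + t / 2 * norm₀ K Ω v ^ 2))
      (𝓝[>] 0) (𝓝 ((0 : ℝ) ^ (1 - r) * (inner₀ K Ω u v + 0 / 2 * norm₀ K Ω v ^ 2))) :=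
    (((Real.continuous_rpow_const (by linarith)).mul (by fun_prop)).tendsto 0).mono_left
      nhdsWithin_le_nhds
  rw [Real.zero_rpow (by linarith), zero_mul] at hlim
  have hc0 : lam / r * c ≤ 0 := ge_of_tendsto hlim hev
  have hc1 : c = 0 := by
    refine le_antisymm ?_ (integral_nonneg hnn)
    exact nonpos_of_mul_nonpos_right hc0 (by positivity)
  have hae := (integral_eq_zero_iff_of_nonneg hnn hi).1 hc1
  filter_upwards [hae, ae_restrict_mem hΩ] with x hx hxΩ
  refine (hu.nonneg x).lt_of_ne fun h0 => ?_
  have h1 : 0 < v x ^ r :=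
    Real.rpow_pos_of_pos (infDist_compl_pos hΩo (hK.compl_nonempty hΩb) hxΩ) r
  simp only [hχ, ← h0, mem_singleton_iff, indicator_of_mem, one_mul, Pi.zero_apply] at hx
  exact h1.ne' hx

/-- The variational inequality satisfied by the minimiser. -/
theorem integral_reaction_le (hpos : ∀ᵐ x ∂(volume.restrict Ω), 0 < u x)
    (hv : v ∈ X₀ K Ω) (hv0 : ∀ x, 0 ≤ v x) :
    IntegrableOn (fun x => reaction p r g lam μ (u x) * v x) Ω volume ∧
      ∫ x in Ω, reaction p r g lam μ (u x) * v x ≤ inner₀ K Ω u v := by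
  set h : ℝ → EuclideanSpace ℝ (Fin n) → ℝ := fun t x =>
    t⁻¹ * (potential p r g lam μ (u x + t * v x) - potential p r g lam μ (u x)) with hh
  have hin := hu.inner₀_nonneg hK hS hΩf hg hr hr1 hlam hμ hv hv0
  have htpos : ∀ k : ℕ, (0 : ℝ) < 1 / ((k : ℝ) + 1) := fun k => by positivity
  have htlim : Tendsto (fun k : ℕ => 1 / ((k : ℝ) + 1)) atTop (𝓝[>] 0) :=
    tendsto_nhdsWithin_iff.2 ⟨tendsto_one_div_add_atTop_nhds_zero_nat, .of_forall htpos⟩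
  have hmono : ∀ t : ℝ, 0 < t → ∀ x, 0 ≤ h t x := fun t ht x => by
    have := hg.potential_mono (lam := lam) (μ := μ) hr hlam.le hμ.le (hu.nonneg x)
      (le_add_of_nonneg_right (mul_nonneg ht.le (hv0 x)))
    exact mul_nonneg (by positivity) (sub_nonneg.2 this)
  have hint : ∀ t : ℝ, 0 < t → IntegrableOn (h t) Ω volume := fun t ht =>
    Integrable.const_mul ((hS.integrable_potential hΩf hg hr hr1 (X₀_add hu.mem (X₀_smul t hv))
      fun x => add_nonneg (hu.nonneg x) (mul_nonneg ht.le (hv0 x))).sub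
      (hS.integrable_potential hΩf hg hr hr1 hu.mem hu.nonneg)) t⁻¹
  have hle : ∀ᶠ k : ℕ in atTop, ∫⁻ x in Ω, ENNReal.ofReal (h (1 / ((k : ℝ) + 1)) x)
      ≤ ENNReal.ofReal (inner₀ K Ω u v + 1 / ((k : ℝ) + 1) / 2 * norm₀ K Ω v ^ 2) := by
    filter_upwards [htlim.eventually (hu.eventually_integral_le hK hS hΩf hg hr hr1 hv hv0)]
      with k hk
    set t := 1 / ((k : ℝ) + 1)
    rw [← ofReal_integral_eq_lintegral_ofReal (hint t (htpos k))
      (.of_forall (hmono t (htpos k)))]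
    refine ENNReal.ofReal_le_ofReal ?_
    rw [integral_const_mul, ← div_eq_inv_mul, div_le_iff₀ (htpos k)]
    exact hk.trans_eq (by ring)
  have hptw : ∀ᵐ x ∂(volume.restrict Ω), Tendsto
      (fun k : ℕ => ENNReal.ofReal (h (1 / ((k : ℝ) + 1)) x)) atTop
      (𝓝 (ENNReal.ofReal (reaction p r g lam μ (u x) * v x))) := by
    filter_upwards [hpos] with x hx
    refine ENNReal.tendsto_ofReal ?_
    have h1 : HasDerivAt (fun t : ℝ => u x + t * v x) (v x) 0 := by
      simpa using ((hasDerivAt_id (0 : ℝ)).mul_const (v x)).const_add (u x)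
    have h2 : HasDerivAt (potential p r g lam μ) (reaction p r g lam μ (u x)) (u x + 0 * v x) := by
      simpa using hg.hasDerivAt_potential (lam := lam) (μ := μ) hr hx
    have h3 := (h2.comp (0 : ℝ) h1).tendsto_slope_zero_right.comp htlim
    refine h3.congr fun k => ?_
    simp [hh]
  -- The difference quotients are nonnegative but have no evident integrable majorant near the zeros
  -- of `u`, so only an inequality results. It carries the integrability of the singular term with
  -- it.
  have hfatou := lintegral_liminf_le' (u := atTop) (μ := volume.restrict Ω)
    (f := fun k : ℕ => fun x => ENNReal.ofReal (h (1 / ((k : ℝ) + 1)) x))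
    fun k => (hint _ (htpos k)).1.aemeasurable.ennreal_ofReal
  have hlim2 : Tendsto (fun k : ℕ => ENNReal.ofReal
      (inner₀ K Ω u v + 1 / ((k : ℝ) + 1) / 2 * norm₀ K Ω v ^ 2)) atTop
      (𝓝 (ENNReal.ofReal (inner₀ K Ω u v))) := by
    refine ENNReal.tendsto_ofReal ?_
    have := ((tendsto_one_div_add_atTop_nhds_zero_nat (𝕜 := ℝ)).div_const 2).mul_const
      (norm₀ K Ω v ^ 2) |>.const_add (inner₀ K Ω u v)
    simpa using this
  have hmain : ∫⁻ x in Ω, ENNReal.ofReal (reaction p r g lam μ (u x) * v x)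
      ≤ ENNReal.ofReal (inner₀ K Ω u v) := by
    calc ∫⁻ x in Ω, ENNReal.ofReal (reaction p r g lam μ (u x) * v x)
        = ∫⁻ x in Ω, liminf (fun k : ℕ => ENNReal.ofReal (h (1 / ((k : ℝ) + 1)) x)) atTop :=
          lintegral_congr_ae (hptw.mono fun x hx => hx.liminf_eq.symm)
      _ ≤ _ := hfatou
      _ ≤ liminf (fun k : ℕ => ENNReal.ofReal
            (inner₀ K Ω u v + 1 / ((k : ℝ) + 1) / 2 * norm₀ K Ω v ^ 2)) atTop :=
          liminf_le_liminf hle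
      _ = _ := hlim2.liminf_eq
  have hnn : ∀ x, 0 ≤ reaction p r g lam μ (u x) * v x := fun x =>
    mul_nonneg (hg.reaction_nonneg hlam.le hμ.le (hu.nonneg x)) (hv0 x)
  have hi : IntegrableOn (fun x => reaction p r g lam μ (u x) * v x) Ω volume := by
    refine ⟨(hg.measurable_reaction.comp_aemeasurable
      hu.mem.1.1.restrict.aemeasurable).aestronglyMeasurable.mul hv.1.1.restrict, ?_⟩
    rw [hasFiniteIntegral_iff_ofReal (.of_forall hnn)]
    exact hmain.trans_lt ENNReal.ofReal_lt_top
  refine ⟨hi, ?_⟩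
  rwa [← ENNReal.ofReal_le_ofReal_iff hin, ofReal_integral_eq_lintegral_ofReal hi
    (.of_forall hnn)]

/-- Testing with the minimiser itself. -/
theorem norm₀_sq_le (hpos : ∀ᵐ x ∂(volume.restrict Ω), 0 < u x) :
    norm₀ K Ω u ^ 2 ≤ ∫ x in Ω, reaction p r g lam μ (u x) * u x := by
  have hp := hS.two_lt
  have hq := hg.one_le
  have hqp := hg.lt
  have hfin : IsFiniteMeasure (volume.restrict Ω) := isFiniteMeasure_restrict.2 hΩf
  -- Since $t_k\le\frac12$, the competitor $(1-t_k)u$ stays above $u/2$. The mean value theorem then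
  -- bounds the singular part of the quotient by $(u/2)^{r-1}u$, so dominated convergence applies,
  -- with majorant `D`.
  set t : ℕ → ℝ := fun k => 1 / ((k : ℝ) + 1) / 2 with ht
  have htpos : ∀ k, 0 < t k := fun k => by positivity
  have hthalf : ∀ k, t k ≤ 1 / 2 := fun k => by
    have : 1 / ((k : ℝ) + 1) ≤ 1 := by
      rw [div_le_one (by positivity)]; linarith [(Nat.cast_nonneg k : (0 : ℝ) ≤ k)]
    simp only [ht]; linarith
  have htlim : Tendsto t atTop (𝓝 0) := by
    have := (tendsto_one_div_add_atTop_nhds_zero_nat (𝕜 := ℝ)).div_const 2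
    rwa [zero_div] at this
  set h : ℕ → EuclideanSpace ℝ (Fin n) → ℝ := fun k x =>
    (t k)⁻¹ * (potential p r g lam μ (u x) - potential p r g lam μ (u x - t k * u x)) with hh
  have hsub : ∀ k, u - t k • u = (1 - t k) • u := fun k => by rw [sub_smul, one_smul]
  have hnn : ∀ k x, 0 ≤ u x - t k * u x := fun k x => by
    nlinarith [hu.nonneg x, hthalf k]
  have hmem : ∀ k, u - t k • u ∈ coneBall K Ω ρ := fun k => by
    refine ⟨X₀_sub hu.mem (X₀_smul _ hu.mem), hnn k, ?_⟩
    rw [hsub, hK.norm₀_smul, abs_of_nonneg (by linarith [hthalf k])]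
    nlinarith [htpos k, hu.norm_lt, norm₀_nonneg (K := K) (Ω := Ω) (u := u)]
  have hint : ∀ k, IntegrableOn (h k) Ω volume := fun k =>
    Integrable.const_mul ((hS.integrable_potential hΩf hg hr hr1 hu.mem hu.nonneg).sub
      (hS.integrable_potential hΩf hg hr hr1 (hmem k).1 (hmem k).2.1)) (t k)⁻¹
  have hle : ∀ k, norm₀ K Ω u ^ 2 * (1 - t k / 2) ≤ ∫ x in Ω, h k x := by
    intro k
    have h1 := hu.le _ (hmem k)
    rw [hS.coneEnergy_eq hΩf hg hr hr1 hu.mem hu.nonneg,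
      hS.coneEnergy_eq hΩf hg hr hr1 (hmem k).1 (hmem k).2.1] at h1
    have hi := hS.integrable_potential (lam := lam) (μ := μ) hΩf hg hr hr1 (hmem k).1 (hmem k).2.1
    have e := integral_sub (hS.integrable_potential (lam := lam) (μ := μ) hΩf hg hr hr1 hu.mem hu.nonneg) hi
    have hn : norm₀ K Ω (u - t k • u) ^ 2 = (1 - t k) ^ 2 * norm₀ K Ω u ^ 2 := by
      rw [hsub, hK.norm₀_smul, mul_pow, sq_abs]
    rw [hn] at h1
    simp only [Pi.sub_apply, Pi.smul_apply, smul_eq_mul] at e h1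
    rw [integral_const_mul, ← div_eq_inv_mul, le_div_iff₀ (htpos k), e]
    linarith
  set D : EuclideanSpace ℝ (Fin n) → ℝ := fun x =>
    μ * u x ^ p + lam * (2⁻¹ ^ (r - 1) * u x ^ r + (a₁ * u x ^ (1 : ℝ) + a₂ * u x ^ q)) with hD
  have hDi : IntegrableOn D Ω volume := by
    have i1 := hS.integrable_rpow hu.mem hu.nonneg
    have i2 := hS.integrable_rpow_of_lt hΩf hr.le (by linarith) hu.mem hu.nonneg
    have i3 := hS.integrable_rpow_of_lt hΩf zero_le_one (by linarith) hu.mem hu.nonneg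
    have i4 := hS.integrable_rpow_of_lt hΩf (by linarith) hqp hu.mem hu.nonneg
    exact (i1.const_mul _).add (((i2.const_mul _).add
      ((i3.const_mul _).add (i4.const_mul _))).const_mul _)
  have hbound : ∀ k, ∀ᵐ x ∂(volume.restrict Ω), ‖h k x‖ ≤ D x := by
    intro k
    filter_upwards [hpos] with x hx
    have hlow : u x / 2 ≤ u x - t k * u x := by nlinarith [hthalf k]
    have hlt : u x - t k * u x < u x := by nlinarith [htpos k]
    obtain ⟨ξ, hξ, hξe⟩ := exists_hasDerivAt_eq_slope (potential p r g lam μ)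
      (reaction p r g lam μ) hlt (hg.continuous_potential hr).continuousOn
      fun y hy => hg.hasDerivAt_potential hr (by linarith [hy.1])
    have hξ0 : 0 < ξ := by linarith [hξ.1]
    have e : h k x = reaction p r g lam μ ξ * u x := by
      rw [hξe]
      have := htpos k
      simp only [hh, sub_sub_cancel]
      field_simp
    have hr0 := hg.reaction_nonneg (r := r) hlam.le hμ.le hξ0.le
    rw [e, Real.norm_eq_abs, abs_of_nonneg (mul_nonneg hr0 hx.le)]
    have f1 : ξ ^ (p - 1) ≤ u x ^ (p - 1) := Real.rpow_le_rpow hξ0.le hξ.2.le (by linarith)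
    have f2 : ξ ^ (r - 1) ≤ (2⁻¹ * u x) ^ (r - 1) :=
      Real.rpow_le_rpow_of_nonpos (by positivity) (by linarith [hξ.1]) (by linarith)
    have f3 : ξ ^ (q - 1) ≤ u x ^ (q - 1) := Real.rpow_le_rpow hξ0.le hξ.2.le (by linarith)
    have f4 : g ξ ≤ a₁ + a₂ * u x ^ (q - 1) :=
      (hg.growth ξ hξ0.le).trans (by have := hg.a₂_nonneg; gcongr)
    have f5 : ∀ e : ℝ, u x ^ e = u x ^ (e - 1) * u x := fun e => by
      rw [← Real.rpow_add_one hx.ne', sub_add_cancel]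
    calc reaction p r g lam μ ξ * u x
        ≤ (μ * u x ^ (p - 1) + lam * ((2⁻¹ * u x) ^ (r - 1) + (a₁ + a₂ * u x ^ (q - 1)))) * u x := by
          unfold reaction
          gcongr
      _ = D x := by
          simp only [hD]
          rw [f5 p, f5 r, f5 q, Real.rpow_one, Real.mul_rpow (by norm_num) hx.le]
          ring
  have hptw : ∀ᵐ x ∂(volume.restrict Ω), Tendsto (fun k => h k x) atTop
      (𝓝 (reaction p r g lam μ (u x) * u x)) := by
    filter_upwards [hpos] with x hx
    have h1 : HasDerivAt (fun τ : ℝ => u x - τ * u x) (-u x) 0 := by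
      simpa using ((hasDerivAt_id (0 : ℝ)).mul_const (u x)).const_sub (u x)
    have h2 : HasDerivAt (potential p r g lam μ) (reaction p r g lam μ (u x)) (u x - 0 * u x) := by
      simpa using hg.hasDerivAt_potential (lam := lam) (μ := μ) hr hx
    have h3 := (h2.comp (0 : ℝ) h1).neg.tendsto_slope_zero_right.comp
      (tendsto_nhdsWithin_iff.2 ⟨htlim, .of_forall htpos⟩)
    rw [mul_neg, neg_neg] at h3
    refine h3.congr fun k => ?_
    simp only [hh, Function.comp_apply, Pi.neg_apply, smul_eq_mul, zero_add, zero_mul, sub_zero]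
    ring
  have hdct := tendsto_integral_of_dominated_convergence D (fun k => (hint k).1) hDi hbound hptw
  have hlhs : Tendsto (fun k => norm₀ K Ω u ^ 2 * (1 - t k / 2)) atTop
      (𝓝 (norm₀ K Ω u ^ 2 * (1 - 0 / 2))) :=
    ((htlim.div_const 2).const_sub 1).const_mul _
  simp only [zero_div, sub_zero, mul_one] at hlhs
  exact le_of_tendsto_of_tendsto' hlhs hdct hle

theorem integrable_reaction_mul (hpos : ∀ᵐ x ∂(volume.restrict Ω), 0 < u x) (hv : v ∈ X₀ K Ω) :
    IntegrableOn (fun x => reaction p r g lam μ (u x) * v x) Ω volume := by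
  have habs : (fun x => |v x|) ∈ X₀ K Ω := hK.mem_X₀_of_abs_le hv hv.1.1.norm
    (fun x => (abs_abs _).le) (fun x y => abs_abs_sub_abs_le_abs_sub _ _)
  refine Integrable.mono (hu.integral_reaction_le hK hS hΩf hg hr hr1 hlam hμ hpos habs
    fun x => abs_nonneg _).1 ((hg.measurable_reaction.comp_aemeasurable
      hu.mem.1.1.restrict.aemeasurable).aestronglyMeasurable.mul hv.1.1.restrict)
    (.of_forall fun x => ?_)
  rw [norm_mul, norm_mul, Real.norm_eq_abs (v x), Real.norm_eq_abs |v x|, abs_abs]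

/-- $u-tv$ need not be nonnegative, so the reverse inequality is obtained by testing with
$(ku-v)^+=ku-(v-z)$, $z=(v-ku)^+$. Since $\|u\|^2\le\int f(u)u$, where $f(u)$ is the reaction at
`u`, and $\int f(u)z\ge0$, this leaves $\langle u,v\rangle-\int f(u)v\le\langle u,z\rangle$, which
is $O(1/k)$. -/
theorem weak_eq_of_nonneg (hpos : ∀ᵐ x ∂(volume.restrict Ω), 0 < u x)
    (hv : v ∈ X₀ K Ω) (hv0 : ∀ x, 0 ≤ v x) :
    inner₀ K Ω u v = ∫ x in Ω, reaction p r g lam μ (u x) * v x := by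
  have hle := fun w (hw : w ∈ X₀ K Ω) (hw0 : ∀ x, 0 ≤ w x) =>
    (hu.integral_reaction_le hK hS hΩf hg hr hr1 hlam hμ hpos hw hw0).2
  have hint := fun w (hw : w ∈ X₀ K Ω) =>
    hu.integrable_reaction_mul hK hS hΩf hg hr hr1 hlam hμ hpos hw
  have hself := hu.norm₀_sq_le hK hS hΩf hg hr hr1 hlam hμ hpos
  refine le_antisymm ?_ (hle v hv hv0)
  have key : ∀ k : ℝ, 0 < k → inner₀ K Ω u v - ∫ x in Ω, reaction p r g lam μ (u x) * v x
      ≤ norm₀ K Ω v ^ 2 / 4 / k := by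
    intro k hk
    have hku := X₀_smul k hu.mem
    have hd := X₀_sub hv hku
    set z : EuclideanSpace ℝ (Fin n) → ℝ := fun x => max ((v - k • u) x) 0 with hz
    have hzX : z ∈ X₀ K Ω := hK.mem_X₀_posPart hd
    have hz0 : ∀ x, 0 ≤ z x := fun x => le_max_right _ _
    have hyX := X₀_sub hku (X₀_sub hv hzX)
    have hy0 : ∀ x, 0 ≤ (k • u - (v - z)) x := fun x => by
      have : (v - k • u) x ≤ z x := le_max_left _ _
      simp only [Pi.sub_apply, Pi.smul_apply, smul_eq_mul] at this ⊢
      linarith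
    have h1 := hle _ hyX hy0
    have h2 : ∫ x in Ω, reaction p r g lam μ (u x) * (k • u - (v - z)) x
        = k * (∫ x in Ω, reaction p r g lam μ (u x) * u x)
          - ((∫ x in Ω, reaction p r g lam μ (u x) * v x)
            - ∫ x in Ω, reaction p r g lam μ (u x) * z x) := by
      rw [← integral_const_mul, ← integral_sub (hint v hv) (hint z hzX),
        ← integral_sub (g := fun x => reaction p r g lam μ (u x) * v x
          - reaction p r g lam μ (u x) * z x) ((hint u hu.mem).const_mul k)
          ((hint v hv).sub (hint z hzX))]
      congr 1; ext x
      simp only [Pi.sub_apply, Pi.smul_apply, smul_eq_mul]; ring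
    have h3 : 0 ≤ ∫ x in Ω, reaction p r g lam μ (u x) * z x := integral_nonneg fun x =>
      mul_nonneg (hg.reaction_nonneg hlam.le hμ.le (hu.nonneg x)) (hz0 x)
    rw [h2, hK.inner₀_sub_right hku (X₀_sub hv hzX) hu.mem, hK.inner₀_smul_right,
      hK.inner₀_sub_right hv hzX hu.mem, ← hK.norm₀_sq] at h1
    have h4 : norm₀ K Ω z ^ 2 ≤ inner₀ K Ω (v - k • u) z := hK.norm₀_posPart_sq_le_inner₀ hd
    rw [hK.inner₀_sub_left hv hku hzX, hK.inner₀_smul_left] at h4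
    -- From $\|z\|^2\le\langle v-ku,z\rangle$ one has $k\langle u,z\rangle\le\langle
    -- v,z\rangle-\|z\|^2$; completing the square bounds this by $\|v\|^2/4$.
    have h5 := hK.norm₀_sub_sq (X₀_smul (2⁻¹ : ℝ) hv) hzX
    rw [hK.norm₀_smul, hK.inner₀_smul_left, mul_pow, sq_abs] at h5
    have h6 := sq_nonneg (norm₀ K Ω ((2⁻¹ : ℝ) • v - z))
    have h7 : k * inner₀ K Ω u z ≤ norm₀ K Ω v ^ 2 / 4 := by linarith
    have h8 : inner₀ K Ω u z ≤ norm₀ K Ω v ^ 2 / 4 / k := by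
      rw [le_div_iff₀ hk]; linarith
    have h9 := mul_le_mul_of_nonneg_left hself hk.le
    linarith
  have hlim : Tendsto (fun k : ℝ => norm₀ K Ω v ^ 2 / 4 / k) atTop (𝓝 0) :=
    tendsto_const_nhds.div_atTop tendsto_id
  have := ge_of_tendsto hlim ((eventually_gt_atTop 0).mono key)
  linarith

theorem weak_eq (hpos : ∀ᵐ x ∂(volume.restrict Ω), 0 < u x) (hv : v ∈ X₀ K Ω) :
    inner₀ K Ω u v = ∫ x in Ω, reaction p r g lam μ (u x) * v x := by
  have hP := hK.mem_X₀_posPart hv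
  have hN := hK.mem_X₀_posPart (X₀_smul (-1) hv)
  have hint := fun w (hw : w ∈ X₀ K Ω) =>
    hu.integrable_reaction_mul hK hS hΩf hg hr hr1 hlam hμ hpos hw
  have e1 := hu.weak_eq_of_nonneg hK hS hΩf hg hr hr1 hlam hμ hpos hP fun x => le_max_right _ _
  have e2 := hu.weak_eq_of_nonneg hK hS hΩf hg hr hr1 hlam hμ hpos hN fun x => le_max_right _ _
  have hdec : v = (fun x => max (v x) 0) - fun x => max (((-1 : ℝ) • v) x) 0 := by
    ext x
    simp only [Pi.sub_apply, Pi.smul_apply, smul_eq_mul]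
    rcases le_total (v x) 0 with h | h
    · rw [max_eq_right h, max_eq_left (by linarith)]; ring
    · rw [max_eq_left h, max_eq_right (by linarith)]; ring
  have e3 : ∫ x in Ω, reaction p r g lam μ (u x) * v x
      = (∫ x in Ω, reaction p r g lam μ (u x) * max (v x) 0)
        - ∫ x in Ω, reaction p r g lam μ (u x) * max (((-1 : ℝ) • v) x) 0 := by
    rw [← integral_sub (hint _ hP) (hint _ hN)]
    congr 1; ext x
    rw [← mul_sub]
    exact congrArg _ (congrFun hdec x)
  rw [e3, ← e1, ← e2, ← hK.inner₀_sub_right hP hN hu.mem, ← hdec]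

end IsInteriorMinimizer

end

/-! ### From interior minimisers to solutions; the function $k_\mu$ -/

section

variable {n : ℕ} {s : ℝ} {Ω : Set (EuclideanSpace ℝ (Fin n))}
  {K u v w : EuclideanSpace ℝ (Fin n) → ℝ} {p S r q a₁ a₂ ρ lam μ : ℝ} {g : ℝ → ℝ}

/-- `g` is controlled only on $[0,\infty)$; composing with `max t 0` extends it continuously to the
line without changing it where it matters. -/
theorem IsSubcritical.of_continuousOn (hgc : ContinuousOn g (Ici 0))
    (hg0 : ∀ t, 0 ≤ t → 0 ≤ g t) (ha₁ : 0 ≤ a₁) (ha₂ : 0 ≤ a₂) (hq1 : 1 ≤ q) (hq2 : q < p)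
    (hg : ∀ t, 0 ≤ t → g t ≤ a₁ + a₂ * t ^ (q - 1)) :
    IsSubcritical p a₁ a₂ q fun t => g (max t 0) where
  continuous := hgc.comp_continuous (by fun_prop) fun _ => mem_Ici.2 (le_max_right _ _)
  nonneg _ := hg0 _ (le_max_right _ _)
  a₁_nonneg := ha₁
  a₂_nonneg := ha₂
  one_le := hq1
  lt := hq2
  growth t ht := by simpa only [max_eq_left ht] using hg t ht

/-- Only the quadratic term sees the negative part of `w`. As $\|w^+\|\le\|w\|$, passing to $w^+$
does not increase the energy. -/
theorem HasSobolevBound.energy_eq (hS : HasSobolevBound K Ω (twoStar n s) S)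
    (hK : IsSingularKernel s K) (hΩf : volume Ω ≠ ∞)
    (hg : IsSubcritical (twoStar n s) a₁ a₂ q fun t => g (max t 0))
    (hr : 0 < r) (hr1 : r < 1) (hw : w ∈ X₀ K Ω) :
    energy s K Ω r g lam μ w = 1 / 2 * norm₀ K Ω w ^ 2
        - 1 / 2 * norm₀ K Ω (fun x => max (w x) 0) ^ 2
        + coneEnergy K Ω (twoStar n s) r (fun t => g (max t 0)) lam μ fun x => max (w x) 0 := by
  have h2 := hS.two_lt
  have hq := hg.one_le
  have ha₁ := hg.a₁_nonneg
  have ha₂ := hg.a₂_nonneg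
  have hfin : IsFiniteMeasure (volume.restrict Ω) := isFiniteMeasure_restrict.2 hΩf
  have hp := hK.mem_X₀_posPart hw
  have hp0 : ∀ x, 0 ≤ max (w x) 0 := fun x => le_max_right _ _
  have hG : ∀ t : ℝ, 0 ≤ t → ∫ τ in (0 : ℝ)..t, g τ = ∫ τ in (0 : ℝ)..t, g (max τ 0) := by
    intro t ht
    refine intervalIntegral.integral_congr fun τ hτ => ?_
    rw [uIcc_of_le ht] at hτ
    simp only [max_eq_left hτ.1]
  have i1 := hS.integrable_rpow_of_lt hΩf hr.le (by linarith) hp hp0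
  have i2 : IntegrableOn (fun x => ∫ τ in (0 : ℝ)..max (w x) 0, g (max τ 0)) Ω volume := by
    have j1 := hS.integrable_rpow_of_lt hΩf zero_le_one (by linarith) hp hp0
    have j2 := hS.integrable_rpow_of_lt hΩf (by linarith) hg.lt hp hp0
    refine Integrable.mono' ((j1.const_mul a₁).add (j2.const_mul a₂))
      (hg.continuous_primitive.comp_aestronglyMeasurable hp.1.1.restrict)
      (.of_forall fun x => ?_)
    rw [Real.norm_eq_abs, abs_of_nonneg (hg.primitive_nonneg (hp0 x))]
    simpa only [Pi.add_apply, Real.rpow_one] using hg.primitive_le (hp0 x)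
  simp only [energy, coneEnergy, lowerPrimitive]
  simp_rw [fun x => hG _ (hp0 x)]
  rw [integral_add (i1.div_const r) i2, integral_div]
  ring

theorem HasSobolevBound.coneEnergy_zero (hS : HasSobolevBound K Ω p S)
    (hK : IsSingularKernel s K) (hr : 0 < r) : coneEnergy K Ω p r g lam μ 0 = 0 := by
  have h0 := hK.norm₀_smul (Ω := Ω) (u := 0) 0
  rw [zero_smul, abs_zero, zero_mul] at h0
  have h2 := hS.two_lt
  have hp : p ≠ 0 := by linarith
  simp [coneEnergy, lowerPrimitive, h0, Real.zero_rpow hp, Real.zero_rpow hr.ne']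

/-- For a small parameter, the minimiser over a small ball is in the interior of the ball. -/
theorem HasSobolevBound.exists_interiorMinimizer (hS : HasSobolevBound K Ω p S)
    (hK : IsSingularKernel s K) (hs : 0 < s) (hns : 2 * s < n)
    (hΩb : Bornology.IsBounded Ω) (hΩ : MeasurableSet Ω) (hg : IsSubcritical p a₁ a₂ q g)
    (hr : 0 < r) (hr1 : r < 1) (hμ : 0 < μ) :
    ∃ ρ : ℝ, 0 < ρ ∧ ∃ lam₀ : ℝ, 0 < lam₀ ∧ ∀ lam : ℝ, 0 < lam → lam < lam₀ →
      ∃ u, IsInteriorMinimizer K Ω p r g lam μ ρ u := by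
  have h2 := hS.two_lt
  have hSp := hS.pos
  have hlim : Tendsto (fun ρ : ℝ => μ * (p - 1) / 4 * (S ^ 2 * (2 * S * ρ) ^ (p - 2))) (𝓝[>] 0)
      (𝓝 (μ * (p - 1) / 4 * (S ^ 2 * (2 * S * 0) ^ (p - 2)))) := by
    refine Tendsto.mono_left (Continuous.tendsto ?_ 0) nhdsWithin_le_nhds
    exact (((Real.continuous_rpow_const (by linarith)).comp (continuous_const.mul
      continuous_id)).const_mul _).const_mul _
  rw [mul_zero, Real.zero_rpow (by linarith), mul_zero, mul_zero] at hlim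
  obtain ⟨ρ, hsmall, hρ⟩ := ((hlim.eventually (gt_mem_nhds (show (0 : ℝ) < 1 / 16 by norm_num))).and
    self_mem_nhdsWithin).exists
  have hρ0 : 0 < ρ := hρ
  obtain ⟨M, hM, hMb⟩ := hS.exists_lowerPrimitive_le hg hΩb.measure_lt_top.ne hr hr1 hρ0.le
  -- On the sphere the subcritical part is then below $\rho^2/4$, and by the choice of $\rho$ the
  -- critical one is at most $\rho^2/8$. Their sum is less than $\rho^2/2$, so the energy is
  -- positive there and exceeds its value at $0$.
  refine ⟨ρ, hρ0, ρ ^ 2 / (4 * (M + 1)), by positivity, fun lam hlam hlam' => ?_⟩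
  obtain ⟨u, hu, hmin⟩ := hS.exists_minimizer hK hs hns hΩb hΩ hg hr hr1 hρ0.le hμ.le hlam.le
    hsmall.le
  refine ⟨u, hu.1, hu.2.1, lt_of_le_of_ne hu.2.2 fun hnorm => ?_, hmin⟩
  have h0 : (0 : EuclideanSpace ℝ (Fin n) → ℝ) ∈ coneBall K Ω ρ := by
    refine ⟨X₀_zero, fun _ => le_rfl, ?_⟩
    have h0 := hK.norm₀_smul (Ω := Ω) (u := 0) 0
    rw [zero_smul, abs_zero, zero_mul] at h0
    exact h0.trans_le hρ0.le
  have hJ := hmin 0 h0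
  rw [hS.coneEnergy_zero hK hr, coneEnergy, hnorm] at hJ
  have e1 := hS.integral_rpow_le hu.1 hu.2.1
  rw [hnorm] at e1
  have e2 := mul_le_mul_of_nonneg_left (hMb u hu.1 hu.2.1 hu.2.2) hlam.le
  have e3 : lam * M < ρ ^ 2 / 4 := by
    rw [lt_div_iff₀ (by positivity)] at hlam'
    nlinarith
  have e4 : (S * ρ) ^ p ≤ S ^ 2 * (2 * S * ρ) ^ (p - 2) * ρ ^ 2 := by
    have : (S * ρ) ^ p = (S * ρ) ^ (p - 2) * (S * ρ) ^ 2 := by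
      rw [← Real.rpow_natCast (S * ρ) 2, ← Real.rpow_add (by positivity)]
      congr 1
      push_cast; ring
    rw [this]
    have h3 : (S * ρ) ^ (p - 2) ≤ (2 * S * ρ) ^ (p - 2) :=
      Real.rpow_le_rpow (by positivity) (by nlinarith) (by linarith)
    calc (S * ρ) ^ (p - 2) * (S * ρ) ^ 2 ≤ (2 * S * ρ) ^ (p - 2) * (S * ρ) ^ 2 := by gcongr
      _ = _ := by ring
  set Y := S ^ 2 * (2 * S * ρ) ^ (p - 2) with hY
  have hY0 : 0 ≤ Y := by positivity
  have e5 : μ * Y ≤ 1 / 4 := by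
    have : μ * Y ≤ (p - 1) * (μ * Y) := le_mul_of_one_le_left (by positivity) (by linarith)
    linarith
  have e6 : μ / p * (∫ x in Ω, u x ^ p) ≤ ρ ^ 2 / 8 := by
    calc μ / p * (∫ x in Ω, u x ^ p) ≤ μ / p * (Y * ρ ^ 2) := by
          have : 0 ≤ μ / p := div_nonneg hμ.le (by linarith)
          gcongr
          exact e1.trans e4
      _ = μ * Y * ρ ^ 2 / p := by ring
      _ ≤ 1 / 4 * ρ ^ 2 / 2 := by gcongr
      _ = _ := by ring
  nlinarith [sq_pos_of_pos hρ0]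

/-- If $\|v-u\|<\rho-\|u\|$, then $v^+$ lies in the ball of radius $\rho$, where `u` is minimal, and
the energy of $v^+$ does not exceed that of `v`. -/
theorem IsInteriorMinimizer.isLocalMinimizer
    (hS : HasSobolevBound K Ω (twoStar n s) S) (hK : IsSingularKernel s K) (hΩf : volume Ω ≠ ∞)
    (hg : IsSubcritical (twoStar n s) a₁ a₂ q fun t => g (max t 0)) (hr : 0 < r) (hr1 : r < 1)
    (hu : IsInteriorMinimizer K Ω (twoStar n s) r (fun t => g (max t 0)) lam μ ρ u) :
    IsLocalMinimizer K Ω (energy s K Ω r g lam μ) u := by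
  refine ⟨hu.mem, ρ - norm₀ K Ω u, sub_pos.2 hu.norm_lt, fun v hv hvu => ?_⟩
  have hpos : (fun x => max (u x) 0) = u := funext fun x => max_eq_left (hu.nonneg x)
  have h1 := hK.norm₀_add_le hu.mem (X₀_sub hv hu.mem)
  rw [add_sub_cancel] at h1
  have h2 := hK.norm₀_posPart_le hv
  have h3 := hu.le _ ⟨hK.mem_X₀_posPart hv, fun x => le_max_right _ _, by linarith⟩
  have h4 := pow_le_pow_left₀ norm₀_nonneg h2 2
  rw [hS.energy_eq hK hΩf hg hr hr1 hu.mem, hS.energy_eq hK hΩf hg hr hr1 hv, hpos]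
  linarith

theorem IsInteriorMinimizer.isWeakSolution
    (hS : HasSobolevBound K Ω (twoStar n s) S) (hK : IsSingularKernel s K) (hΩo : IsOpen Ω)
    (hΩb : Bornology.IsBounded Ω)
    (hg : IsSubcritical (twoStar n s) a₁ a₂ q fun t => g (max t 0)) (hr : 0 < r) (hr1 : r < 1)
    (hlam : 0 < lam) (hμ : 0 < μ)
    (hu : IsInteriorMinimizer K Ω (twoStar n s) r (fun t => g (max t 0)) lam μ ρ u) :
    IsWeakSolution s K Ω r g lam μ u := by
  have hΩf : volume Ω ≠ ∞ := hΩb.measure_lt_top.ne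
  have hpos := hu.ae_pos hK hS hΩf hg hr hr1 hlam hμ hΩo hΩb
  -- All terms of the reaction are nonnegative, so each is dominated by the whole and the integral
  -- of the reaction may be split.
  have hdom : ∀ (F : ℝ → ℝ) (C : ℝ), Measurable F → (∀ t, 0 ≤ t → 0 ≤ F t) →
      (∀ t, 0 ≤ t →
        C * F t ≤ reaction (twoStar n s) r (fun t => g (max t 0)) lam μ t) → 0 < C →
      ∀ v ∈ X₀ K Ω, IntegrableOn (fun x => F (u x) * v x) Ω volume := by
    intro F C hF hF0 hFC hC v hv
    have hi := hu.integrable_reaction_mul hK hS hΩf hg hr hr1 hlam hμ hpos hv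
    refine Integrable.mono (hi.const_mul C⁻¹) ((hF.comp_aemeasurable
      hu.mem.1.1.restrict.aemeasurable).aestronglyMeasurable.mul hv.1.1.restrict)
      (.of_forall fun x => ?_)
    rw [norm_mul, ← mul_assoc, norm_mul]
    gcongr
    have h1 := hF0 _ (hu.nonneg x)
    have h2 := hFC _ (hu.nonneg x)
    rw [Real.norm_eq_abs, Real.norm_eq_abs, abs_of_nonneg h1]
    refine le_trans ?_ (le_abs_self _)
    rw [← div_eq_inv_mul, le_div_iff₀ hC, mul_comm]
    exact h2
  have hgm := hg.continuous.measurable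
  have hg0 := hg.nonneg
  have i1 := hdom (fun t => t ^ (twoStar n s - 1)) μ (by fun_prop)
    (fun t ht => by positivity) (fun t ht => by
      have h1 := hg0 t
      have h2 : 0 ≤ lam * (t ^ (r - 1) + g (max t 0)) := by positivity
      simp only [reaction]
      linarith) hμ
  have i2 := hdom (fun t => t ^ (r - 1)) lam (by fun_prop)
    (fun t ht => by positivity) (fun t ht => by
      have h1 := mul_nonneg hlam.le (hg0 t)
      have h2 : 0 ≤ μ * t ^ (twoStar n s - 1) := by positivity
      simp only [reaction]
      linarith) hlam
  have i3 := hdom (fun t => t ^ (r - 1) + g (max t 0)) lam ((measurable_id.pow_const _).add hgm)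
    (fun t ht => add_nonneg (by positivity) (hg0 t)) (fun t ht => by
      have h2 : 0 ≤ μ * t ^ (twoStar n s - 1) := by positivity
      simp only [reaction]
      linarith) hlam
  refine ⟨hu.mem, hpos, i2, fun v hv => ?_⟩
  have h := hu.weak_eq hK hS hΩf hg hr hr1 hlam hμ hpos hv
  have e : ∫ x in Ω, reaction (twoStar n s) r (fun t => g (max t 0)) lam μ (u x) * v x
      = μ * (∫ x in Ω, u x ^ (twoStar n s - 1) * v x)
        + lam * ∫ x in Ω, (u x ^ (r - 1) + g (u x)) * v x := by
    rw [← integral_const_mul, ← integral_const_mul, ← integral_add ((i1 v hv).const_mul μ)]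
    · congr 1; ext x
      simp only [reaction, max_eq_left (hu.nonneg x)]
      ring
    · refine ((i3 v hv).const_mul lam).congr (.of_forall fun x => ?_)
      simp only [max_eq_left (hu.nonneg x)]
  rw [h, e]
  ring

/-- The function `k_μ` has a positive maximum on the half line. -/
theorem exists_isMaxOn_kFun (hp : 2 < twoStar n s) (hc : 0 < embConst K Ω (twoStar n s))
    (hΩ : 0 < volume.real Ω) (hr : 0 < r) (hr1 : r < 1) (ha₁ : 0 ≤ a₁) (ha₂ : 0 ≤ a₂)
    (hq : 1 ≤ q) (hμ : 0 < μ) :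
    ∃ t ∈ Ici (0 : ℝ), IsMaxOn (kFun s K Ω r a₁ a₂ q μ) (Ici 0) t ∧
      0 < kFun s K Ω r a₁ a₂ q μ t := by
  set p := twoStar n s with hpdef
  set c := embConst K Ω p with hcdef
  set V := volume.real Ω with hV
  set N : ℝ → ℝ := fun t => t ^ (2 - r) - μ * c ^ p * t ^ (p - r) with hN
  set D : ℝ → ℝ := fun t => c ^ r * V ^ ((p - r) / p) + a₁ * c * V ^ ((p - 1) / p) * t ^ (1 - r)
    + a₂ * c ^ q * V ^ ((p - q) / p) * t ^ (q - r) with hD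
  have hk : kFun s K Ω r a₁ a₂ q μ = fun t => N t / D t := rfl
  rw [hk]
  have hDpos : ∀ t, 0 ≤ t → 0 < D t := fun t ht => by
    simp only [hD]
    positivity
  have hNcont : Continuous N :=
    (Real.continuous_rpow_const (by linarith)).sub
      ((Real.continuous_rpow_const (by linarith)).const_mul _)
  have hDcont : Continuous D :=
    (continuous_const.add ((Real.continuous_rpow_const (by linarith)).const_mul _)).add
      ((Real.continuous_rpow_const (by linarith)).const_mul _)
  have hNfac : ∀ t : ℝ, 0 < t → N t = t ^ (2 - r) * (1 - μ * c ^ p * t ^ (p - 2)) := fun t ht => by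
    simp only [hN]
    rw [show p - r = (2 - r) + (p - 2) by ring, Real.rpow_add ht]
    ring
  -- The positive zero of the numerator, which is positive on $(0,T)$ and nonpositive beyond $T$; a
  -- maximum over $[0,T]$ is therefore positive and global.
  set T : ℝ := (1 / (μ * c ^ p)) ^ (1 / (p - 2)) with hT
  have hT0 : 0 < T := by positivity
  have hTp : μ * c ^ p * T ^ (p - 2) = 1 := by
    rw [hT, ← Real.rpow_mul (by positivity), one_div (p - 2), inv_mul_cancel₀ (by linarith),
      Real.rpow_one, mul_one_div_cancel (by positivity)]
  obtain ⟨t₀, ht₀, hmax⟩ := (isCompact_Icc (a := (0 : ℝ)) (b := T)).exists_isMaxOn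
    (nonempty_Icc.2 hT0.le) (f := fun t => N t / D t)
    (hNcont.continuousOn.div hDcont.continuousOn fun t ht => (hDpos t ht.1).ne')
  have hpos : 0 < N t₀ / D t₀ := by
    have h1 : 0 < N (T / 2) := by
      rw [hNfac _ (by positivity)]
      have h2 : (T / 2) ^ (p - 2) < T ^ (p - 2) :=
        Real.rpow_lt_rpow (by positivity) (by linarith) (by linarith)
      have h3 : 0 < μ * c ^ p := by positivity
      have h4 := mul_lt_mul_of_pos_left h2 h3
      rw [hTp] at h4
      exact mul_pos (by positivity) (by linarith)
    have h2 := hmax (⟨by positivity, by linarith⟩ : T / 2 ∈ Icc 0 T)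
    exact (div_pos h1 (hDpos _ (by positivity))).trans_le h2
  refine ⟨t₀, ht₀.1, fun t ht => ?_, hpos⟩
  rcases le_total t T with h | h
  · exact hmax ⟨ht, h⟩
  · have ht0 : 0 < t := hT0.trans_le h
    have h1 : N t ≤ 0 := by
      rw [hNfac t ht0]
      have h2 : T ^ (p - 2) ≤ t ^ (p - 2) := Real.rpow_le_rpow hT0.le h (by linarith)
      have h3 : 0 < μ * c ^ p := by positivity
      have h4 := mul_le_mul_of_nonneg_left h2 h3.le
      rw [hTp] at h4
      exact mul_nonpos_of_nonneg_of_nonpos (by positivity) (by linarith)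
    exact (div_nonpos_of_nonpos_of_nonneg h1 (hDpos t ht).le).trans hpos.le

end

end NonlocalCritical

end

theorem theorem3p4 (n : ℕ) (s : ℝ) (hs0 : 0 < s) (hs1 : s < 1) (hns : 2 * s < n)
    (Ω : Set (EuclideanSpace ℝ (Fin n))) (hΩo : IsOpen Ω) (hΩb : Bornology.IsBounded Ω)
    (hΩne : Ω.Nonempty) (hΩL : NonlocalCritical.HasLipschitzBoundary Ω)
    (K : EuclideanSpace ℝ (Fin n) → ℝ)
    (hK1 : Integrable (fun x => min (‖x‖ ^ 2) 1 * K x) volume)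
    (hK2 : ∃ k₀ : ℝ, 0 < k₀ ∧ ∀ x, x ≠ 0 → k₀ / ‖x‖ ^ ((n : ℝ) + 2 * s) ≤ K x)
    (r : ℝ) (hr0 : 0 < r) (hr1 : r < 1)
    (g : ℝ → ℝ) (hgc : ContinuousOn g (Set.Ici 0)) (hg0 : ∀ t, 0 ≤ t → 0 ≤ g t)
    (a₁ a₂ q : ℝ) (ha₁ : 0 ≤ a₁) (ha₂ : 0 ≤ a₂)
    (hq1 : 1 ≤ q) (hq2 : q < NonlocalCritical.twoStar n s)
    (hg : ∀ t, 0 ≤ t → g t ≤ a₁ + a₂ * t ^ (q - 1)) :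
    ∀ μ : ℝ, 0 < μ →
      ∃ tmax ∈ Set.Ici (0 : ℝ),
        IsMaxOn (NonlocalCritical.kFun s K Ω r a₁ a₂ q μ) (Set.Ici 0) tmax ∧
        ∃ α β : ℝ, α < β ∧ Set.Ioo α β ⊆ Set.Ioo 0 (NonlocalCritical.kFun s K Ω r a₁ a₂ q μ tmax) ∧
          ∀ lam ∈ Set.Ioo α β, ∃ u : EuclideanSpace ℝ (Fin n) → ℝ,
            NonlocalCritical.IsWeakSolution s K Ω r g lam μ u ∧
            NonlocalCritical.IsLocalMinimizer K Ω
              (NonlocalCritical.energy s K Ω r g lam μ) u := by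
  intro μ hμ
  have hn : 0 < n := by
    have : (0 : ℝ) < n := by linarith
    exact_mod_cast this
  have hK : NonlocalCritical.IsSingularKernel s K := ⟨hn, hK1, hK2⟩
  have hΩ := hΩo.measurableSet
  have hp := NonlocalCritical.two_lt_twoStar hs0 hns
  obtain ⟨S, hSp, hSb⟩ := hK.exists_sobolev hs0 hns hΩb hΩ
  have hS : NonlocalCritical.HasSobolevBound K Ω (NonlocalCritical.twoStar n s) S := ⟨hp, hSp, hSb⟩
  have hV : 0 < volume.real Ω :=
    ENNReal.toReal_pos (hΩo.measure_pos volume hΩne).ne' hΩb.measure_lt_top.ne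
  obtain ⟨tmax, ht, hmax, hpos⟩ := NonlocalCritical.exists_isMaxOn_kFun hp
    (hK.embConst_pos hs0 hns hΩo hΩb hΩne) hV hr0 hr1 ha₁ ha₂ hq1 hμ
  have hsub := NonlocalCritical.IsSubcritical.of_continuousOn hgc hg0 ha₁ ha₂ hq1 hq2 hg
  obtain ⟨ρ, hρ, lam₀, hlam₀, hex⟩ :=
    hS.exists_interiorMinimizer hK hs0 hns hΩb hΩ hsub hr0 hr1 hμ
  -- Every sufficiently small $\lambda>0$ is admissible; the right endpoint is capped by the maximum
  -- of $k_\mu$, which is positive, so the interval is non-empty.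
  refine ⟨tmax, ht, hmax, 0, min lam₀ (NonlocalCritical.kFun s K Ω r a₁ a₂ q μ tmax),
    lt_min hlam₀ hpos, Set.Ioo_subset_Ioo le_rfl (min_le_right _ _), fun lam hlam => ?_⟩
  obtain ⟨u, hu⟩ := hex lam hlam.1 (hlam.2.trans_le (min_le_left _ _))
  exact ⟨u, hu.isWeakSolution hS hK hΩo hΩb hsub hr0 hr1 hlam.1 hμ,
    hu.isLocalMinimizer hS hK hΩb.measure_lt_top.ne hsub hr0 hr1⟩
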